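/- \textbf{Setting.} An \emph{asymptotic couple} is a pair $(\Gamma,\psi)$ of a (totally) ordered abelian group $\Gamma$ and a map $\psi:\Gamma\setminus\{0\}\to\Gamma$ such that for all nonzero $\alpha,\beta\in\Gamma$: (AC1) $\psi(\alpha+\beta)\ge\min(\psi(\alpha),\psi(\beta))$ if $\alpha+\beta\ne0$; (AC2) $\psi(r\alpha)=\psi(\alpha)$ for all nonzero integers $r$; (AC3) $\alpha>0$ implies $\alpha+\psi(\alpha)>\psi(\beta)$. It is of \emph{$H$-type} if moreover $0<\alpha\le\beta$ implies $\psi(\alpha)\ge\psi(\beta)$; it is \emph{divisible} if $\Gamma$ is; it has \emph{asymptotic integration} if every $\alpha\in\Gamma$ equals $\beta+\psi(\beta)$ for some $\beta\ne0$ in $\Gamma$. This $\beta$ is then unique and denoted $\int\alpha$, and $s(\alpha):=\psi(\int\alpha)$. Put $\Psi:=\psi(\Gamma\setminus\{0\})$ and $\Psi^{>s0}:=\{\gamma\in\Psi:\gamma>s(0)\}$. Let $L_0=\{0,+,-,<,\psi,\infty\}$. Every asymptotic couple is regarded as an $L_0$-structure with underlying set $\Gamma_\infty=\Gamma\cup\{\infty\}$,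 where $\gamma<\infty$ for all $\gamma\in\Gamma$ and $-\infty=\gamma+\infty=\infty+\gamma=\infty+\infty=\psi(0)=\psi(\infty)=\infty$. Let $T_0$ be the $L_0$-theory whose models are (up to isomorphism) the divisible $H$-asymptotic couples with asymptotic integration such that $\Psi$ has a least element, equal to $s(0)$, and $s(0)>0$; each $\alpha\in\Psi$ has an immediate successor in $\Psi$, equal to $s(\alpha)$; and $\gamma\mapsto s(\gamma)$ is a bijection $\Psi\to\Psi^{>s0}$. Let $L=L_0\cup\{s,p,\delta_1,\delta_2,\delta_3,\dots\}$ with unary function symbols $s,p,\delta_n$ $(n\ge1)$. Each model of $T_0$ is regarded as an $L$-structure: $s$ is the function above on $\Gamma$; $p$ is the inverse of $s:\Psi\to\Psi^{>s0}$ on $\Psi^{>s0}$ and takes the value $\infty$ elsewhere; $\delta_n$ is division by $n$ on $\Gamma$; and $s(\infty)=p(\infty)=\delta_n(\infty)=\infty$. Let $T_{\log}$ be the $L$-theory whose models are the models of $T_0$, viewed as $L$-structures in this way. \textbf{Statement.} The theory $T_{\log}$ is complete (that is, it is satisfiable and entails each $L$-sentence or its negation) and has quantifier elimination: modulo $T_{\log}$,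 every $L$-formula in finitely many (possibly zero) free variables is equivalent to a quantifier-free $L$-formula in the same free variables. The theory $T_0$ is complete and model complete: whenever $M\subseteq N$ are models of $T_0$, $M$ is an elementary substructure of $N$. -/

import Mathlib

universe u v w

namespace AsymCouple

open FirstOrder FirstOrder.Language

/-! ## General model-theoretic notions -/

/-- Quantifier elimination: modulo `T`, every formula in finitely many free variables (also in
none) is equivalent to a quantifier-free formula in the same variables. -/
def HasQE {L : FirstOrder.Language.{u, v}} (T : L.Theory) : Prop :=
  ∀ (n : ℕ) (φ : L.Formula (Fin n)), ∃ θ : L.Formula (Fin n),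
    BoundedFormula.IsQF θ ∧ φ ⇔[T] θ

/-- Model completeness: whenever `S ⊆ N` are models of `T`, `S` is an elementary substructure
of `N`. -/
def IsModelComplete {L : FirstOrder.Language.{u, v}} (T : L.Theory) : Prop :=
  ∀ (N : Type w) [L.Structure N] [Nonempty N] (S : L.Substructure N) [Nonempty S],
    N ⊨ T → S ⊨ T → S.IsElementary

/-! ## The languages -/

/-- Function symbols `0, ∞, +, -, ψ`. -/
inductive L0Func : ℕ → Type
  | zero : L0Func 0
  | infty : L0Func 0
  | add : L0Func 2
  | neg : L0Func 1
  | psi : L0Func 1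

/-- The relation symbol `<`. -/
inductive L0Rel : ℕ → Type
  | lt : L0Rel 2

/-- The language `{0, +, -, <, ψ, ∞}` of asymptotic couples. -/
def L0 : FirstOrder.Language := ⟨L0Func, L0Rel⟩

/-- The additional unary function symbols `s`, `p` and `δ_n` for `n ≥ 1`. -/
inductive NewFunc : ℕ → Type
  | succ : NewFunc 1
  | pred : NewFunc 1
  | delta (n : ℕ+) : NewFunc 1

/-- The language consisting only of the additional symbols. -/
def Lnew : FirstOrder.Language := ⟨NewFunc, fun _ => Empty⟩

/-- The language `L0 ∪ {s, p, δ_1, δ_2, …}`. -/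
abbrev Llog : FirstOrder.Language := L0.sum Lnew

/-! ## Asymptotic couples -/

section Couples

variable {Γ : Type u} [AddCommGroup Γ] [LinearOrder Γ]

/-- `(Γ, ψ)` is an asymptotic couple. Here `ψ` matters only on nonzero elements; its value
at `0` is never used. -/
structure IsCouple (ψ : Γ → Γ) : Prop where
  ac1 : ∀ α β : Γ, α ≠ 0 → β ≠ 0 → α + β ≠ 0 → min (ψ α) (ψ β) ≤ ψ (α + β)
  ac2 : ∀ (r : ℤ) (α : Γ), r ≠ 0 → α ≠ 0 → ψ (r • α) = ψ α
  ac3 : ∀ α β : Γ, 0 < α → β ≠ 0 → ψ β < α + ψ α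

/-- `Ψ = ψ(Γ \ {0})`. -/
def PsiSet (ψ : Γ → Γ) : Set Γ := ψ '' {α | α ≠ 0}

/-- `∫ α`: an element `β ≠ 0` with `β + ψ β = α` (unique in an asymptotic couple). -/
noncomputable def integral (ψ : Γ → Γ) (α : Γ) : Γ :=
  Classical.epsilon fun β => β ≠ 0 ∧ β + ψ β = α

/-- The successor function `s α = ψ (∫ α)`. -/
noncomputable def succ (ψ : Γ → Γ) (α : Γ) : Γ := ψ (integral ψ α)

/-- The divisible `H`-asymptotic couples with asymptotic integration such that `Ψ` has least
element `s 0 > 0`, each `α ∈ Ψ` has immediate successor `s α` in `Ψ`, and `s` restricts to a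
bijection from `Ψ` onto `{γ ∈ Ψ | s 0 < γ}`. -/
structure IsLogCouple (ψ : Γ → Γ) : Prop extends IsCouple ψ where
  hType : ∀ α β : Γ, 0 < α → α ≤ β → ψ β ≤ ψ α
  divisible : ∀ (n : ℕ+) (α : Γ), ∃ β : Γ, (n : ℕ) • β = α
  integration : ∀ α : Γ, ∃ β : Γ, β ≠ 0 ∧ β + ψ β = α
  least : IsLeast (PsiSet ψ) (succ ψ 0)
  succ_zero_pos : 0 < succ ψ 0
  succ_isLeast : ∀ α ∈ PsiSet ψ, IsLeast {β ∈ PsiSet ψ | α < β} (succ ψ α)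
  succ_bijOn : Set.BijOn (succ ψ) (PsiSet ψ) {β ∈ PsiSet ψ | succ ψ 0 < β}

/-- The set `Γ_∞ = Γ ∪ {∞}` on which `(Γ, ψ)` is considered as a structure. -/
def Ginf (_ψ : Γ → Γ) : Type u := WithTop Γ

/-- Extends a function `Γ → Γ_∞` by the default value `∞` at `∞`. -/
def extTop (f : Γ → WithTop Γ) : WithTop Γ → WithTop Γ
  | ⊤ => ⊤
  | (a : Γ) => f a

/-- Negation on `Γ_∞`. -/
def negInf : WithTop Γ → WithTop Γ := extTop fun a => ((-a : Γ) : WithTop Γ)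

open Classical in
/-- `ψ` on `Γ_∞`, with `ψ 0 = ψ ∞ = ∞`. -/
noncomputable def psiInf (ψ : Γ → Γ) : WithTop Γ → WithTop Γ :=
  extTop fun a => if a = 0 then ⊤ else ((ψ a : Γ) : WithTop Γ)

/-- `s` on `Γ_∞`. -/
noncomputable def succInf (ψ : Γ → Γ) : WithTop Γ → WithTop Γ :=
  extTop fun a => ((succ ψ a : Γ) : WithTop Γ)

open Classical in
/-- `p` on `Γ_∞`: the inverse of `s : Ψ → Ψ^{> s 0}`, with value `∞` outside `Ψ^{> s 0}`. -/
noncomputable def predInf (ψ : Γ → Γ) : WithTop Γ → WithTop Γ :=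
  extTop fun a => if a ∈ PsiSet ψ ∧ succ ψ 0 < a then
    ((Function.invFunOn (succ ψ) (PsiSet ψ) a : Γ) : WithTop Γ) else ⊤

/-- `δ_n` on `Γ_∞`: division by `n` on `Γ`. -/
noncomputable def deltaInf (n : ℕ+) : WithTop Γ → WithTop Γ :=
  extTop fun a => ((Classical.epsilon fun b : Γ => (n : ℕ) • b = a : Γ) : WithTop Γ)

/-- `(Γ, ψ)` as an `L0`-structure with underlying set `Γ_∞`. -/
noncomputable instance ginfL0 (ψ : Γ → Γ) : L0.Structure (Ginf ψ) where
  funMap {n} (f : L0Func n) := match n, f with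
    | _, .zero => fun _ => ((0 : Γ) : WithTop Γ)
    | _, .infty => fun _ => (⊤ : WithTop Γ)
    | _, .add => fun x => (show WithTop Γ from x 0) + (show WithTop Γ from x 1)
    | _, .neg => fun x => negInf (x 0)
    | _, .psi => fun x => psiInf ψ (x 0)
  RelMap {n} (r : L0Rel n) := match n, r with
    | _, .lt => fun x => (show WithTop Γ from x 0) < (show WithTop Γ from x 1)

/-- The additional functions `s`, `p` and `δ_n` on `Γ_∞`. -/
noncomputable instance ginfLnew (ψ : Γ → Γ) : Lnew.Structure (Ginf ψ) where
  funMap {n} (f : NewFunc n) := match n, f with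
    | _, .succ => fun x => succInf ψ (x 0)
    | _, .pred => fun x => predInf ψ (x 0)
    | _, .delta n => fun x => deltaInf n (x 0)
  RelMap {_} (r : Empty) := r.elim

end Couples

/-! ## Terms and formulas -/

section Formulas

variable {n : ℕ}

/-- `L0`-terms in the variables `&0, …, &(n-1)`. -/
abbrev T0Term (n : ℕ) := L0.Term (Empty ⊕ Fin n)

/-- `L0`-formulas in the variables `&0, …, &(n-1)`. -/
abbrev Fml (n : ℕ) := L0.BoundedFormula Empty n

/-- The term `0`. -/
def zeroT : T0Term n := Constants.term (L := L0) L0Func.zero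
/-- The term `∞`. -/
def inftyT : T0Term n := Constants.term (L := L0) L0Func.infty
/-- The term `t₁ + t₂`. -/
def addT (t₁ t₂ : T0Term n) : T0Term n := Functions.apply₂ (L := L0) L0Func.add t₁ t₂
/-- The term `-t`. -/
def negT (t : T0Term n) : T0Term n := Functions.apply₁ (L := L0) L0Func.neg t
/-- The term `ψ t`. -/
def psiT (t : T0Term n) : T0Term n := Functions.apply₁ (L := L0) L0Func.psi t
/-- The term `k t = 0 + t + ⋯ + t`. -/
def nsmulT : ℕ → T0Term n → T0Term n
  | 0, _ => zeroT
  | k + 1, t => addT (nsmulT k t) t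
/-- The formula `t₁ < t₂`. -/
def ltF (t₁ t₂ : T0Term n) : Fml n := Relations.boundedFormula₂ (L := L0) L0Rel.lt t₁ t₂
/-- The formula `t₁ < t₂ ∨ t₁ = t₂`. -/
def leF (t₁ t₂ : T0Term n) : Fml n := ltF t₁ t₂ ⊔ t₁ =' t₂
/-- The formula `t ≠ ∞`, expressing `t ∈ Γ`. -/
def finF (t : T0Term n) : Fml n := ∼(t =' inftyT)
/-- The formula `t ≠ 0 ∧ t ≠ ∞`, expressing `t ∈ Γ \ {0}`. -/
def nzF (t : T0Term n) : Fml n := ∼(t =' zeroT) ⊓ ∼(t =' inftyT)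
/-- The formula expressing that the `i`-th variable lies in `Ψ`. -/
def inPsiF (i : Fin n) : Fml n :=
  ∃' (nzF (&(Fin.last n)) ⊓ psiT (&(Fin.last n)) =' (&i.castSucc))
/-- The formula expressing, for the `i`-th and `j`-th variables `x, y`, that `x, y ∈ Γ` and
`s x = y`, that is, that `y = ψ z` for some `z ∈ Γ \ {0}` with `z + ψ z = x`. -/
def succF (i j : Fin n) : Fml n :=
  finF (&i) ⊓ ∃' (nzF (&(Fin.last n)) ⊓
    addT (&(Fin.last n)) (psiT (&(Fin.last n))) =' (&i.castSucc) ⊓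
    psiT (&(Fin.last n)) =' (&j.castSucc))
/-- The formula expressing, for the `i`-th variable `x`, that `x = s 0`. -/
def succZeroF (i : Fin n) : Fml n :=
  ∃' (&(Fin.last n) =' zeroT ⊓ succF (Fin.last n) i.castSucc)
/-- The formula expressing, for the `i`-th variable `x`, that `x ∈ Ψ` and `s 0 < x`. -/
def inPsiGtF (i : Fin n) : Fml n :=
  inPsiF i ⊓ ∃' (succZeroF (Fin.last n) ⊓ ltF (&(Fin.last n)) (&i.castSucc))

end Formulas

/-! ## The theories -/

/-- `Γ_∞` is totally ordered with largest element `∞`. -/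
def orderAxioms : L0.Theory :=
  {∀' (∼(ltF &0 &0)),
   ∀' ∀' ∀' (ltF &0 &1 ⟹ ltF &1 &2 ⟹ ltF &0 &2),
   ∀' ∀' (ltF &0 &1 ⊔ (&0 =' &1) ⊔ ltF &1 &0),
   ∀' (finF &0 ⟹ ltF &0 inftyT)}

/-- `Γ` is an ordered abelian group, and `∞` is the default value for `+` and `-`. -/
def groupAxioms : L0.Theory :=
  {finF zeroT,
   ∀' ∀' (finF &0 ⟹ finF &1 ⟹ finF (addT &0 &1)),
   ∀' (finF &0 ⟹ finF (negT &0)),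
   ∀' ∀' ∀' (addT (addT &0 &1) &2 =' addT &0 (addT &1 &2)),
   ∀' ∀' (addT &0 &1 =' addT &1 &0),
   ∀' (addT &0 zeroT =' &0),
   ∀' (finF &0 ⟹ addT &0 (negT &0) =' zeroT),
   ∀' ∀' ∀' (finF &0 ⟹ finF &1 ⟹ finF &2 ⟹ ltF &0 &1 ⟹ ltF (addT &0 &2) (addT &1 &2)),
   ∀' (addT &0 inftyT =' inftyT),
   negT inftyT =' inftyT}

/-- `ψ` maps `Γ \ {0}` to `Γ`, is `∞` at `0` and `∞`, and satisfies (AC1), (AC2), (AC3), (HC). -/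
def psiAxioms : L0.Theory :=
  {psiT zeroT =' inftyT,
   psiT inftyT =' inftyT,
   ∀' (nzF &0 ⟹ finF (psiT &0)),
   ∀' ∀' (nzF &0 ⟹ nzF &1 ⟹ nzF (addT &0 &1) ⟹
      (leF (psiT &0) (psiT (addT &0 &1)) ⊔ leF (psiT &1) (psiT (addT &0 &1)))),
   ∀' ∀' (finF &0 ⟹ ltF zeroT &0 ⟹ nzF &1 ⟹ ltF (psiT &1) (addT &0 (psiT &0))),
   ∀' ∀' (finF &0 ⟹ finF &1 ⟹ ltF zeroT &0 ⟹ leF &0 &1 ⟹ leF (psiT &1) (psiT &0))} ∪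
  {φ | ∃ k : ℕ+, φ = ∀' (nzF &0 ⟹ psiT (nsmulT k &0) =' psiT &0)} ∪
  {φ | ∃ k : ℕ+, φ = ∀' (nzF &0 ⟹ psiT (negT (nsmulT k &0)) =' psiT &0)}

/-- `Γ` is divisible. -/
def divAxioms : L0.Theory :=
  {φ | ∃ k : ℕ+, φ = ∀' (finF &0 ⟹ ∃' (finF &1 ⊓ nsmulT k &1 =' &0))}

/-- Asymptotic integration; `Ψ` has least element `s 0 > 0`; each `α ∈ Ψ` has immediate
successor `s α` in `Ψ`; `s : Ψ → Ψ^{> s 0}` is well-defined, injective and surjective. -/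
def succAxioms : L0.Theory :=
  {∀' (finF &0 ⟹ ∃' (nzF &1 ⊓ addT &1 (psiT &1) =' &0)),
   ∀' (succZeroF 0 ⟹ (ltF zeroT &0 ⊓ inPsiF 0 ⊓ ∀' (inPsiF 1 ⟹ leF &0 &1))),
   ∀' ∀' (inPsiF 0 ⟹ succF 0 1 ⟹
      (inPsiF 1 ⊓ ltF &0 &1 ⊓ ∀' (inPsiF 2 ⟹ ltF &0 &2 ⟹ leF &1 &2))),
   ∀' ∀' (inPsiF 0 ⟹ succF 0 1 ⟹ inPsiGtF 1),
   ∀' ∀' ∀' (inPsiF 0 ⟹ inPsiF 1 ⟹ succF 0 2 ⟹ succF 1 2 ⟹ &0 =' &1),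
   ∀' (inPsiGtF 0 ⟹ ∃' (inPsiF 1 ⊓ succF 1 0))}

/-- The `L0`-theory whose models are (up to isomorphism) the couples as in `IsLogCouple`;
see `model_T0_iff`. -/
def T0 : L0.Theory := orderAxioms ∪ groupAxioms ∪ psiAxioms ∪ divAxioms ∪ succAxioms

/-- For each additional function symbol `f`, an `L0`-formula in the variables `x = &0`, `y = &1`
defining the graph `f x = y`. -/
def graphF : NewFunc 1 → Fml 2
  | .succ => ((&0 =' inftyT) ⊓ (&1 =' inftyT)) ⊔ succF 0 1
  | .pred => (inPsiGtF 0 ⊓ inPsiF 1 ⊓ succF 1 0) ⊔ (∼(inPsiGtF 0) ⊓ (&1 =' inftyT))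
  | .delta k => nsmulT k &1 =' &0

/-- The axiom `∀ x y, (f x = y ↔ D_f(x, y))` with `D_f` the formula `graphF f`. -/
def newAxiom (f : NewFunc 1) : Llog.Sentence :=
  ∀' ∀' ((Functions.apply₁ (L := Llog) (Sum.inr f) &0 =' &1) ⇔
    (LHom.sumInl (L := L0) (L' := Lnew)).onBoundedFormula (graphF f))

/-- The `Llog`-theory whose models are the models of `T0` with `s`, `p`, `δ_n` interpreted
in the obvious way; see `model_Tlog_iff`. -/
def Tlog : Llog.Theory :=
  (LHom.sumInl (L := L0) (L' := Lnew)).onTheory T0 ∪ Set.range newAxiom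

/-! ## The models of the theories -/

section Realize

variable (M : Type u) [L0.Structure M]

/-- Interpretation of `0`. -/
def mz : M := Structure.funMap (L := L0) L0Func.zero ![]
/-- Interpretation of `∞`. -/
def mi : M := Structure.funMap (L := L0) L0Func.infty ![]
variable {M}
/-- Interpretation of `+`. -/
def ma (x y : M) : M := Structure.funMap (L := L0) L0Func.add ![x, y]
/-- Interpretation of `-`. -/
def mn (x : M) : M := Structure.funMap (L := L0) L0Func.neg ![x]
/-- Interpretation of `ψ`. -/
def mp (x : M) : M := Structure.funMap (L := L0) L0Func.psi ![x]
/-- Interpretation of `<`. -/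
def ml (x y : M) : Prop := Structure.RelMap (L := L0) L0Rel.lt ![x, y]
/-- The iterated sum `0 + x + ⋯ + x`. -/
def msmul : ℕ → M → M
  | 0, _ => mz M
  | k + 1, x => ma (msmul k x) x
/-- `x ∈ Γ \ {0}`. -/
def mnz (x : M) : Prop := x ≠ mz M ∧ x ≠ mi M
/-- `x ∈ Ψ`. -/
def mPsi (x : M) : Prop := ∃ z, mnz z ∧ mp z = x
/-- `x, y ∈ Γ` and `s x = y`. -/
def mS (x y : M) : Prop := x ≠ mi M ∧ ∃ z, mnz z ∧ ma z (mp z) = x ∧ mp z = y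
/-- `x ∈ Ψ` and `s 0 < x`. -/
def mGt (x : M) : Prop := mPsi x ∧ ∃ z, mS (mz M) z ∧ ml z x

variable {n : ℕ} (v : Empty → M) (xs : Fin n → M)

@[simp] theorem realize_zeroT : (zeroT : T0Term n).realize (Sum.elim v xs) = mz M :=
  Term.realize_constants.trans (congrArg (Structure.funMap (L := L0) L0Func.zero) (Subsingleton.elim _ _))
@[simp] theorem realize_inftyT : (inftyT : T0Term n).realize (Sum.elim v xs) = mi M :=
  Term.realize_constants.trans (congrArg (Structure.funMap (L := L0) L0Func.infty) (Subsingleton.elim _ _))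
@[simp] theorem realize_addT (s t : T0Term n) : (addT s t).realize (Sum.elim v xs) =
    ma (s.realize (Sum.elim v xs)) (t.realize (Sum.elim v xs)) :=
  Term.realize_functions_apply₂
@[simp] theorem realize_negT (t : T0Term n) : (negT t).realize (Sum.elim v xs) =
    mn (t.realize (Sum.elim v xs)) := Term.realize_functions_apply₁
@[simp] theorem realize_psiT (t : T0Term n) : (psiT t).realize (Sum.elim v xs) =
    mp (t.realize (Sum.elim v xs)) := Term.realize_functions_apply₁
@[simp] theorem realize_nsmulT (k : ℕ) (t : T0Term n) : (nsmulT k t).realize (Sum.elim v xs) =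
    msmul k (t.realize (Sum.elim v xs)) := by
  induction k with
  | zero => simp [nsmulT, msmul]
  | succ k ih => simp [nsmulT, msmul, ih]
@[simp] theorem realize_ltF (s t : T0Term n) : (ltF s t).Realize v xs ↔
    ml (s.realize (Sum.elim v xs)) (t.realize (Sum.elim v xs)) :=
  BoundedFormula.realize_rel₂
@[simp] theorem realize_leF (s t : T0Term n) : (leF s t).Realize v xs ↔
    (ml (s.realize (Sum.elim v xs)) (t.realize (Sum.elim v xs)) ∨
      s.realize (Sum.elim v xs) = t.realize (Sum.elim v xs)) := by
  simp [leF]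
@[simp] theorem realize_finF (t : T0Term n) : (finF t).Realize v xs ↔
    t.realize (Sum.elim v xs) ≠ mi M := by
  simp [finF]
@[simp] theorem realize_nzF (t : T0Term n) : (nzF t).Realize v xs ↔
    mnz (t.realize (Sum.elim v xs)) := by
  simp [nzF, mnz]
@[simp] theorem realize_inPsiF (i : Fin n) : (inPsiF i).Realize v xs ↔ mPsi (xs i) := by
  simp [inPsiF, mPsi]
@[simp] theorem realize_succF (i j : Fin n) :
    (succF i j).Realize v xs ↔ mS (xs i) (xs j) := by
  simp [succF, mS, and_assoc]
@[simp] theorem realize_succZeroF (i : Fin n) :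
    (succZeroF i).Realize v xs ↔ mS (mz M) (xs i) := by
  simp [succZeroF]
@[simp] theorem realize_inPsiGtF (i : Fin n) : (inPsiGtF i).Realize v xs ↔ mGt (xs i) := by
  simp [inPsiGtF, mGt]

end Realize
theorem snoc0 {M : Type u} (a : Fin 0 → M) (x : M) : (Fin.snoc a x : Fin 1 → M) 0 = x := rfl
theorem snoc10 {M : Type u} (a : Fin 1 → M) (x : M) : (Fin.snoc a x : Fin 2 → M) 0 = a 0 := rfl
theorem snoc11 {M : Type u} (a : Fin 1 → M) (x : M) : (Fin.snoc a x : Fin 2 → M) 1 = x := rfl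
theorem snoc20 {M : Type u} (a : Fin 2 → M) (x : M) : (Fin.snoc a x : Fin 3 → M) 0 = a 0 := rfl
theorem snoc21 {M : Type u} (a : Fin 2 → M) (x : M) : (Fin.snoc a x : Fin 3 → M) 1 = a 1 := rfl
theorem snoc22 {M : Type u} (a : Fin 2 → M) (x : M) : (Fin.snoc a x : Fin 3 → M) 2 = x := rfl

section Plain
set_option linter.unusedSimpArgs false
variable (M : Type u) [L0.Structure M]

theorem order_iff : M ⊨ orderAxioms ↔ (∀ x : M, ¬ ml x x) ∧
    (∀ x y z : M, ml x y → ml y z → ml x z) ∧ (∀ x y : M, (ml x y ∨ x = y) ∨ ml y x) ∧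
    (∀ x : M, x ≠ mi M → ml x (mi M)) := by
  simp [orderAxioms, Sentence.Realize, Formula.Realize, snoc0, snoc10, snoc11, snoc20, snoc21,
    snoc22]

theorem group_iff : M ⊨ groupAxioms ↔ mz M ≠ mi M ∧
    (∀ x y : M, x ≠ mi M → y ≠ mi M → ma x y ≠ mi M) ∧
    (∀ x : M, x ≠ mi M → mn x ≠ mi M) ∧
    (∀ x y z : M, ma (ma x y) z = ma x (ma y z)) ∧
    (∀ x y : M, ma x y = ma y x) ∧
    (∀ x : M, ma x (mz M) = x) ∧
    (∀ x : M, x ≠ mi M → ma x (mn x) = mz M) ∧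
    (∀ x y z : M, x ≠ mi M → y ≠ mi M → z ≠ mi M → ml x y → ml (ma x z) (ma y z)) ∧
    (∀ x : M, ma x (mi M) = mi M) ∧
    mn (mi M) = mi M := by
  simp [groupAxioms, Sentence.Realize, Formula.Realize, snoc0, snoc10, snoc11, snoc20, snoc21,
    snoc22]

theorem psi_iff : M ⊨ psiAxioms ↔ (mp (mz M) = mi M ∧ mp (mi M) = mi M ∧
    (∀ x : M, mnz x → mp x ≠ mi M) ∧
    (∀ x y : M, mnz x → mnz y → mnz (ma x y) →
      (ml (mp x) (mp (ma x y)) ∨ mp x = mp (ma x y)) ∨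
      (ml (mp y) (mp (ma x y)) ∨ mp y = mp (ma x y))) ∧
    (∀ x y : M, x ≠ mi M → ml (mz M) x → mnz y → ml (mp y) (ma x (mp x))) ∧
    (∀ x y : M, x ≠ mi M → y ≠ mi M → ml (mz M) x → (ml x y ∨ x = y) →
      (ml (mp y) (mp x) ∨ mp y = mp x))) ∧
    (∀ (k : ℕ+) (x : M), mnz x → mp (msmul k x) = mp x) ∧
    (∀ (k : ℕ+) (x : M), mnz x → mp (mn (msmul k x)) = mp x) := by
  simp [psiAxioms, Sentence.Realize, Formula.Realize, snoc0, snoc10, snoc11, snoc20, snoc21,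
    snoc22, or_imp, forall_and, and_assoc]

theorem div_iff : M ⊨ divAxioms ↔
    ∀ (k : ℕ+) (x : M), x ≠ mi M → ∃ y, y ≠ mi M ∧ msmul k y = x := by
  simp [divAxioms, Sentence.Realize, Formula.Realize, snoc0, snoc10, snoc11, snoc20, snoc21,
    snoc22]

theorem succ_iff : M ⊨ succAxioms ↔
    (∀ x : M, x ≠ mi M → ∃ y, mnz y ∧ ma y (mp y) = x) ∧
    (∀ x : M, mS (mz M) x → (ml (mz M) x ∧ mPsi x) ∧ ∀ y, mPsi y → (ml x y ∨ x = y)) ∧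
    (∀ x y : M, mPsi x → mS x y →
      (mPsi y ∧ ml x y) ∧ ∀ z, mPsi z → ml x z → (ml y z ∨ y = z)) ∧
    (∀ x y : M, mPsi x → mS x y → mGt y) ∧
    (∀ x y z : M, mPsi x → mPsi y → mS x z → mS y z → x = y) ∧
    (∀ x : M, mGt x → ∃ y, mPsi y ∧ mS y x) := by
  simp [succAxioms, Sentence.Realize, Formula.Realize, snoc0, snoc10, snoc11, snoc20, snoc21,
    snoc22]

end Plain
section GinfModels

set_option linter.unusedSectionVars false

variable {Γ : Type u} [AddCommGroup Γ] [LinearOrder Γ] {ψ : Γ → Γ}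

/-- The inclusion `Γ → Γ_∞`. -/
def co (ψ : Γ → Γ) (a : Γ) : Ginf ψ := (a : WithTop Γ)

theorem ginf_forall {P : Ginf ψ → Prop} :
    (∀ x, P x) ↔ P (mi _) ∧ ∀ a, P (co ψ a) := WithTop.forall
theorem ginf_exists {P : Ginf ψ → Prop} :
    (∃ x, P x) ↔ P (mi _) ∨ ∃ a, P (co ψ a) := WithTop.exists
@[simp] theorem co_inj {a b : Γ} : co ψ a = co ψ b ↔ a = b := WithTop.coe_inj
@[simp] theorem co_ne (a : Γ) : co ψ a ≠ mi _ := WithTop.coe_ne_top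
@[simp] theorem co_ne2 (a : Γ) : mi _ ≠ co ψ a := WithTop.top_ne_coe
theorem g_mz : mz (Ginf ψ) = co ψ 0 := rfl
@[simp] theorem g_ma (a b : Γ) : ma (co ψ a) (co ψ b) = co ψ (a + b) := rfl
@[simp] theorem g_ma1 (a : Ginf ψ) : ma a (mi _) = mi _ := WithTop.add_top _
@[simp] theorem g_ma2 (a : Ginf ψ) : ma (mi _) a = mi _ := WithTop.top_add _
@[simp] theorem g_mn (a : Γ) : mn (co ψ a) = co ψ (-a) := rfl
@[simp] theorem g_mn1 : mn (mi (Ginf ψ)) = mi _ := rfl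
@[simp] theorem g_mp1 : mp (mi (Ginf ψ)) = mi _ := rfl
theorem g_mp {a : Γ} (h : a ≠ 0) : mp (co ψ a) = co ψ (ψ a) := if_neg h
@[simp] theorem g_mp0 : mp (co ψ 0) = mi _ := if_pos rfl
@[simp] theorem g_ml (a b : Γ) : ml (co ψ a) (co ψ b) ↔ a < b := WithTop.coe_lt_coe
@[simp] theorem g_ml1 (a : Γ) : ml (co ψ a) (mi _) := WithTop.coe_lt_top a
@[simp] theorem g_ml2 (a : Ginf ψ) : ¬ ml (mi _) a := not_top_lt
@[simp] theorem g_msmul (k : ℕ) (a : Γ) : msmul k (co ψ a) = co ψ (k • a) := by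
  induction k with
  | zero => simp [msmul, g_mz]
  | succ k ih => simp [msmul, ih, succ_nsmul]
theorem g_msmul1 (k : ℕ+) : msmul k (mi (Ginf ψ)) = mi _ := by
  obtain ⟨k, hk⟩ := k
  cases k with
  | zero => exact absurd hk (lt_irrefl _)
  | succ k => simp [msmul]
@[simp] theorem g_mnz (a : Γ) : mnz (co ψ a) ↔ a ≠ 0 := by simp [mnz, g_mz]
@[simp] theorem g_mnz1 : ¬ mnz (mi (Ginf ψ)) := by simp [mnz]
@[simp] theorem g_mPsi (a : Γ) : mPsi (co ψ a) ↔ a ∈ PsiSet ψ := by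
  simp only [mPsi, ginf_exists, g_mnz1, false_and, g_mnz, false_or, PsiSet]
  exact exists_congr fun b => and_congr_right fun h => by simp [g_mp h]
@[simp] theorem g_mPsi1 : ¬ mPsi (mi (Ginf ψ)) := by
  simp only [mPsi, ginf_exists, g_mnz1, false_and, g_mnz, false_or]
  rintro ⟨a, h, h'⟩
  simp [g_mp h] at h'
@[simp] theorem g_mS1 (x : Ginf ψ) : ¬ mS (mi _) x := by simp [mS]
@[simp] theorem g_mS2 (x : Ginf ψ) : ¬ mS x (mi _) := by
  simp only [mS, ginf_exists, g_mnz1, false_and, g_mnz, false_or]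
  rintro ⟨-, a, h, -, h'⟩
  simp [g_mp h] at h'
theorem g_mS0 (a b : Γ) : mS (co ψ a) (co ψ b) ↔ ∃ c, c ≠ 0 ∧ c + ψ c = a ∧ ψ c = b := by
  simp only [mS, ginf_exists, g_mnz1, false_and, g_mnz, false_or, ne_eq, co_ne, not_false_eq_true,
    true_and]
  exact exists_congr fun c => and_congr_right fun h => by simp [g_mp h]

variable [IsOrderedAddMonoid Γ]

/-- Integrals in an asymptotic couple are unique. -/
theorem IsCouple.integral_unique (h : IsCouple ψ) {a b : Γ} (ha : a ≠ 0) (hb : b ≠ 0)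
    (hab : a + ψ a = b + ψ b) : a = b := by
  have key : ∀ a b : Γ, a ≠ 0 → b ≠ 0 → a + ψ a = b + ψ b → ¬ a < b := by
    intro a b ha hb hab hlt
    have hd : 0 < b - a := sub_pos.2 hlt
    have e : b - a = ψ a - ψ b := by
      rw [sub_eq_sub_iff_add_eq_add, ← hab, add_comm]
    have hneg : ∀ c : Γ, c ≠ 0 → ψ (-c) = ψ c := fun c hc => by
      simpa using h.ac2 (-1) c (by simp) hc
    have h1 : min (ψ b) (ψ (-a)) ≤ ψ (b + -a) :=
      h.ac1 b (-a) hb (neg_ne_zero.2 ha) (by rw [← sub_eq_add_neg]; exact hd.ne')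
    rw [hneg a ha, ← sub_eq_add_neg] at h1
    have hψ : ψ b < ψ a := by rw [e] at hd; exact sub_pos.1 hd
    rw [min_eq_left hψ.le] at h1
    have h2 : min (ψ (b - a)) (ψ a) ≤ ψ (b - a + a) :=
      h.ac1 (b - a) a hd.ne' ha (by simpa using hb)
    rw [sub_add_cancel] at h2
    have h3 : ψ (b - a) ≤ ψ b := by
      rcases min_le_iff.1 h2 with h2 | h2
      · exact h2
      · exact absurd h2 (not_le.2 hψ)
    have h4 := h.ac3 (b - a) a hd ha
    have h5 : b - a + ψ (b - a) ≤ b - a + ψ b := by gcongr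
    rw [e, sub_add_cancel] at h5
    rw [← e] at h5
    exact absurd h4 (not_lt.2 h5)
  rcases lt_trichotomy a b with h1 | h1 | h1
  · exact absurd h1 (key a b ha hb hab)
  · exact h1
  · exact absurd h1 (key b a hb ha hab.symm)

theorem integral_spec (hi : ∀ α : Γ, ∃ β : Γ, β ≠ 0 ∧ β + ψ β = α) (a : Γ) :
    integral ψ a ≠ 0 ∧ integral ψ a + ψ (integral ψ a) = a :=
  Classical.epsilon_spec (hi a)

theorem g_mS (h : IsCouple ψ) (hi : ∀ α : Γ, ∃ β : Γ, β ≠ 0 ∧ β + ψ β = α) (a b : Γ) :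
    mS (co ψ a) (co ψ b) ↔ succ ψ a = b := by
  obtain ⟨h1, h2⟩ := integral_spec hi a
  rw [g_mS0]
  constructor
  · rintro ⟨c, hc, hca, rfl⟩
    rw [succ, h.integral_unique h1 hc (h2.trans hca.symm)]
  · rintro rfl
    exact ⟨_, h1, h2, rfl⟩

theorem g_mGt (h : IsCouple ψ) (hi : ∀ α : Γ, ∃ β : Γ, β ≠ 0 ∧ β + ψ β = α) (a : Γ) :
    mGt (co ψ a) ↔ a ∈ PsiSet ψ ∧ succ ψ 0 < a := by
  simp [mGt, g_mz, ginf_exists, g_mS h hi]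

theorem g_mGt1 (x : Ginf ψ) (hx : x = mi _) : ¬ mGt x := by subst hx; simp [mGt]

theorem ginf_psi_iff : Ginf ψ ⊨ psiAxioms ↔
    IsCouple ψ ∧ ∀ α β : Γ, 0 < α → α ≤ β → ψ β ≤ ψ α := by
  rw [psi_iff]
  constructor
  · rintro ⟨⟨-, -, -, h1, h3, h4⟩, h5, h6⟩
    refine ⟨⟨?_, ?_, ?_⟩, ?_⟩
    · intro a b ha hb hab
      have := h1 (co ψ a) (co ψ b) (by simpa) (by simpa) (by simpa)
      simpa [g_mp ha, g_mp hb, g_mp hab, ← le_iff_lt_or_eq] using this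
    · intro r a hr ha
      obtain ⟨k, rfl | rfl⟩ := r.eq_nat_or_neg
      · have hk : 0 < k := by rcases k with _ | k <;> simp at hr ⊢
        have := h5 ⟨k, hk⟩ (co ψ a) (by simpa)
        have hka : k • a ≠ 0 := by
          rw [smul_ne_zero_iff]; exact ⟨hk.ne', ha⟩
        simpa [g_mp ha, g_mp hka] using this
      · have hk : 0 < k := by rcases k with _ | k <;> simp at hr ⊢
        have := h6 ⟨k, hk⟩ (co ψ a) (by simpa)
        have hka : -(k • a) ≠ 0 := by
          rw [neg_ne_zero, smul_ne_zero_iff]; exact ⟨hk.ne', ha⟩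
        simpa [g_mp ha, g_mp hka] using this
    · intro a b ha hb
      have := h3 (co ψ a) (co ψ b) (by simp) (by simpa [g_mz]) (by simpa)
      simpa [g_mp ha.ne', g_mp hb] using this
    · intro a b ha hab
      have := h4 (co ψ a) (co ψ b) (by simp) (by simp) (by simpa [g_mz])
        (by simpa [← le_iff_lt_or_eq])
      simpa [g_mp ha.ne', g_mp (ha.trans_le hab).ne', ← le_iff_lt_or_eq] using this
  · rintro ⟨h, hc⟩
    refine ⟨⟨by simp [g_mz], by simp, ?_, ?_, ?_, ?_⟩, ?_, ?_⟩
    · simp +contextual [ginf_forall, g_mp]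
    · simp only [ginf_forall, g_mnz1, g_mnz, false_imp_iff, true_and, g_ma, g_ma1, g_ma2,
        implies_true]
      intro a b ha hb hab
      have := h.ac1 a b ha hb hab
      simpa [g_mp ha, g_mp hb, g_mp hab, ← le_iff_lt_or_eq] using this
    · simp only [ginf_forall, g_mnz1, g_mnz, false_imp_iff, true_and, g_mz, ne_eq,
        not_true_eq_false, implies_true, g_ml]
      intro a b _ ha hb
      simpa [g_mp ha.ne', g_mp hb] using h.ac3 a b ha hb
    · simp only [ginf_forall, false_imp_iff, true_and, g_mz, ne_eq,
        not_true_eq_false, implies_true, g_ml, co_inj, ← le_iff_lt_or_eq]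
      intro a b _ _ ha hab
      simpa [g_mp ha.ne', g_mp (ha.trans_le hab).ne', ← le_iff_lt_or_eq] using hc a b ha hab
    · intro k
      simp only [ginf_forall, g_mnz1, g_mnz, false_imp_iff, true_and, g_msmul]
      intro a ha
      have hka : (k : ℕ) • a ≠ 0 := by
        rw [smul_ne_zero_iff]; exact ⟨k.pos.ne', ha⟩
      simpa [g_mp ha, g_mp hka] using h.ac2 (k : ℕ) a (by simp) ha
    · intro k
      simp only [ginf_forall, g_mnz1, g_mnz, false_imp_iff, true_and, g_msmul, g_mn]
      intro a ha
      have hka : -((k : ℕ) • a) ≠ 0 := by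
        rw [neg_ne_zero, smul_ne_zero_iff]; exact ⟨k.pos.ne', ha⟩
      simpa [g_mp ha, g_mp hka] using h.ac2 (-(k : ℕ)) a (by simp) ha

theorem ginf_order : Ginf ψ ⊨ orderAxioms := by
  rw [order_iff]
  refine ⟨?_, ?_, ?_, ?_⟩
  · exact fun x => lt_irrefl (α := WithTop Γ) x
  · exact fun x y z => lt_trans (α := WithTop Γ)
  · exact fun x y => or_assoc.2 (lt_trichotomy (α := WithTop Γ) x y)
  · exact fun x hx => lt_top_iff_ne_top (α := WithTop Γ).2 hx

theorem ginf_group : Ginf ψ ⊨ groupAxioms := by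
  rw [group_iff]
  refine ⟨by simp [g_mz], ?_, ?_, ?_, ?_, ?_, ?_, ?_, ?_, ?_⟩
  · simp [ginf_forall]
  · simp [ginf_forall]
  · exact fun x y z => add_assoc (G := WithTop Γ) x y z
  · exact fun x y => add_comm (G := WithTop Γ) x y
  · exact fun x => add_zero (M := WithTop Γ) x
  · simp [ginf_forall, g_mz]
  · simp +contextual [ginf_forall]
  · simp
  · simp

theorem ginf_div : Ginf ψ ⊨ divAxioms ↔ ∀ (n : ℕ+) (α : Γ), ∃ β : Γ, (n : ℕ) • β = α := by
  rw [div_iff]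
  simp [ginf_forall, ginf_exists]

theorem ginf_succ (h : IsCouple ψ) : Ginf ψ ⊨ succAxioms ↔
    (∀ α : Γ, ∃ β : Γ, β ≠ 0 ∧ β + ψ β = α) ∧
    IsLeast (PsiSet ψ) (succ ψ 0) ∧ 0 < succ ψ 0 ∧
    (∀ α ∈ PsiSet ψ, IsLeast {β ∈ PsiSet ψ | α < β} (succ ψ α)) ∧
    Set.BijOn (succ ψ) (PsiSet ψ) {β ∈ PsiSet ψ | succ ψ 0 < β} := by
  rw [succ_iff]
  have e : (∀ x : Ginf ψ, x ≠ mi _ → ∃ y, mnz y ∧ ma y (mp y) = x) ↔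
      (∀ α : Γ, ∃ β : Γ, β ≠ 0 ∧ β + ψ β = α) := by
    simp only [ginf_forall, ginf_exists, ne_eq, not_true_eq_false, false_imp_iff, true_and,
      co_ne, not_false_eq_true, true_imp_iff, g_mnz1, false_and, false_or, g_mnz]
    exact forall_congr' fun a => exists_congr fun b => and_congr_right fun hb => by
      simp [g_mp hb]
  rw [e]
  refine and_congr_right fun hi => ?_
  have hG1 : ¬ mGt (mi (Ginf ψ)) := g_mGt1 _ rfl
  simp only [ginf_forall, ginf_exists, g_mPsi, g_mPsi1, g_mS1, g_mS2, false_imp_iff, true_and,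
    imp_true_iff, g_mz, g_mS h hi, g_mGt h hi, hG1, g_ml, false_and, false_or, forall_eq', and_false, co_inj, ← le_iff_lt_or_eq]
  constructor
  · rintro ⟨⟨⟨a1, a2⟩, a3⟩, b, c, d, e⟩
    exact ⟨⟨a2, a3⟩, a1,
      fun α hα => ⟨(b α _ hα rfl).1, fun β hβ => (b α _ hα rfl).2 β hβ.1 hβ.2⟩,
      fun α hα => c α _ hα rfl, fun x hx y hy hxy => d x y _ hx hy rfl hxy.symm,
      fun x hx => e x hx⟩
  · rintro ⟨a, b, c, d1, d2, d3⟩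
    refine ⟨⟨⟨b, a.1⟩, a.2⟩, ?_, ?_, fun x y z hx hy hxz hyz => d2 hx hy (hxz.trans hyz.symm),
      fun x hx => d3 hx⟩
    · rintro α _ hα rfl
      exact ⟨(c α hα).1, fun β hβ hβ' => (c α hα).2 ⟨hβ, hβ'⟩⟩
    · rintro α _ hα rfl
      exact d1 hα

theorem ginf_T0_iff : Ginf ψ ⊨ T0 ↔ IsLogCouple ψ := by
  have hu : ∀ S T : L0.Theory, Ginf ψ ⊨ S ∪ T ↔ Ginf ψ ⊨ S ∧ Ginf ψ ⊨ T := by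
    intro S T
    simp only [Theory.model_iff, Set.mem_union, or_imp, forall_and]
  rw [T0, hu, hu, hu, hu, ginf_psi_iff, ginf_div]
  constructor
  · rintro ⟨⟨⟨-, h1, h2⟩, h3⟩, h4⟩
    obtain ⟨a, b, c, d, e⟩ := (ginf_succ h1).1 h4
    exact ⟨h1, h2, h3, a, b, c, d, e⟩
  · intro h
    exact ⟨⟨⟨⟨ginf_order, ginf_group⟩, h.toIsCouple, h.hType⟩, h.divisible⟩,
      (ginf_succ h.toIsCouple).2 ⟨h.integration, h.least, h.succ_zero_pos, h.succ_isLeast,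
        h.succ_bijOn⟩⟩

end GinfModels

section Characterization

/-- The models of `T0` are, up to isomorphism, exactly the structures `Γ_∞` for `(Γ, ψ)` as in
`IsLogCouple`. -/
theorem model_T0_iff (M : Type u) [L0.Structure M] :
    M ⊨ T0 ↔ ∃ (Γ : Type u) (_ : AddCommGroup Γ) (_ : LinearOrder Γ) (_ : IsOrderedAddMonoid Γ)
      (ψ : Γ → Γ), IsLogCouple ψ ∧ Nonempty (M ≃[L0] Ginf ψ) := by
  constructor
  · intro hM
    have ho : M ⊨ orderAxioms := hM.mono fun φ h => Or.inl (Or.inl (Or.inl (Or.inl h)))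
    have hg : M ⊨ groupAxioms := hM.mono fun φ h => Or.inl (Or.inl (Or.inl (Or.inr h)))
    have hp : M ⊨ psiAxioms := hM.mono fun φ h => Or.inl (Or.inl (Or.inr h))
    obtain ⟨o1, o2, o3, o4⟩ := (order_iff M).1 ho
    obtain ⟨g1, g2, g3, g4, g5, g6, g7, g8, g9, g10⟩ := (group_iff M).1 hg
    obtain ⟨⟨p1, p2, p3, -⟩, -⟩ := (psi_iff M).1 hp
    let Γ := {x : M // x ≠ mi M}
    let iz : Zero Γ := ⟨⟨mz M, g1⟩⟩
    let ia : Add Γ := ⟨fun x y => ⟨ma x.1 y.1, g2 _ _ x.2 y.2⟩⟩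
    let ing : Neg Γ := ⟨fun x => ⟨mn x.1, g3 _ x.2⟩⟩
    let ig : AddCommGroup Γ :=
      { add_assoc := fun x y z => Subtype.ext (g4 _ _ _)
        zero_add := fun x => Subtype.ext ((g5 _ _).trans (g6 _))
        add_zero := fun x => Subtype.ext (g6 _)
        nsmul := nsmulRec
        zsmul := zsmulRec
        neg_add_cancel := fun x => Subtype.ext ((g5 _ _).trans (g7 _ x.2))
        add_comm := fun x y => Subtype.ext (g5 _ _) }
    let il : LinearOrder Γ :=
      { le := fun x y => ml x.1 y.1 ∨ x = y
        lt := fun x y => ml x.1 y.1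
        le_refl := fun x => Or.inr rfl
        le_trans := by
          rintro x y z (h | rfl) (h' | rfl)
          · exact Or.inl (o2 _ _ _ h h')
          · exact Or.inl h
          · exact Or.inl h'
          · exact Or.inr rfl
        lt_iff_le_not_ge := by
          intro x y
          constructor
          · intro h
            refine ⟨Or.inl h, ?_⟩
            rintro (h' | rfl)
            · exact o1 _ (o2 _ _ _ h h')
            · exact o1 _ h
          · rintro ⟨h | rfl, h'⟩
            · exact h
            · exact absurd (Or.inr rfl) h'
        le_antisymm := by
          rintro x y (h | rfl) (h' | h')
          · exact absurd (o2 _ _ _ h h') (o1 _)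
          · exact h'.symm
          · rfl
          · rfl
        le_total := by
          intro x y
          rcases o3 x.1 y.1 with (h | h) | h
          · exact Or.inl (Or.inl h)
          · exact Or.inl (Or.inr (Subtype.ext h))
          · exact Or.inr (Or.inl h)
        toDecidableLE := Classical.decRel _ }
    have iom : IsOrderedAddMonoid Γ :=
      { add_le_add_left := by
          rintro x y (h | rfl) z
          · exact Or.inl (g8 _ _ _ x.2 y.2 z.2 h)
          · exact Or.inr rfl }
    classical
    let ψ : Γ → Γ := fun x => if h : mnz x.1 then ⟨mp x.1, p3 _ h⟩ else 0
    have hψ : ∀ x : Γ, x ≠ 0 → (ψ x).1 = mp x.1 := fun x hx => by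
      have : mnz x.1 := ⟨fun h => hx (Subtype.ext h), x.2⟩
      simp only [ψ, dif_pos this]
    let toM : Ginf ψ → M := fun x => WithTop.recTopCoe (C := fun _ => M) (mi M) (fun a => a.1) x
    have t1 : toM (mi _) = mi M := rfl
    have t2 : ∀ a, toM (co ψ a) = a.1 := fun a => rfl
    have hbij : Function.Bijective toM := by
      constructor
      · simp only [Function.Injective, ginf_forall, t1, t2]
        refine ⟨⟨fun _ => trivial, fun a h => absurd h.symm a.2⟩, fun a => ⟨fun h => absurd h a.2, ?_⟩⟩
        intro b h
        rw [Subtype.ext h]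
      · intro x
        by_cases hx : x = mi M
        · exact ⟨mi _, hx.symm⟩
        · exact ⟨co ψ ⟨x, hx⟩, rfl⟩
    have e : Ginf ψ ≃[L0] M :=
      { Equiv.ofBijective toM hbij with
        map_fun' := by
          intro n f x
          change toM _ = Structure.funMap (L := L0) f (toM ∘ x)
          match n, f with
          | _, .zero =>
            rw [show (toM ∘ x : Fin 0 → M) = ![] from Subsingleton.elim _ _,
              show x = ![] from Subsingleton.elim _ _]
            rfl
          | _, .infty =>
            rw [show (toM ∘ x : Fin 0 → M) = ![] from Subsingleton.elim _ _,
              show x = ![] from Subsingleton.elim _ _]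
            rfl
          | _, .add =>
            rw [show (toM ∘ x : Fin 2 → M) = ![toM (x 0), toM (x 1)] by
              ext i; fin_cases i <;> rfl, show x = ![x 0, x 1] by ext i; fin_cases i <;> rfl]
            change toM (ma (x 0) (x 1)) = ma (toM (x 0)) (toM (x 1))
            generalize x 0 = a, x 1 = b
            revert a b
            simp only [ginf_forall, g_ma, g_ma1, g_ma2, t1, t2, g9, g5 (mi M), true_and,
              implies_true]
            exact fun a b => rfl
          | _, .neg =>
            rw [show (toM ∘ x : Fin 1 → M) = ![toM (x 0)] by
              ext i; fin_cases i; rfl, show x = ![x 0] by ext i; fin_cases i; rfl]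
            change toM (mn (x 0)) = mn (toM (x 0))
            generalize x 0 = a
            revert a
            simp only [ginf_forall, g_mn, g_mn1, t1, t2, g10, true_and]
            exact fun a => rfl
          | _, .psi =>
            rw [show (toM ∘ x : Fin 1 → M) = ![toM (x 0)] by
              ext i; fin_cases i; rfl, show x = ![x 0] by ext i; fin_cases i; rfl]
            change toM (mp (x 0)) = mp (toM (x 0))
            generalize x 0 = a
            revert a
            simp only [ginf_forall, g_mp1, t1, t2, p2, true_and]
            intro a
            by_cases ha : a = 0
            · subst ha
              rw [g_mp0, t1]
              exact p1.symm
            · rw [g_mp ha, t2, hψ a ha]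
        map_rel' := by
          intro n r x
          change Structure.RelMap r (toM ∘ x) ↔ _
          match n, r with
          | _, .lt =>
            rw [show (toM ∘ x : Fin 2 → M) = ![toM (x 0), toM (x 1)] by
              ext i; fin_cases i <;> rfl, show x = ![x 0, x 1] by ext i; fin_cases i <;> rfl]
            change ml (toM (x 0)) (toM (x 1)) ↔ ml (x 0) (x 1)
            generalize x 0 = a, x 1 = b
            revert a b
            simp only [ginf_forall, g_ml, g_ml1, g_ml2, t1, t2, o1, iff_true, true_and,
              iff_false]
            refine ⟨fun a h => o1 _ (o2 _ _ _ h (o4 _ a.2)), fun a => ⟨o4 _ a.2, fun b => Iff.rfl⟩⟩ }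
    refine ⟨Γ, ig, il, iom, ψ, ?_, ⟨e.symm⟩⟩
    exact ginf_T0_iff.1 (StrongHomClass.theory_model e.symm)
  · rintro ⟨Γ, _, _, _, ψ, h, ⟨e⟩⟩
    have := ginf_T0_iff.2 h
    exact StrongHomClass.theory_model e.symm

/-- Each `graphF f` defines the graph of the intended function. -/
theorem ginf_graphF {Γ : Type u} [AddCommGroup Γ] [LinearOrder Γ] [IsOrderedAddMonoid Γ]
    {ψ : Γ → Γ} (h : IsLogCouple ψ) (f : NewFunc 1) (v : Empty → Ginf ψ) (x y : Ginf ψ) :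
    (graphF f).Realize v ![x, y] ↔ Structure.funMap (L := Lnew) f ![x] = y := by
  have hc := h.toIsCouple
  have hi := h.integration
  have hG1 : ¬ mGt (mi (Ginf ψ)) := g_mGt1 _ rfl
  match f with
  | .succ =>
    have e1 : (Structure.funMap (L := Lnew) (M := Ginf ψ) NewFunc.succ ![mi _]) = mi _ := rfl
    have e2 : ∀ a, (Structure.funMap (L := Lnew) (M := Ginf ψ) NewFunc.succ ![co ψ a]) =
      co ψ (succ ψ a) := fun a => rfl
    simp only [graphF, BoundedFormula.realize_sup, BoundedFormula.realize_inf,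
      BoundedFormula.realize_bdEqual, Function.comp_apply, Term.realize_var, Sum.elim_inr,
      realize_inftyT, realize_succF, Matrix.cons_val_zero, Matrix.cons_val_one]
    revert x y
    simp [ginf_forall, e1, e2, g_mS hc hi]
  | .pred =>
    have e1 : (Structure.funMap (L := Lnew) (M := Ginf ψ) NewFunc.pred ![mi _]) = mi _ := rfl
    have e2 : ∀ a, a ∈ PsiSet ψ ∧ succ ψ 0 < a →
      (Structure.funMap (L := Lnew) (M := Ginf ψ) NewFunc.pred ![co ψ a]) =
      co ψ (Function.invFunOn (succ ψ) (PsiSet ψ) a) := fun a ha => if_pos ha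
    have e3 : ∀ a, ¬ (a ∈ PsiSet ψ ∧ succ ψ 0 < a) →
      (Structure.funMap (L := Lnew) (M := Ginf ψ) NewFunc.pred ![co ψ a]) = mi _ :=
      fun a ha => if_neg ha
    simp only [graphF, BoundedFormula.realize_sup, BoundedFormula.realize_inf,
      BoundedFormula.realize_not,
      BoundedFormula.realize_bdEqual, Function.comp_apply, Term.realize_var, Sum.elim_inr,
      realize_inftyT, realize_succF, realize_inPsiF, realize_inPsiGtF, Matrix.cons_val_zero,
      Matrix.cons_val_one]
    revert x y
    rw [ginf_forall]
    refine ⟨fun y => by simp [hG1, e1, eq_comm], fun a => ?_⟩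
    by_cases ha : a ∈ PsiSet ψ ∧ succ ψ 0 < a
    · have hs := h.succ_bijOn.surjOn ha
      have s1 := Function.invFunOn_mem hs
      have s2 := Function.invFunOn_eq hs
      simp only [ginf_forall, g_mGt hc hi, ha, e2 a ha, g_mS hc hi, g_mPsi, g_mPsi1]
      refine ⟨by simp, fun b => ?_⟩
      simp only [true_and, not_true_eq_false, false_and, and_self, or_false, co_inj]
      constructor
      · rintro ⟨hb, hb'⟩
        exact h.succ_bijOn.injOn s1 hb (s2.trans hb'.symm)
      · rintro rfl
        exact ⟨s1, s2⟩
    · intro y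
      rw [g_mGt hc hi, e3 a ha]
      simp [ha, eq_comm]
  | .delta k =>
    have e1 : (Structure.funMap (L := Lnew) (M := Ginf ψ) (NewFunc.delta k) ![mi _]) = mi _ := rfl
    have e2 : ∀ a, (Structure.funMap (L := Lnew) (M := Ginf ψ) (NewFunc.delta k) ![co ψ a]) =
      co ψ (Classical.epsilon fun b : Γ => (k : ℕ) • b = a) := fun a => rfl
    simp only [graphF, BoundedFormula.realize_bdEqual, Function.comp_apply, Term.realize_var,
      Sum.elim_inr, realize_nsmulT, Matrix.cons_val_zero, Matrix.cons_val_one]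
    revert x y
    simp only [ginf_forall, g_msmul, g_msmul1, e1, e2, co_ne, co_ne2, true_and, co_inj]
    refine ⟨fun _ => trivial, fun a b => ?_⟩
    have hs := Classical.epsilon_spec (h.divisible k a)
    constructor
    · intro hb
      exact nsmul_right_injective k.pos.ne' (hs.trans hb.symm)
    · rintro rfl
      exact hs

theorem realize_newAxiom (M : Type u) [Llog.Structure M] [L0.Structure M]
    [(LHom.sumInl : L0 →ᴸ Llog).IsExpansionOn M] (f : NewFunc 1) :
    M ⊨ newAxiom f ↔ ∀ x y : M, (Structure.funMap (L := Llog) (Sum.inr f) ![x] = y ↔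
      (graphF f).Realize (default : Empty → M) ![x, y]) := by
  simp only [newAxiom, Sentence.Realize, Formula.Realize, BoundedFormula.realize_all,
    BoundedFormula.realize_iff, BoundedFormula.realize_bdEqual,
    LHom.realize_onBoundedFormula, Function.comp_apply, Term.realize_var, Sum.elim_inr]
  refine forall_congr' fun x => forall_congr' fun y => ?_
  rw [show (Fin.snoc (Fin.snoc default x) y : Fin 2 → M) = ![x, y] by
    ext i; fin_cases i <;> rfl]
  exact iff_congr (Eq.congr_left (Term.realize_functions_apply₁ (L := Llog))) Iff.rfl

/-- The models of `Tlog` are, up to isomorphism, exactly the structures `Γ_∞` for `(Γ, ψ)` as in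
`IsLogCouple`, with `s`, `p`, `δ_n` interpreted in the intended way. -/
theorem model_Tlog_iff (M : Type u) [Llog.Structure M] :
    M ⊨ Tlog ↔ ∃ (Γ : Type u) (_ : AddCommGroup Γ) (_ : LinearOrder Γ)
      (_ : IsOrderedAddMonoid Γ) (ψ : Γ → Γ), IsLogCouple ψ ∧
      Nonempty (M ≃[Llog] Ginf ψ) := by
  have hu : ∀ (N : Type u) [Llog.Structure N] [L0.Structure N]
      [(LHom.sumInl : L0 →ᴸ Llog).IsExpansionOn N],
      N ⊨ Tlog ↔ N ⊨ T0 ∧ ∀ f, N ⊨ newAxiom f := by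
    intro N _ _ _
    rw [← LHom.onTheory_model (LHom.sumInl : L0 →ᴸ Llog)]
    simp only [Tlog, Theory.model_iff, Set.mem_union, or_imp, forall_and, Set.forall_mem_range]
  let := (LHom.sumInl : L0 →ᴸ Llog).reduct M
  constructor
  · intro hM
    obtain ⟨h0, h1⟩ := (hu M).1 hM
    obtain ⟨Γ, i1, i2, i3, ψ, h, ⟨e⟩⟩ := (model_T0_iff M).1 h0
    refine ⟨Γ, i1, i2, i3, ψ, h, ⟨{ e.toEquiv with map_fun' := ?_, map_rel' := ?_ }⟩⟩
    · intro n f x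
      change e _ = Structure.funMap f (e ∘ x)
      match n, f with
      | n, .inl f => exact e.map_fun f x
      | n, .inr f =>
        have key : ∀ (f : NewFunc 1) (a : M), e (Structure.funMap (L := Llog) (Sum.inr f) ![a]) =
            Structure.funMap (L := Lnew) f ![e a] := by
          intro f a
          have := ((realize_newAxiom M f).1 (h1 f) a _).1 rfl
          rw [← StrongHomClass.realize_boundedFormula e] at this
          symm
          rw [← ginf_graphF h f (e ∘ default)]
          convert this using 1
          ext i; fin_cases i <;> rfl
        have hx : ∀ x : Fin 1 → M, x = ![x 0] := fun x => by ext i; fin_cases i; rfl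
        have hx' : ∀ x : Fin 1 → M, e ∘ x = ![e (x 0)] := fun x => by ext i; fin_cases i; rfl
        match n, f with
        | _, .succ => rw [hx' x, hx x]; exact key _ _
        | _, .pred => rw [hx' x, hx x]; exact key _ _
        | _, .delta k => rw [hx' x, hx x]; exact key _ _
    · intro n r x
      change Structure.RelMap r (e ∘ x) ↔ _
      match n, r with
      | n, .inl r => exact e.map_rel r x
      | n, .inr r => exact r.elim
  · rintro ⟨Γ, _, _, _, ψ, h, ⟨e⟩⟩
    have : Ginf ψ ⊨ Tlog := by
      rw [hu (Ginf ψ)]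
      refine ⟨ginf_T0_iff.2 h, fun f => ?_⟩
      rw [realize_newAxiom]
      intro x y
      rw [ginf_graphF h]
      rfl
    exact StrongHomClass.theory_model e.symm

end Characterization

end AsymCouple

/-! Quantifier elimination follows, by compactness of the type spaces, once two tuples in models of
`Tlog` with the same quantifier-free type are shown to satisfy the same formulas. Each model embeds
elementarily in its ultrapower over a nonprincipal ultrafilter on `ℕ`, where countable families of
definable conditions are realized as soon as finite subfamilies are. So it suffices to play
back-and-forth, with countable partial isomorphisms, between two saturated couples.

The algebra rests on two facts. With value `∞` at `0`, `ψ` is a convex valuation `val` on an ordered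
`ℚ`-vector space, so a sum is governed in sign and value by a summand of strictly smaller value. And
`succ ψ a` is the only `b` with `val ψ (a - b) = b`; together with (AC3) this yields the successor
identity `val_sub_of_lt`: if `succ ψ x < succ ψ y`, then `val ψ (x - y) = succ ψ x`. Values of
differences can thus be read off from successors.

A partial isomorphism (`PIso`) consists of a linear part `G` and a combinatorial part `P` on `Ψ ∪
{0}`. They are kept apart so that `P` may run ahead of `G`. Inside a countable subspace `A` closed
under the operations, a maximal partial isomorphism is exhausted in three moves. A point of `Ψ ∪
{0}` missing from `P` is added together with its orbit under `s` and `p`; saturation supplies the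
corresponding cut (`exists_newCut`, `union_chain`). A point of `P` missing from `G` is adjoined
without saturation, because the successor identity determines sign, value and successor of every `g
+ q c` (`adjoin_of_mem`). Finally, when `P` is the full trace of `Ψ ∪ {0}` on `A` and `P ⊆ G`, a
further element `c` is described over `G` by its cut and the values of `c - g`; finite parts of this
description are realized in the domain of `G` (`exists_approx`), so saturation supplies an image
(`exists_adjoin`, `adjoin_of_subset`).

Starting from the pairs of values of terms at the two tuples gives quantifier elimination; starting
from `G = 0` and the iterates of `s` at `0` gives completeness, with satisfiability from an explicit
lexicographic model. Every model of `T0` expands to one of `Tlog`, so `T0` is complete. An embedding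
of `L0`-structures between such couples automatically respects `s`, `p` and `δ_n`, hence is
elementary by quantifier elimination for `Tlog`; this is model completeness of `T0`. -/

namespace AsymCouple

open FirstOrder FirstOrder.Language

/-! ### The convex valuation given by `ψ`. -/

section Valuation

set_option linter.unusedSectionVars false

variable {Γ : Type*} [AddCommGroup Γ] [LinearOrder Γ] {ψ : Γ → Γ}

open Classical in
/-- The valuation `Γ → Γ_∞` given by `ψ`, with value `∞` at `0`. -/
noncomputable def val (ψ : Γ → Γ) (x : Γ) : WithTop Γ :=
  if x = 0 then ⊤ else ((ψ x : Γ) : WithTop Γ)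

@[simp] theorem val_zero : val ψ 0 = ⊤ := if_pos rfl

theorem val_of_ne {x : Γ} (hx : x ≠ 0) : val ψ x = ((ψ x : Γ) : WithTop Γ) := if_neg hx

theorem val_eq_coe {x a : Γ} : val ψ x = (a : WithTop Γ) ↔ x ≠ 0 ∧ ψ x = a := by
  by_cases hx : x = 0
  · simp [hx]
  · simp [val_of_ne hx, hx]

theorem val_ne_top {x : Γ} : val ψ x ≠ ⊤ ↔ x ≠ 0 := by
  by_cases hx : x = 0
  · simp [hx]
  · simp [val_of_ne hx, hx]

theorem ne_zero_of_val_lt {x : Γ} {t : WithTop Γ} (h : val ψ x < t) : x ≠ 0 :=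
  val_ne_top.1 (ne_top_of_lt h)

theorem ne_zero_of_val_eq {x t : Γ} (h : val ψ x = t) : x ≠ 0 :=
  (val_eq_coe.1 h).1

theorem IsCouple.val_neg (h : IsCouple ψ) (x : Γ) : val ψ (-x) = val ψ x := by
  by_cases hx : x = 0
  · simp [hx]
  · rw [val_of_ne hx, val_of_ne (neg_ne_zero.2 hx)]
    simpa using h.ac2 (-1) x (by simp) hx

theorem IsCouple.val_sub_comm (h : IsCouple ψ) (x y : Γ) : val ψ (x - y) = val ψ (y - x) := by
  rw [← h.val_neg, neg_sub]

theorem IsCouple.val_add (h : IsCouple ψ) (x y : Γ) : min (val ψ x) (val ψ y) ≤ val ψ (x + y) := by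
  by_cases hx : x = 0
  · simp [hx]
  by_cases hy : y = 0
  · simp [hy]
  by_cases hxy : x + y = 0
  · simp [hxy]
  rw [val_of_ne hx, val_of_ne hy, val_of_ne hxy]
  exact_mod_cast h.ac1 x y hx hy hxy

theorem IsCouple.lt_val_add (h : IsCouple ψ) {x y : Γ} {t : WithTop Γ} (hx : t < val ψ x)
    (hy : t < val ψ y) : t < val ψ (x + y) :=
  (lt_min hx hy).trans_le (h.val_add x y)

theorem IsCouple.le_val_add (h : IsCouple ψ) {x y : Γ} {t : WithTop Γ} (hx : t ≤ val ψ x)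
    (hy : t ≤ val ψ y) : t ≤ val ψ (x + y) :=
  (le_min hx hy).trans (h.val_add x y)

theorem IsCouple.val_add_of_lt (h : IsCouple ψ) {x y : Γ} (hxy : val ψ x < val ψ y) :
    val ψ (x + y) = val ψ x := by
  refine le_antisymm ?_ ((le_min le_rfl hxy.le).trans (h.val_add x y))
  by_contra! hlt
  have := h.lt_val_add hlt ((h.val_neg y).symm ▸ hxy)
  simp at this

theorem IsLogCouple.val_anti (h : IsLogCouple ψ) {x y : Γ} (hx : 0 < x) (hxy : x ≤ y) :
    val ψ y ≤ val ψ x := by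
  rw [val_of_ne hx.ne', val_of_ne (hx.trans_le hxy).ne']
  exact_mod_cast h.hType x y hx hxy

section Order

variable [IsOrderedAddMonoid Γ]

/-- Convexity of the valuation: if adding `y` could change the sign of `x`, then `|x| ≤ |y|`, and so
`val ψ y ≤ val ψ x`. This is the source of all later order computations. -/
theorem IsLogCouple.add_pos_iff (h : IsLogCouple ψ) {x y : Γ} (hxy : val ψ x < val ψ y) :
    0 < x + y ↔ 0 < x := by
  constructor
  · intro h1
    by_contra h2
    have h3 : 0 < -x := neg_pos.2 (lt_of_le_of_ne (not_lt.1 h2) (ne_zero_of_val_lt hxy))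
    have h4 := h.val_anti h3 (by rw [neg_le_iff_add_nonneg']; exact h1.le)
    rw [h.val_neg] at h4
    exact absurd h4 (not_le.2 hxy)
  · intro h1
    by_contra h2
    have h4 := h.val_anti h1 (y := -y) (by rw [le_neg_iff_add_nonpos_right]; exact not_lt.1 h2)
    rw [h.val_neg] at h4
    exact absurd h4 (not_le.2 hxy)

theorem IsLogCouple.add_neg_iff (h : IsLogCouple ψ) {x y : Γ} (hxy : val ψ x < val ψ y) :
    x + y < 0 ↔ x < 0 := by
  have := h.add_pos_iff (x := -x) (y := -y) (by simpa [h.val_neg] using hxy)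
  rwa [← neg_add, neg_pos, neg_pos] at this

section Rat

variable [Module ℚ Γ]

/-- Reduces rational scalars to integer ones, to which (AC2) and monotonicity of integer multiples
apply. -/
theorem den_smul_rat_smul (q : ℚ) (x : Γ) : (q.den : ℤ) • (q • x) = q.num • x := by
  rw [← Int.cast_smul_eq_zsmul ℚ, ← Int.cast_smul_eq_zsmul ℚ, smul_smul]
  congr 1
  simp [mul_comm]

theorem IsCouple.val_smul (h : IsCouple ψ) {q : ℚ} (hq : q ≠ 0) (x : Γ) :
    val ψ (q • x) = val ψ x := by
  by_cases hx : x = 0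
  · simp [hx]
  have hqx : q • x ≠ 0 := smul_ne_zero hq hx
  rw [val_of_ne hx, val_of_ne hqx, ← h.ac2 q.den (q • x) (by simp) hqx, den_smul_rat_smul,
    h.ac2 q.num x (by simpa) hx]

theorem rat_smul_pos_iff {q : ℚ} (hq : 0 < q) (x : Γ) : 0 < q • x ↔ 0 < x := by
  have key : ∀ (n : ℤ) (y : Γ), 0 < n → (0 < n • y ↔ 0 < y) := fun n y hn => by
    simpa using zsmul_lt_zsmul_iff_right hn (a := 0) (b := y)
  rw [← key q.den _ (by exact_mod_cast q.den_pos), den_smul_rat_smul, key _ _ (Rat.num_pos.2 hq)]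

theorem rat_smul_pos_iff_of_neg {q : ℚ} (hq : q < 0) (x : Γ) : 0 < q • x ↔ x < 0 := by
  rw [← neg_smul_neg, rat_smul_pos_iff (neg_pos.2 hq), neg_pos]

end Rat

/-! ## The successor function -/

/-- The set `Ψ ∪ {0}`. -/
def PsiZero (ψ : Γ → Γ) : Set Γ := insert 0 (PsiSet ψ)

theorem mem_psiSet_of_pos {v : Γ} (hv : v ∈ PsiZero ψ) (h0 : 0 < v) : v ∈ PsiSet ψ := by
  rcases hv with rfl | hv
  · exact absurd h0 (lt_irrefl _)
  · exact hv

namespace IsLogCouple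

theorem sub_succ (h : IsLogCouple ψ) (a : Γ) : a - succ ψ a ≠ 0 ∧ ψ (a - succ ψ a) = succ ψ a := by
  obtain ⟨h1, h2⟩ := integral_spec h.integration a
  have : a - succ ψ a = integral ψ a := by
    rw [sub_eq_iff_eq_add]; exact h2.symm
  rw [this]
  exact ⟨h1, rfl⟩

theorem val_sub_succ (h : IsLogCouple ψ) (a : Γ) : val ψ (a - succ ψ a) = succ ψ a :=
  val_eq_coe.2 (h.sub_succ a)

theorem val_succ_sub (h : IsLogCouple ψ) (a : Γ) : val ψ (succ ψ a - a) = succ ψ a := by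
  rw [h.val_sub_comm, h.val_sub_succ]

/-- The hypothesis makes `a - b` an integral of `a`, and integrals are unique. Hence successors can
be recognized from values alone. -/
theorem succ_eq_of_val (h : IsLogCouple ψ) {a b : Γ} (hab : val ψ (a - b) = b) : succ ψ a = b := by
  obtain ⟨h1, h2⟩ := val_eq_coe.1 hab
  obtain ⟨h3, h4⟩ := h.sub_succ a
  have := h.integral_unique h1 h3 (by rw [h2, h4]; abel)
  exact (sub_right_injective this).symm

theorem succ_mem (h : IsLogCouple ψ) (a : Γ) : succ ψ a ∈ PsiSet ψ := ⟨_, h.sub_succ a⟩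

theorem succ_mem' (h : IsLogCouple ψ) (a : Γ) : succ ψ a ∈ PsiZero ψ := Or.inr (h.succ_mem a)

theorem pos_of_mem (h : IsLogCouple ψ)
    {v : Γ} (hv : v ∈ PsiSet ψ) : 0 < v := h.succ_zero_pos.trans_le (h.least.2 hv)

theorem nonneg_of_mem (h : IsLogCouple ψ) {v : Γ} (hv : v ∈ PsiZero ψ) : 0 ≤ v := by
  rcases hv with rfl | hv
  · exact le_rfl
  · exact (h.pos_of_mem hv).le

theorem lt_succ (h : IsLogCouple ψ) {u : Γ} (hu : u ∈ PsiZero ψ) : u < succ ψ u := by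
  rcases hu with rfl | hu
  · exact h.succ_zero_pos
  · exact (h.succ_isLeast u hu).1.2

theorem succ_le (h : IsLogCouple ψ)
    {u v : Γ} (hu : u ∈ PsiZero ψ) (hv : v ∈ PsiZero ψ) (huv : u < v) :
    succ ψ u ≤ v := by
  have hv' := mem_psiSet_of_pos hv ((h.nonneg_of_mem hu).trans_lt huv)
  rcases hu with rfl | hu
  · exact h.least.2 hv'
  · exact (h.succ_isLeast u hu).2 ⟨hv', huv⟩

theorem succ_lt_succ (h : IsLogCouple ψ)
    {u v : Γ} (hu : u ∈ PsiZero ψ) (hv : v ∈ PsiZero ψ) (huv : u < v) :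
    succ ψ u < succ ψ v :=
  (h.succ_le hu hv huv).trans_lt (h.lt_succ hv)

theorem succ_strictMonoOn (h : IsLogCouple ψ) : StrictMonoOn (succ ψ) (PsiZero ψ) :=
  fun _ hu _ hv => h.succ_lt_succ hu hv

theorem succ_lt_iff (h : IsLogCouple ψ) {u v : Γ} (hu : u ∈ PsiZero ψ) (hv : v ∈ PsiZero ψ) :
    succ ψ u < succ ψ v ↔ u < v := h.succ_strictMonoOn.lt_iff_lt hu hv

theorem succ_inj (h : IsLogCouple ψ) {u v : Γ} (hu : u ∈ PsiZero ψ) (hv : v ∈ PsiZero ψ) :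
    succ ψ u = succ ψ v ↔ u = v := h.succ_strictMonoOn.injOn.eq_iff hu hv

theorem exists_pred (h : IsLogCouple ψ)
    {v : Γ} (hv : v ∈ PsiSet ψ) : ∃ u ∈ PsiZero ψ, succ ψ u = v := by
  rcases (h.least.2 hv).eq_or_lt with h0 | h0
  · exact ⟨0, Or.inl rfl, h0⟩
  · obtain ⟨u, hu, rfl⟩ := h.succ_bijOn.surjOn ⟨hv, h0⟩
    exact ⟨u, Or.inr hu, rfl⟩

theorem exists_succ_eq (h : IsLogCouple ψ) (a : Γ) : ∃ u ∈ PsiZero ψ, succ ψ a = succ ψ u := by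
  obtain ⟨u, hu, hu'⟩ := h.exists_pred (h.succ_mem a)
  exact ⟨u, hu, hu'.symm⟩

theorem exists_val_eq (h : IsLogCouple ψ)
    {x : Γ} (hx : x ≠ 0) : ∃ u ∈ PsiZero ψ, val ψ x = (succ ψ u : Γ) := by
  obtain ⟨u, hu, hu'⟩ := h.exists_pred ⟨x, hx, rfl⟩
  exact ⟨u, hu, by rw [hu', val_of_ne hx]⟩

theorem le_val_sub_of_eq (h : IsLogCouple ψ) {x y : Γ} (hxy : succ ψ x = succ ψ y) :
    ((succ ψ x : Γ) : WithTop Γ) ≤ val ψ (x - y) := by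
  have e : x - y = (x - succ ψ x) + (succ ψ y - y) := by rw [hxy]; abel
  rw [e]
  refine h.le_val_add (h.val_sub_succ x).ge ?_
  rw [h.val_succ_sub, hxy]

/-- The successor identity. -/
theorem val_sub_of_lt (h : IsLogCouple ψ) {x y : Γ} (hxy : succ ψ x < succ ψ y) :
    val ψ (x - y) = succ ψ x := by
  -- The first summand has value `succ ψ x`; the other two have larger values.
  have e : x - y = (x - succ ψ x) + ((succ ψ y - y) + (succ ψ x - succ ψ y)) := by abel
  rw [e, h.val_add_of_lt, h.val_sub_succ]
  rw [h.val_sub_succ]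
  refine h.lt_val_add ?_ ?_
  · rw [h.val_succ_sub]
    exact_mod_cast hxy
  · rw [h.val_sub_comm]
    have hd : 0 < succ ψ y - succ ψ x := sub_pos.2 hxy
    obtain ⟨h1, h2⟩ := h.sub_succ y
    -- (AC3) for the positive difference of the successors, against `succ ψ y = ψ (y - succ ψ y)`:
    -- cancelling `succ ψ y` leaves exactly that this difference has value above `succ ψ x`.
    have := h.ac3 _ _ hd h1
    rw [h2, sub_add_eq_add_sub, lt_sub_iff_add_lt, add_lt_add_iff_left] at this
    rw [val_of_ne hd.ne']
    exact_mod_cast this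

theorem lt_val_sub (h : IsLogCouple ψ) {x y t : Γ} (hx : t < succ ψ x) (hy : t < succ ψ y) :
    (t : WithTop Γ) < val ψ (x - y) := by
  have hx' : (t : WithTop Γ) < succ ψ x := by exact_mod_cast hx
  have hy' : (t : WithTop Γ) < succ ψ y := by exact_mod_cast hy
  rcases lt_trichotomy (succ ψ x) (succ ψ y) with h1 | h1 | h1
  · rwa [h.val_sub_of_lt h1]
  · exact hx'.trans_le (h.le_val_sub_of_eq h1)
  · rwa [h.val_sub_comm, h.val_sub_of_lt h1]

/-- Converse use of the successor identity: in the cases `succ ψ x ≥ succ ψ y` the difference would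
have value at least `succ ψ y`. -/
theorem succ_eq_val_sub (h : IsLogCouple ψ) {x y : Γ} (hxy : val ψ (x - y) < succ ψ y) :
    val ψ (x - y) = succ ψ x := by
  rcases lt_trichotomy (succ ψ x) (succ ψ y) with h1 | h1 | h1
  · exact h.val_sub_of_lt h1
  · exact absurd (h.le_val_sub_of_eq h1) (not_le.2 (h1 ▸ hxy))
  · rw [h.val_sub_comm, h.val_sub_of_lt h1] at hxy
    exact absurd hxy (lt_irrefl _)

theorem succ_eq_of_lt_val_sub (h : IsLogCouple ψ)
    {x y : Γ} (hxy : ((succ ψ y : Γ) : WithTop Γ) < val ψ (x - y)) :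
    succ ψ x = succ ψ y := by
  rcases lt_trichotomy (succ ψ x) (succ ψ y) with h1 | h1 | h1
  · rw [h.val_sub_of_lt h1] at hxy
    exact absurd h1 (not_lt.2 (by exact_mod_cast hxy.le))
  · exact h1
  · rw [h.val_sub_comm, h.val_sub_of_lt h1] at hxy
    exact absurd hxy (lt_irrefl _)

/-! ### Adding an element of `Ψ` -/

theorem val_sub_left (h : IsLogCouple ψ) {c a : Γ} (hac : succ ψ a < succ ψ c) :
    val ψ (c - a) = succ ψ a := by
  rw [h.val_sub_comm, h.val_sub_of_lt hac]

/-- In `c - a = (succ ψ a - a) + (c - succ ψ a)` the first summand dominates, so the position of `a`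
relative to `c` does not depend on `c`. -/
theorem lt_iff_of_succ_lt (h : IsLogCouple ψ) {c a : Γ} (hac : succ ψ a < succ ψ c) :
    a < c ↔ a < succ ψ a := by
  have e : c - a = (succ ψ a - a) + (c - succ ψ a) := by abel
  rw [← sub_pos, e, h.add_pos_iff, sub_pos]
  rw [h.val_succ_sub]
  exact h.lt_val_sub hac (h.lt_succ (h.succ_mem' a))

/-- Here `succ ψ a - c` dominates in `a - c`, and it is positive since `c < succ ψ c < succ ψ a`. -/
theorem lt_of_lt_succ (h : IsLogCouple ψ)
    {c a : Γ} (hc : c ∈ PsiZero ψ) (hca : succ ψ c < succ ψ a) : c < a := by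
  have e : a - c = (succ ψ a - c) + (a - succ ψ a) := by abel
  rw [← sub_pos, e, h.add_pos_iff, sub_pos]
  · exact (h.lt_succ hc).trans hca
  · rw [h.val_sub_succ, h.val_sub_comm, h.val_sub_of_lt]
    · exact_mod_cast hca
    · exact hca.trans (h.lt_succ (h.succ_mem' a))

theorem succ_add_eq_val (h : IsLogCouple ψ)
    {c e : Γ} (he : val ψ e < succ ψ c) : val ψ e = succ ψ (c + e) := by
  have := h.succ_eq_val_sub (x := c + e) (y := c) (by simpa using he)
  simpa using this

/-- With `t = succ ψ (c + e) = val ψ e`, both `c` and `t` have successor above `t`, so `c - t` has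
value above `val ψ e` and `e` decides the sign of `c + e - t`. -/
theorem add_lt_succ_iff (h : IsLogCouple ψ)
    {c e : Γ} (he : val ψ e < succ ψ c) : c + e < succ ψ (c + e) ↔ e < 0 := by
  have h1 := h.succ_add_eq_val he
  have e1 : c + e - succ ψ (c + e) = e + (c - succ ψ (c + e)) := by abel
  rw [← sub_neg, e1, h.add_neg_iff]
  rw [h1]
  refine h.lt_val_sub ?_ (h.lt_succ (h.succ_mem' _))
  rw [h1] at he
  exact_mod_cast he

theorem succ_add_eq_left (h : IsLogCouple ψ)
    {c e : Γ} (he : ((succ ψ c : Γ) : WithTop Γ) < val ψ e) :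
    succ ψ (c + e) = succ ψ c :=
  h.succ_eq_of_lt_val_sub (by simpa using he)

theorem add_lt_succ (h : IsLogCouple ψ)
    {c e : Γ} (hc : c ∈ PsiZero ψ) (he : ((succ ψ c : Γ) : WithTop Γ) < val ψ e) :
    c + e < succ ψ (c + e) := by
  have e1 : succ ψ (c + e) - (c + e) = (succ ψ c - c) + (-e) := by
    rw [h.succ_add_eq_left he]; abel
  rw [← sub_pos, e1, h.add_pos_iff, sub_pos]
  · exact h.lt_succ hc
  · rwa [h.val_succ_sub, h.val_neg]

theorem succ_add_eq_of_val (h : IsLogCouple ψ)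
    {c a e : Γ} (he : val ψ e = succ ψ c) (hca : succ ψ c < succ ψ a) :
    succ ψ (a + e) = succ ψ c := by
  have h1 := h.succ_add_eq_val (c := a) (e := e) (by rw [he]; exact_mod_cast hca)
  rw [he] at h1
  exact_mod_cast h1.symm

end IsLogCouple

end Order

end Valuation


/-! ### Iterated successors and approximation by elements of a subspace. -/

section SingleCouple

variable {Γ : Type*} [AddCommGroup Γ] [LinearOrder Γ] [IsOrderedAddMonoid Γ]
  {ψ : Γ → Γ}

namespace IsLogCouple

theorem iterate_mem (h : IsLogCouple ψ)
    {u : Γ} (hu : u ∈ PsiZero ψ) (n : ℕ) : (succ ψ)^[n] u ∈ PsiZero ψ := by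
  cases n with
  | zero => exact hu
  | succ n => rw [Function.iterate_succ_apply']; exact h.succ_mem' _

theorem iterate_lt_iff (h : IsLogCouple ψ)
    {u v : Γ} (hu : u ∈ PsiZero ψ) (hv : v ∈ PsiZero ψ) (n : ℕ) :
    (succ ψ)^[n] u < (succ ψ)^[n] v ↔ u < v := by
  induction n with
  | zero => rfl
  | succ n ih =>
    rw [Function.iterate_succ_apply', Function.iterate_succ_apply',
      h.succ_lt_iff (h.iterate_mem hu n) (h.iterate_mem hv n), ih]

theorem iterate_strictMono (h : IsLogCouple ψ) {u : Γ} (hu : u ∈ PsiZero ψ) :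
    StrictMono fun n : ℕ => (succ ψ)^[n] u :=
  strictMono_nat_of_lt_succ fun n => by
    rw [Function.iterate_succ_apply']
    exact h.lt_succ (h.iterate_mem hu n)

variable [Module ℚ Γ]

/-- The position of `c` relative to finitely many elements of a subspace `D`, together with the
`ψ`-values of the differences, is realized in `D` if these values are attained on `D`. -/
theorem exists_approx (h : IsLogCouple ψ) (D : Submodule ℚ Γ) {c : Γ}
    (hval : ∀ a ∈ D, ∃ e ∈ D, e ≠ 0 ∧ val ψ (c - a) = val ψ e) (F : Finset Γ)
    (hF : ∀ a ∈ F, a ∈ D) :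
    ∃ y ∈ D, ∀ a ∈ F, (a < y ↔ a < c) ∧ val ψ (y - a) = val ψ (c - a) := by
  classical
  rcases F.eq_empty_or_nonempty with rfl | hne
  · exact ⟨0, D.zero_mem, by simp⟩
  -- Only the points of `F` closest to `c`, those with the maximal value `γ`, impose a real
  -- constraint: any `y` with `val ψ (y - c) ≥ γ` behaves like `c` towards the others.
  obtain ⟨a₀, ha₀, hmax⟩ := F.exists_max_image (fun a => val ψ (c - a)) hne
  set γ := val ψ (c - a₀) with hγ
  obtain ⟨e, heD, he, heγ⟩ : ∃ e ∈ D, 0 < e ∧ val ψ e = γ := by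
    obtain ⟨e, heD, he0, he⟩ := hval a₀ (hF _ ha₀)
    rcases he0.lt_or_gt with h0 | h0
    · exact ⟨-e, D.neg_mem heD, neg_pos.2 h0, by rw [h.val_neg, ← he]⟩
    · exact ⟨e, heD, h0, he.symm⟩
  have hγtop : γ ≠ ⊤ := heγ ▸ val_ne_top.2 he.ne'
  let L := F.filter fun a => a < c ∧ val ψ (c - a) = γ
  let U := F.filter fun a => c < a ∧ val ψ (c - a) = γ
  have hL : ∀ {a}, a ∈ L ↔ a ∈ F ∧ a < c ∧ val ψ (c - a) = γ := by simp [L]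
  have hU : ∀ {a}, a ∈ U ↔ a ∈ F ∧ c < a ∧ val ψ (c - a) = γ := by simp [U]
  have hLU : ∀ a ∈ F, val ψ (c - a) = γ → a ∈ L ∨ a ∈ U := fun a ha hv => by
    have : c - a ≠ 0 := val_ne_top.1 (hv ▸ hγtop)
    rcases lt_or_gt_of_ne (sub_ne_zero.1 this) with h1 | h1
    · exact Or.inr (hU.2 ⟨ha, h1, hv⟩)
    · exact Or.inl (hL.2 ⟨ha, h1, hv⟩)
  have core : ∀ y ∈ D, γ ≤ val ψ (y - c) → (∀ a ∈ L, a < y ∧ val ψ (y - a) ≤ γ) →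
      (∀ a ∈ U, y < a ∧ val ψ (y - a) ≤ γ) →
      ∃ y ∈ D, ∀ a ∈ F, (a < y ↔ a < c) ∧ val ψ (y - a) = val ψ (c - a) := by
    intro y hy hyc h1 h2
    refine ⟨y, hy, fun a ha => ?_⟩
    have e1 : y - a = (c - a) + (y - c) := by abel
    rcases (hmax a ha).lt_or_eq with hlt | heq
    · have hlt' := hlt.trans_le hyc
      rw [← sub_pos, ← sub_pos (b := a) (a := c), e1, h.add_pos_iff hlt', h.val_add_of_lt hlt']
      exact ⟨Iff.rfl, rfl⟩
    · have hge : γ ≤ val ψ (y - a) := by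
        rw [e1]
        exact h.le_val_add heq.ge hyc
      rw [heq]
      rcases hLU a ha heq with hm | hm
      · exact ⟨iff_of_true (h1 a hm).1 (hL.1 hm).2.1, le_antisymm (h1 a hm).2 hge⟩
      · exact ⟨iff_of_false (h2 a hm).1.not_gt (hU.1 hm).2.1.not_gt,
          le_antisymm (h2 a hm).2 hge⟩
  rcases L.eq_empty_or_nonempty with hLe | hLn <;> rcases U.eq_empty_or_nonempty with hUe | hUn
  · rcases hLU a₀ ha₀ rfl with hm | hm
    · simp [hLe] at hm
    · simp [hUe] at hm
  -- All closest points lie above `c`: step down from the least of them by a positive element of `D`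
  -- of value `γ`.
  · obtain ⟨u, hu, humin⟩ := U.exists_min_image id hUn
    obtain ⟨huF, hu1, hu2⟩ := hU.1 hu
    refine core (u - e) (D.sub_mem (hF _ huF) heD) ?_ (by simp [hLe]) fun a ha => ?_
    · have : u - e - c = (u - c) + (-e) := by abel
      rw [this]
      refine h.le_val_add ?_ ?_
      · rw [h.val_sub_comm, hu2]
      · rw [h.val_neg, heγ]
    · have h3 : e ≤ a - (u - e) := by
        have := humin a ha
        simp only [id] at this
        rw [show a - (u - e) = (a - u) + e by abel]
        exact le_add_of_nonneg_left (sub_nonneg.2 this)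
      refine ⟨sub_pos.1 (he.trans_le h3), ?_⟩
      rw [h.val_sub_comm, ← heγ]
      exact h.val_anti he h3
  · obtain ⟨l, hl, hlmax⟩ := L.exists_max_image id hLn
    obtain ⟨hlF, hl1, hl2⟩ := hL.1 hl
    refine core (l + e) (D.add_mem (hF _ hlF) heD) ?_ (fun a ha => ?_) (by simp [hUe])
    · have : l + e - c = (l - c) + e := by abel
      rw [this]
      refine h.le_val_add ?_ heγ.ge
      rw [h.val_sub_comm, hl2]
    · have h3 : e ≤ (l + e) - a := by
        have := hlmax a ha
        simp only [id] at this
        rw [show l + e - a = (l - a) + e by abel]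
        exact le_add_of_nonneg_left (sub_nonneg.2 this)
      refine ⟨sub_pos.1 (he.trans_le h3), ?_⟩
      rw [← heγ]
      exact h.val_anti he h3
  -- Closest points on both sides: the midpoint of the innermost pair works. Its difference from `c`
  -- is the average of two elements of value `γ`, and its distance to every point of `L` and `U` is
  -- at least half of `u - l`, hence of value at most `γ`.
  · obtain ⟨u, hu, humin⟩ := U.exists_min_image id hUn
    obtain ⟨huF, hu1, hu2⟩ := hU.1 hu
    obtain ⟨l, hl, hlmax⟩ := L.exists_max_image id hLn
    obtain ⟨hlF, hl1, hl2⟩ := hL.1 hl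
    have hlu : 0 < u - l := sub_pos.2 (hl1.trans hu1)
    have hhalf : (0 : ℚ) < 1 / 2 := by norm_num
    set d : Γ := (1 / 2 : ℚ) • (u - l) with hd
    have hdpos : 0 < d := (rat_smul_pos_iff hhalf _).2 hlu
    have hdγ : val ψ d ≤ γ := by
      rw [hd, h.val_smul hhalf.ne', ← hl2]
      exact h.val_anti (sub_pos.2 hl1) (sub_le_sub_right hu1.le _)
    have e1 : u - d = l + d := by
      rw [sub_eq_iff_eq_add, add_assoc, hd, ← add_smul]
      norm_num
    refine core (l + d) (D.add_mem (hF _ hlF) (D.smul_mem _ (D.sub_mem (hF _ huF) (hF _ hlF))))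
      ?_ (fun a ha => ?_) fun a ha => ?_
    · have : l + d - c = (1 / 2 : ℚ) • ((l - c) + (u - c)) := by
        rw [hd]; module
      rw [this, h.val_smul hhalf.ne']
      refine h.le_val_add ?_ ?_
      · rw [h.val_sub_comm, hl2]
      · rw [h.val_sub_comm, hu2]
    · have h3 : d ≤ (l + d) - a := by
        have := hlmax a ha
        simp only [id] at this
        rw [show l + d - a = (l - a) + d by abel]
        exact le_add_of_nonneg_left (sub_nonneg.2 this)
      exact ⟨sub_pos.1 (hdpos.trans_le h3), (h.val_anti hdpos h3).trans hdγ⟩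
    · have h3 : d ≤ a - (l + d) := by
        have := humin a ha
        simp only [id] at this
        rw [← e1, show a - (u - d) = (a - u) + d by abel]
        exact le_add_of_nonneg_left (sub_nonneg.2 this)
      refine ⟨sub_pos.1 (hdpos.trans_le h3), ?_⟩
      rw [h.val_sub_comm]
      exact (h.val_anti hdpos h3).trans hdγ

end IsLogCouple

end SingleCouple

/-! ## Partial isomorphisms -/

section PartialIso

set_option linter.unusedSectionVars false

variable {Γ Δ : Type*} [AddCommGroup Γ] [LinearOrder Γ] [IsOrderedAddMonoid Γ] [Module ℚ Γ]
  [AddCommGroup Δ] [LinearOrder Δ] [IsOrderedAddMonoid Δ] [Module ℚ Δ]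
  {ψ : Γ → Γ} {φ : Δ → Δ}

/-- The subspace `G` is the graph of an isomorphism of ordered vector spaces between subspaces of
`Γ` and `Δ`, and `P` is the graph of an isomorphism between subsets of `Ψ ∪ {0}` closed under
successors and predecessors; the common part of `G` and `P` contains the predecessors of all
`ψ`-values and all successors of elements of `G`. -/
structure PIso (ψ : Γ → Γ) (φ : Δ → Δ) (G : Submodule ℚ (Γ × Δ)) (P : Set (Γ × Δ)) : Prop where
  zero_mem : (0 : Γ × Δ) ∈ P
  mem_fst : ∀ p ∈ P, p.1 ∈ PsiZero ψ
  mem_snd : ∀ p ∈ P, p.2 ∈ PsiZero φ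
  lt_iff : ∀ p ∈ P, ∀ q ∈ P, (p.1 < q.1 ↔ p.2 < q.2)
  succ_mem : ∀ p ∈ P, (succ ψ p.1, succ φ p.2) ∈ P
  pred_mem : ∀ p ∈ P, p = 0 ∨ ∃ q ∈ P, p = (succ ψ q.1, succ φ q.2)
  pos_iff : ∀ g ∈ G, (0 < g.1 ↔ 0 < g.2)
  val_mem : ∀ g ∈ G, g.1 ≠ 0 → ∃ u ∈ P, u ∈ G ∧ val ψ g.1 = ((succ ψ u.1 : Γ) : WithTop Γ) ∧
    val φ g.2 = ((succ φ u.2 : Δ) : WithTop Δ)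
  succ_eq : ∀ g ∈ G, ∃ u ∈ P, u ∈ G ∧ succ ψ g.1 = succ ψ u.1 ∧ succ φ g.2 = succ φ u.2
  lt_succ_iff : ∀ g ∈ G, (g.1 < succ ψ g.1 ↔ g.2 < succ φ g.2)

namespace PIso

variable {G : Submodule ℚ (Γ × Δ)} {P : Set (Γ × Δ)}

theorem eq_iff (H : PIso ψ φ G P) {p q : Γ × Δ} (hp : p ∈ P) (hq : q ∈ P) :
    p.1 = q.1 ↔ p.2 = q.2 := by
  rw [eq_iff_le_not_lt, eq_iff_le_not_lt, ← not_lt, ← not_lt, H.lt_iff p hp q hq,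
    H.lt_iff q hq p hp]

theorem eq_of_fst_eq (H : PIso ψ φ G P) {p q : Γ × Δ} (hp : p ∈ P) (hq : q ∈ P)
    (h : p.1 = q.1) : p = q :=
  Prod.ext h ((H.eq_iff hp hq).1 h)

theorem lt_iff' (H : PIso ψ φ G P) {p q : Γ × Δ} (hp : p ∈ G) (hq : q ∈ G) :
    p.1 < q.1 ↔ p.2 < q.2 := by
  rw [← sub_pos, ← sub_pos (a := q.2)]
  exact H.pos_iff _ (G.sub_mem hq hp)

theorem neg_iff (H : PIso ψ φ G P) {p : Γ × Δ} (hp : p ∈ G) : p.1 < 0 ↔ p.2 < 0 :=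
  H.lt_iff' hp G.zero_mem

theorem eq_iff' (H : PIso ψ φ G P) {p q : Γ × Δ} (hp : p ∈ G) (hq : q ∈ G) :
    p.1 = q.1 ↔ p.2 = q.2 := by
  rw [eq_iff_le_not_lt, eq_iff_le_not_lt, ← not_lt, ← not_lt, H.lt_iff' hp hq,
    H.lt_iff' hq hp]

theorem eq_zero_iff (H : PIso ψ φ G P) {p : Γ × Δ} (hp : p ∈ G) : p.1 = 0 ↔ p.2 = 0 :=
  H.eq_iff' hp G.zero_mem

/-- Makes the "back" direction an instance of the "forth" direction. -/
theorem symm (H : PIso ψ φ G P) :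
    PIso φ ψ (G.comap (LinearEquiv.prodComm ℚ Δ Γ).toLinearMap) (Prod.swap ⁻¹' P) where
  zero_mem := H.zero_mem
  mem_fst p hp := H.mem_snd _ hp
  mem_snd p hp := H.mem_fst _ hp
  lt_iff p hp q hq := (H.lt_iff _ hp _ hq).symm
  succ_mem p hp := H.succ_mem _ hp
  pred_mem p hp := by
    rcases H.pred_mem _ hp with h | ⟨q, hq, h⟩
    · exact Or.inl (Prod.swap_injective h)
    · exact Or.inr ⟨q.swap, hq, Prod.swap_injective h⟩
  pos_iff g hg := (H.pos_iff _ hg).symm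
  val_mem g hg h0 := by
    obtain ⟨u, hu, huG, h1, h2⟩ := H.val_mem g.swap hg fun h => h0 ((H.eq_zero_iff hg).1 h)
    exact ⟨u.swap, hu, huG, h2, h1⟩
  succ_eq g hg := by
    obtain ⟨u, hu, huG, h1, h2⟩ := H.succ_eq g.swap hg
    exact ⟨u.swap, hu, huG, h2, h1⟩
  lt_succ_iff g hg := (H.lt_succ_iff _ hg).symm

theorem succ_lt_succ_iff (hψ : IsLogCouple ψ) (hφ : IsLogCouple φ)
    (H : PIso ψ φ G P) {p q : Γ × Δ} (hp : p ∈ P) (hq : q ∈ P) :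
    succ ψ p.1 < succ ψ q.1 ↔ succ φ p.2 < succ φ q.2 := by
  rw [hψ.succ_lt_iff (H.mem_fst _ hp) (H.mem_fst _ hq),
    hφ.succ_lt_iff (H.mem_snd _ hp) (H.mem_snd _ hq), H.lt_iff p hp q hq]

/-! ### Extending `P` -/

/-- `x` realizes a new cut in the domain of `P`, and its second component the corresponding
cut. -/
def NewCut (ψ : Γ → Γ) (φ : Δ → Δ) (P : Set (Γ × Δ)) (x : Γ × Δ) : Prop :=
  x.1 ∈ PsiZero ψ ∧ x.2 ∈ PsiZero φ ∧
    ∀ u ∈ P, (u.1 < x.1 ↔ u.2 < x.2) ∧ u.1 ≠ x.1 ∧ u.2 ≠ x.2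

/-- A nonzero point of `P` is the successor of a point of `P`, and `s` is strictly increasing on `Ψ
∪ {0}`; so a comparison with a successor reduces to one before applying `s`. -/
theorem NewCut.succ (hψ : IsLogCouple ψ) (hφ : IsLogCouple φ)
    (H : PIso ψ φ G P) {x : Γ × Δ} (hx : NewCut ψ φ P x) :
    NewCut ψ φ P (succ ψ x.1, succ φ x.2) := by
  refine ⟨hψ.succ_mem' _, hφ.succ_mem' _, fun u hu => ?_⟩
  rcases H.pred_mem u hu with rfl | ⟨q, hq, rfl⟩
  · have h1 := hψ.pos_of_mem (hψ.succ_mem x.1)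
    have h2 := hφ.pos_of_mem (hφ.succ_mem x.2)
    exact ⟨iff_of_true h1 h2, h1.ne, h2.ne⟩
  · obtain ⟨h1, h2, h3⟩ := hx.2.2 q hq
    refine ⟨?_, ?_, ?_⟩
    · simpa only [hψ.succ_lt_iff (H.mem_fst _ hq) hx.1, hφ.succ_lt_iff (H.mem_snd _ hq) hx.2.1]
    · simpa only [ne_eq, hψ.succ_inj (H.mem_fst _ hq) hx.1]
    · simpa only [ne_eq, hφ.succ_inj (H.mem_snd _ hq) hx.2.1]

theorem NewCut.iterate (hψ : IsLogCouple ψ) (hφ : IsLogCouple φ)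
    (H : PIso ψ φ G P) {x : Γ × Δ} (hx : NewCut ψ φ P x) (n : ℕ) :
    NewCut ψ φ P ((AsymCouple.succ ψ)^[n] x.1, (AsymCouple.succ φ)^[n] x.2) := by
  induction n with
  | zero => exact hx
  | succ n ih =>
    rw [Function.iterate_succ_apply', Function.iterate_succ_apply']
    exact NewCut.succ hψ hφ H ih

theorem iterate_succ_mem (H : PIso ψ φ G P) {p : Γ × Δ} (hp : p ∈ P) (n : ℕ) :
    ((succ ψ)^[n] p.1, (succ φ)^[n] p.2) ∈ P := by
  induction n with
  | zero => exact hp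
  | succ n ih =>
    rw [Function.iterate_succ_apply', Function.iterate_succ_apply']
    exact H.succ_mem _ ih

/-- The pairs obtained from `c` by iterated successors and predecessors. -/
def chain (ψ : Γ → Γ) (φ : Δ → Δ) (c : Γ × Δ) : Set (Γ × Δ) :=
  {x | x.1 ∈ PsiZero ψ ∧ x.2 ∈ PsiZero φ ∧ ∃ m n : ℕ,
    (succ ψ)^[m] x.1 = (succ ψ)^[n] c.1 ∧ (succ φ)^[m] x.2 = (succ φ)^[n] c.2}

/-- Enough iterations of `s` carry `x` into the forward orbit of `c`, and `P` into itself, without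
changing the order. -/
theorem NewCut.of_mem_chain (hψ : IsLogCouple ψ) (hφ : IsLogCouple φ)
    (H : PIso ψ φ G P) {c x : Γ × Δ} (hc : NewCut ψ φ P c)
    (hx : x ∈ chain ψ φ c) : NewCut ψ φ P x := by
  obtain ⟨hx1, hx2, m, n, h1, h2⟩ := hx
  refine ⟨hx1, hx2, fun u hu => ?_⟩
  obtain ⟨h3, h4, h5⟩ := (NewCut.iterate hψ hφ H hc n).2.2 _ (H.iterate_succ_mem hu m)
  simp only [← h1, ← h2] at h3 h4 h5
  refine ⟨?_, fun h => h4 (by rw [h]), fun h => h5 (by rw [h])⟩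
  rwa [hψ.iterate_lt_iff (H.mem_fst _ hu) hx1, hφ.iterate_lt_iff (H.mem_snd _ hu) hx2] at h3

theorem union_chain (hψ : IsLogCouple ψ) (hφ : IsLogCouple φ)
    (H : PIso ψ φ G P) {c : Γ × Δ} (hc : NewCut ψ φ P c) :
    PIso ψ φ G (P ∪ chain ψ φ c) where
  zero_mem := Or.inl H.zero_mem
  mem_fst p hp := hp.elim (H.mem_fst p) fun h => h.1
  mem_snd p hp := hp.elim (H.mem_snd p) fun h => h.2.1
  lt_iff := by
    have key : ∀ p ∈ P, ∀ q ∈ chain ψ φ c, (p.1 < q.1 ↔ p.2 < q.2) ∧ (q.1 < p.1 ↔ q.2 < p.2) := by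
      intro p hp q hq
      obtain ⟨h1, h2, h3⟩ := (NewCut.of_mem_chain hψ hφ H hc hq).2.2 p hp
      refine ⟨h1, ?_⟩
      rw [← not_le, ← not_le, h2.le_iff_lt, h3.le_iff_lt, h1]
    rintro p (hp | hp) q (hq | hq)
    · exact H.lt_iff p hp q hq
    · exact (key p hp q hq).1
    · exact (key q hq p hp).2
    · obtain ⟨hp1, hp2, m, n, h1, h2⟩ := hp
      obtain ⟨hq1, hq2, m', n', h3, h4⟩ := hq
      -- After `m + m'` successors both elements are iterates of `c`, with the same exponents in
      -- both coordinates, so that comparing them means comparing natural numbers.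
      rw [← hψ.iterate_lt_iff hp1 hq1 (m + m'), ← hφ.iterate_lt_iff hp2 hq2 (m + m'),
        Function.iterate_add_apply _ m m' q.1, Function.iterate_add_apply _ m m' q.2, h3, h4,
        add_comm m m', Function.iterate_add_apply _ m' m p.1, Function.iterate_add_apply _ m' m p.2,
        h1, h2]
      simp only [← Function.iterate_add_apply]
      rw [(hψ.iterate_strictMono hc.1).lt_iff_lt, (hφ.iterate_strictMono hc.2.1).lt_iff_lt]
  succ_mem := by
    rintro p (hp | ⟨hp1, hp2, m, n, h1, h2⟩)
    · exact Or.inl (H.succ_mem p hp)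
    · refine Or.inr ⟨hψ.succ_mem' _, hφ.succ_mem' _, m, n + 1, ?_, ?_⟩
      · rw [← Function.iterate_succ_apply, Function.iterate_succ_apply',
          Function.iterate_succ_apply', h1]
      · rw [← Function.iterate_succ_apply, Function.iterate_succ_apply',
          Function.iterate_succ_apply', h2]
  pred_mem := by
    rintro p (hp | hp)
    · refine (H.pred_mem p hp).imp_right ?_
      rintro ⟨q, hq, h⟩
      exact ⟨q, Or.inl hq, h⟩
    · obtain ⟨h1, h2, h3⟩ := NewCut.of_mem_chain hψ hφ H hc hp
      -- Since `0` lies in `P`, no element of the chain has a zero coordinate; each therefore has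
      -- predecessors.
      obtain ⟨-, h4, h5⟩ := h3 0 H.zero_mem
      obtain ⟨q1, hq1, e1⟩ := hψ.exists_pred (mem_psiSet_of_pos h1 ((hψ.nonneg_of_mem h1).lt_of_ne h4))
      obtain ⟨q2, hq2, e2⟩ := hφ.exists_pred (mem_psiSet_of_pos h2 ((hφ.nonneg_of_mem h2).lt_of_ne h5))
      refine Or.inr ⟨(q1, q2), Or.inr ?_, Prod.ext e1.symm e2.symm⟩
      obtain ⟨-, -, m, n, h6, h7⟩ := hp
      refine ⟨hq1, hq2, m + 1, n, ?_, ?_⟩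
      · rw [Function.iterate_succ_apply, e1, h6]
      · rw [Function.iterate_succ_apply, e2, h7]
  pos_iff := H.pos_iff
  val_mem g hg h0 := by
    obtain ⟨u, hu, h⟩ := H.val_mem g hg h0
    exact ⟨u, Or.inl hu, h⟩
  succ_eq g hg := by
    obtain ⟨u, hu, h⟩ := H.succ_eq g hg
    exact ⟨u, Or.inl hu, h⟩
  lt_succ_iff := H.lt_succ_iff

/-! ### Extending `G` -/

/-- For `q ≠ 0` the element is `q (c - a)` with `a` in `G`, so its sign is given by the sign of `q`
and the cut of `c` over `G`. -/
theorem add_smul_pos_iff (H : PIso ψ φ G P) {c : Γ × Δ}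
    (hne : ∀ g ∈ G, g.1 ≠ c.1 ∧ g.2 ≠ c.2) (hlt : ∀ g ∈ G, (g.1 < c.1 ↔ g.2 < c.2))
    {g : Γ × Δ} (hg : g ∈ G) (q : ℚ) : 0 < g.1 + q • c.1 ↔ 0 < g.2 + q • c.2 := by
  rcases eq_or_ne q 0 with rfl | hq0
  · simpa using H.pos_iff g hg
  set a := (-q⁻¹) • g with ha
  have haG : a ∈ G := G.smul_mem _ hg
  have e1 : g.1 + q • c.1 = q • (c.1 - a.1) := by
    simp [ha, smul_smul, hq0, add_comm]
  have e2 : g.2 + q • c.2 = q • (c.2 - a.2) := by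
    simp [ha, smul_smul, hq0, add_comm]
  rw [e1, e2]
  rcases hq0.lt_or_gt with hq | hq
  · rw [rat_smul_pos_iff_of_neg hq, rat_smul_pos_iff_of_neg hq, sub_neg, sub_neg, ← not_le,
      ← not_le, (hne a haG).1.le_iff_lt, (hne a haG).2.le_iff_lt, hlt a haG]
  · rw [rat_smul_pos_iff hq, rat_smul_pos_iff hq, sub_pos, sub_pos, hlt a haG]

theorem add_smul_neg_iff (H : PIso ψ φ G P) {c : Γ × Δ}
    (hne : ∀ g ∈ G, g.1 ≠ c.1 ∧ g.2 ≠ c.2) (hlt : ∀ g ∈ G, (g.1 < c.1 ↔ g.2 < c.2))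
    {g : Γ × Δ} (hg : g ∈ G) (q : ℚ) : g.1 + q • c.1 < 0 ↔ g.2 + q • c.2 < 0 := by
  have := H.add_smul_pos_iff hne hlt (G.neg_mem hg) (-q)
  simpa only [Prod.fst_neg, Prod.snd_neg, neg_smul, ← neg_add, neg_pos] using this

/-- The data needed to adjoin one element. Values are required only for `c - g`, since every new
element is a nonzero multiple of such a difference; successors are not invariant under scaling and
must be given for all `g + q c`. -/
theorem adjoin (hψ : IsLogCouple ψ) (hφ : IsLogCouple φ) (H : PIso ψ φ G P) {c : Γ × Δ}
    (hlt : ∀ g ∈ G, (g.1 < c.1 ↔ g.2 < c.2))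
    (hval : ∀ g ∈ G, ∃ u ∈ P, u ∈ G ⊔ Submodule.span ℚ {c} ∧
      val ψ (c.1 - g.1) = ((succ ψ u.1 : Γ) : WithTop Γ) ∧
      val φ (c.2 - g.2) = ((succ φ u.2 : Δ) : WithTop Δ))
    (hsucc : ∀ g ∈ G, ∀ q : ℚ, q ≠ 0 → ∃ u ∈ P, u ∈ G ⊔ Submodule.span ℚ {c} ∧
      succ ψ (g.1 + q • c.1) = succ ψ u.1 ∧ succ φ (g.2 + q • c.2) = succ φ u.2 ∧
      (g.1 + q • c.1 < succ ψ (g.1 + q • c.1) ↔ g.2 + q • c.2 < succ φ (g.2 + q • c.2))) :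
    PIso ψ φ (G ⊔ Submodule.span ℚ {c}) P := by
  have hne : ∀ g ∈ G, g.1 ≠ c.1 ∧ g.2 ≠ c.2 := fun g hg => by
    obtain ⟨u, -, -, h1, h2⟩ := hval g hg
    exact ⟨(sub_ne_zero.1 (ne_zero_of_val_eq h1)).symm,
      (sub_ne_zero.1 (ne_zero_of_val_eq h2)).symm⟩
  have hmem : ∀ x ∈ G ⊔ Submodule.span ℚ {c}, ∃ g ∈ G, ∃ q : ℚ, x = g + q • c := fun x hx => by
    obtain ⟨g, hg, y, hy, rfl⟩ := Submodule.mem_sup.1 hx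
    obtain ⟨q, rfl⟩ := Submodule.mem_span_singleton.1 hy
    exact ⟨g, hg, q, rfl⟩
  have hle : G ≤ G ⊔ Submodule.span ℚ {c} := le_sup_left
  refine ⟨H.zero_mem, H.mem_fst, H.mem_snd, H.lt_iff, H.succ_mem, H.pred_mem, ?_, ?_, ?_, ?_⟩
  · intro x hx
    obtain ⟨g, hg, q, rfl⟩ := hmem x hx
    exact H.add_smul_pos_iff hne hlt hg q
  · intro x hx h0
    obtain ⟨g, hg, q, rfl⟩ := hmem x hx
    rcases eq_or_ne q 0 with rfl | hq0
    · rw [zero_smul, add_zero] at h0 ⊢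
      obtain ⟨u, hu, huG, h⟩ := H.val_mem g hg h0
      exact ⟨u, hu, hle huG, h⟩
    · obtain ⟨u, hu, huG, h1, h2⟩ := hval ((-q⁻¹) • g) (G.smul_mem _ hg)
      have e : g + q • c = q • (c - (-q⁻¹) • g) := by
        simp [smul_smul, hq0, add_comm]
      refine ⟨u, hu, huG, ?_, ?_⟩
      · rw [e, Prod.smul_fst, hψ.val_smul hq0, Prod.fst_sub, h1]
      · rw [e, Prod.smul_snd, hφ.val_smul hq0, Prod.snd_sub, h2]
  · intro x hx
    obtain ⟨g, hg, q, rfl⟩ := hmem x hx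
    rcases eq_or_ne q 0 with rfl | hq0
    · rw [zero_smul, add_zero]
      obtain ⟨u, hu, huG, h⟩ := H.succ_eq g hg
      exact ⟨u, hu, hle huG, h⟩
    · obtain ⟨u, hu, huG, h1, h2, -⟩ := hsucc g hg q hq0
      exact ⟨u, hu, huG, h1, h2⟩
  · intro x hx
    obtain ⟨g, hg, q, rfl⟩ := hmem x hx
    rcases eq_or_ne q 0 with rfl | hq0
    · rw [zero_smul, add_zero]
      exact H.lt_succ_iff g hg
    · obtain ⟨u, hu, huG, h1, h2, h3⟩ := hsucc g hg q hq0
      exact h3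

/-- Successors of elements of `G` are `succ` of points of `P` in `G`, hence differ from that of `c`,
which is not in `G`. With no ties, the successor identity computes everything about `g + q c` from
the order on `P` and the signs in `G`. -/
theorem adjoin_of_mem (hψ : IsLogCouple ψ) (hφ : IsLogCouple φ)
    (H : PIso ψ φ G P) {c : Γ × Δ} (hc : c ∈ P) (hcG : c ∉ G) :
    PIso ψ φ (G ⊔ Submodule.span ℚ {c}) P := by
  have hc1 := H.mem_fst c hc
  have hc2 := H.mem_snd c hc
  have hcm : c ∈ G ⊔ Submodule.span ℚ {c} :=
    Submodule.mem_sup_right (Submodule.mem_span_singleton_self c)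
  have hle : G ≤ G ⊔ Submodule.span ℚ {c} := le_sup_left
  have hcases : ∀ u ∈ P, u ∈ G → (succ ψ u.1 < succ ψ c.1 ∧ succ φ u.2 < succ φ c.2) ∨
      (succ ψ c.1 < succ ψ u.1 ∧ succ φ c.2 < succ φ u.2) := by
    intro u hu huG
    have hne : u.1 ≠ c.1 := fun h => hcG (H.eq_of_fst_eq hu hc h ▸ huG)
    rcases hne.lt_or_gt with h | h
    · have := hψ.succ_lt_succ (H.mem_fst u hu) hc1 h
      exact Or.inl ⟨this, (H.succ_lt_succ_iff hψ hφ hu hc).1 this⟩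
    · have := hψ.succ_lt_succ hc1 (H.mem_fst u hu) h
      exact Or.inr ⟨this, (H.succ_lt_succ_iff hψ hφ hc hu).1 this⟩
  have hlt : ∀ g ∈ G, (g.1 < c.1 ↔ g.2 < c.2) := by
    intro g hg
    obtain ⟨u, hu, huG, h1, h2⟩ := H.succ_eq g hg
    rcases hcases u hu huG with ⟨h3, h4⟩ | ⟨h3, h4⟩ <;> rw [← h1] at h3 <;> rw [← h2] at h4
    · rw [hψ.lt_iff_of_succ_lt h3, hφ.lt_iff_of_succ_lt h4, H.lt_succ_iff g hg]
    · exact iff_of_false (hψ.lt_of_lt_succ hc1 h3).not_gt (hφ.lt_of_lt_succ hc2 h4).not_gt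
  have hval : ∀ g ∈ G, ∃ u ∈ P, u ∈ G ⊔ Submodule.span ℚ {c} ∧
      val ψ (c.1 - g.1) = ((succ ψ u.1 : Γ) : WithTop Γ) ∧
      val φ (c.2 - g.2) = ((succ φ u.2 : Δ) : WithTop Δ) := by
    intro g hg
    obtain ⟨u, hu, huG, h1, h2⟩ := H.succ_eq g hg
    rcases hcases u hu huG with ⟨h3, h4⟩ | ⟨h3, h4⟩ <;> rw [← h1] at h3 <;> rw [← h2] at h4
    · exact ⟨u, hu, hle huG, by rw [hψ.val_sub_left h3, h1], by rw [hφ.val_sub_left h4, h2]⟩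
    · exact ⟨c, hc, hcm, hψ.val_sub_of_lt h3, hφ.val_sub_of_lt h4⟩
  have hne : ∀ g ∈ G, g.1 ≠ c.1 ∧ g.2 ≠ c.2 := fun g hg => by
    obtain ⟨u, -, -, h1, h2⟩ := hval g hg
    exact ⟨(sub_ne_zero.1 (ne_zero_of_val_eq h1)).symm,
      (sub_ne_zero.1 (ne_zero_of_val_eq h2)).symm⟩
  refine H.adjoin hψ hφ hlt hval fun g hg q hq0 => ?_
  by_cases hq1 : q = 1
  · subst hq1
    rw [one_smul, one_smul, add_comm g.1, add_comm g.2]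
    -- For `q = 1`, a summand of value above `succ ψ c.1` leaves the successor of `c` unchanged; the
    -- case `g = 0` is included through the value `∞`.
    have hbig : ∀ {e : Γ} {e' : Δ}, ((succ ψ c.1 : Γ) : WithTop Γ) < val ψ e →
        ((succ φ c.2 : Δ) : WithTop Δ) < val φ e' → ∃ u ∈ P, u ∈ G ⊔ Submodule.span ℚ {c} ∧
        succ ψ (c.1 + e) = succ ψ u.1 ∧ succ φ (c.2 + e') = succ φ u.2 ∧
        (c.1 + e < succ ψ (c.1 + e) ↔ c.2 + e' < succ φ (c.2 + e')) := fun h3 h4 =>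
      ⟨c, hc, hcm, hψ.succ_add_eq_left h3, hφ.succ_add_eq_left h4,
        iff_of_true (hψ.add_lt_succ hc1 h3) (hφ.add_lt_succ hc2 h4)⟩
    by_cases hg0 : g.1 = 0
    · refine hbig ?_ ?_
      · rw [hg0, val_zero]; exact WithTop.coe_lt_top _
      · rw [(H.eq_zero_iff hg).1 hg0, val_zero]; exact WithTop.coe_lt_top _
    obtain ⟨u, hu, huG, h1, h2⟩ := H.val_mem g hg hg0
    rcases hcases u hu huG with ⟨h3, h4⟩ | ⟨h3, h4⟩ <;> rw [← WithTop.coe_lt_coe, ← h1] at h3 <;>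
      rw [← WithTop.coe_lt_coe, ← h2] at h4
    · refine ⟨u, hu, hle huG, ?_, ?_, ?_⟩
      · have := hψ.succ_add_eq_val h3
        rw [h1] at this
        exact_mod_cast this.symm
      · have := hφ.succ_add_eq_val h4
        rw [h2] at this
        exact_mod_cast this.symm
      · rw [hψ.add_lt_succ_iff h3, hφ.add_lt_succ_iff h4, H.neg_iff hg]
    · exact hbig h3 h4
  · have hq1' : q - 1 ≠ 0 := sub_ne_zero.2 hq1
    -- Chosen so that `g + q c` is both `c + (q - 1)(c - a)` and `a + q (c - a)`. Whichever of `c`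
    -- and `a` has the larger successor serves as base point, and then the multiple of `c - a` has
    -- value below that successor.
    set a : Γ × Δ := (-(q - 1)⁻¹) • g with ha
    have haG : a ∈ G := G.smul_mem _ hg
    have hga : g = (-(q - 1)) • a := by
      rw [ha, smul_smul, neg_mul_neg, mul_inv_cancel₀ hq1', one_smul]
    have e1 : g + q • c = c + (q - 1) • (c - a) := by rw [hga]; module
    have e2 : g + q • c = a + q • (c - a) := by rw [hga]; module
    have hsg : ∀ r : ℚ, (r • (c.1 - a.1) < 0 ↔ r • (c.2 - a.2) < 0) := fun r => by
      have := H.add_smul_neg_iff hne hlt (G.smul_mem (-r) haG) r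
      simpa only [Prod.smul_fst, Prod.smul_snd, neg_smul, Prod.fst_neg, Prod.snd_neg, neg_add_eq_sub,
        ← smul_sub] using this
    obtain ⟨u, hu, huG, h1, h2⟩ := H.succ_eq a haG
    rcases hcases u hu huG with ⟨h3, h4⟩ | ⟨h3, h4⟩ <;> rw [← h1] at h3 <;> rw [← h2] at h4
    · have v1 : val ψ ((q - 1) • (c.1 - a.1)) = ((succ ψ a.1 : Γ) : WithTop Γ) := by
        rw [hψ.val_smul hq1', hψ.val_sub_left h3]
      have v2 : val φ ((q - 1) • (c.2 - a.2)) = ((succ φ a.2 : Δ) : WithTop Δ) := by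
        rw [hφ.val_smul hq1', hφ.val_sub_left h4]
      have w1 := v1.trans_lt (WithTop.coe_lt_coe.2 h3)
      have w2 := v2.trans_lt (WithTop.coe_lt_coe.2 h4)
      have f1 : g.1 + q • c.1 = c.1 + (q - 1) • (c.1 - a.1) := congrArg Prod.fst e1
      have f2 : g.2 + q • c.2 = c.2 + (q - 1) • (c.2 - a.2) := congrArg Prod.snd e1
      rw [f1, f2]
      refine ⟨u, hu, hle huG, ?_, ?_, ?_⟩
      · have := hψ.succ_add_eq_val w1
        rw [v1, h1] at this
        exact_mod_cast this.symm
      · have := hφ.succ_add_eq_val w2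
        rw [v2, h2] at this
        exact_mod_cast this.symm
      · rw [hψ.add_lt_succ_iff w1, hφ.add_lt_succ_iff w2, hsg]
    · have v1 : val ψ (q • (c.1 - a.1)) = ((succ ψ c.1 : Γ) : WithTop Γ) := by
        rw [hψ.val_smul hq0, hψ.val_sub_of_lt h3]
      have v2 : val φ (q • (c.2 - a.2)) = ((succ φ c.2 : Δ) : WithTop Δ) := by
        rw [hφ.val_smul hq0, hφ.val_sub_of_lt h4]
      have f1 : g.1 + q • c.1 = a.1 + q • (c.1 - a.1) := congrArg Prod.fst e2
      have f2 : g.2 + q • c.2 = a.2 + q • (c.2 - a.2) := congrArg Prod.snd e2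
      rw [f1, f2]
      refine ⟨c, hc, hcm, hψ.succ_add_eq_of_val v1 h3, hφ.succ_add_eq_of_val v2 h4, ?_⟩
      rw [hψ.add_lt_succ_iff (v1.trans_lt (WithTop.coe_lt_coe.2 h3)),
        hφ.add_lt_succ_iff (v2.trans_lt (WithTop.coe_lt_coe.2 h4)), hsg]

/-- When `P ⊆ G`, candidate successors lie in `G`, and being the successor is a condition on the
value of a difference. So the cut and the values of `c - g` suffice, and successors need only be
located in `Γ`. -/
theorem adjoin_of_subset (hψ : IsLogCouple ψ) (hφ : IsLogCouple φ)
    (H : PIso ψ φ G P) (hPG : P ⊆ G) {c : Γ × Δ}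
    (hlt : ∀ g ∈ G, (g.1 < c.1 ↔ g.2 < c.2))
    (hval : ∀ g ∈ G, ∃ u ∈ P, val ψ (c.1 - g.1) = ((succ ψ u.1 : Γ) : WithTop Γ) ∧
      val φ (c.2 - g.2) = ((succ φ u.2 : Δ) : WithTop Δ))
    (hsucc : ∀ g ∈ G, ∀ q : ℚ, ∃ u ∈ P, succ ψ (g.1 + q • c.1) = succ ψ u.1) :
    PIso ψ φ (G ⊔ Submodule.span ℚ {c}) P := by
  have hne : ∀ g ∈ G, g.1 ≠ c.1 ∧ g.2 ≠ c.2 := fun g hg => by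
    obtain ⟨u, -, h1, h2⟩ := hval g hg
    exact ⟨(sub_ne_zero.1 (ne_zero_of_val_eq h1)).symm,
      (sub_ne_zero.1 (ne_zero_of_val_eq h2)).symm⟩
  have hle : G ≤ G ⊔ Submodule.span ℚ {c} := le_sup_left
  refine H.adjoin hψ hφ hlt (fun g hg => ?_) fun g hg q hq0 => ?_
  · obtain ⟨u, hu, h⟩ := hval g hg
    exact ⟨u, hu, hle (hPG hu), h⟩
  obtain ⟨u, hu, h1⟩ := hsucc g hg q
  set t : Γ × Δ := (succ ψ u.1, succ φ u.2) with ht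
  have htP : t ∈ P := H.succ_mem u hu
  have htG : g - t ∈ G := G.sub_mem hg (hPG htP)
  have h2 : succ φ (g.2 + q • c.2) = succ φ u.2 := by
    -- The difference of `g + q c` and its presumed successor `t` is a multiple of some `c - a` with
    -- `a` in `G`; its value on the first side is `t.1`, so by injectivity `r = u` and its value on
    -- the second side is `t.2`.
    obtain ⟨r, hr, h3, h4⟩ := hval _ (G.smul_mem (-q⁻¹) htG)
    have e : g + q • c - t = q • (c - (-q⁻¹) • (g - t)) := by
      rw [smul_sub, smul_smul, mul_neg, mul_inv_cancel₀ hq0]; module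
    have e1 : g.1 + q • c.1 - t.1 = q • (c.1 - ((-q⁻¹) • (g - t)).1) := congrArg Prod.fst e
    have e2 : g.2 + q • c.2 - t.2 = q • (c.2 - ((-q⁻¹) • (g - t)).2) := congrArg Prod.snd e
    have h5 := hψ.val_sub_succ (g.1 + q • c.1)
    rw [h1] at h5
    rw [show succ ψ u.1 = t.1 from rfl, e1, hψ.val_smul hq0, h3, WithTop.coe_inj] at h5
    have h6 := H.eq_of_fst_eq hr hu ((hψ.succ_inj (H.mem_fst r hr) (H.mem_fst u hu)).1 h5)
    refine hφ.succ_eq_of_val ?_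
    rw [show succ φ u.2 = t.2 from rfl, e2, hφ.val_smul hq0, h4, h6]
  refine ⟨u, hu, hle (hPG hu), h1, h2, ?_⟩
  rw [h1, h2]
  have := H.add_smul_neg_iff hne hlt htG q
  simp only [Prod.fst_sub, Prod.snd_sub, sub_add_eq_add_sub, sub_neg] at this
  exact this

end PIso

end PartialIso


/-! ### Extending partial isomorphisms into a saturated couple. -/

section Extension

set_option linter.unusedSectionVars false

variable {Γ Δ : Type*} [AddCommGroup Γ] [LinearOrder Γ] [IsOrderedAddMonoid Γ] [Module ℚ Γ]
  [AddCommGroup Δ] [LinearOrder Δ] [IsOrderedAddMonoid Δ] [Module ℚ Δ]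
  {ψ : Γ → Γ} {φ : Δ → Δ}

/-- The sets used in the saturation condition. -/
inductive IsBasicSet (ψ : Γ → Γ) : Set Γ → Prop
  | gt_val (b e : Γ) : IsBasicSet ψ {y | b < y ∧ val ψ (y - b) = (e : WithTop Γ)}
  | lt_val (b e : Γ) : IsBasicSet ψ {y | y < b ∧ val ψ (y - b) = (e : WithTop Γ)}
  | gt_mem (b : Γ) : IsBasicSet ψ {y | y ∈ PsiSet ψ ∧ b < y}
  | lt_mem (b : Γ) : IsBasicSet ψ {y | y ∈ PsiSet ψ ∧ y < b}

/-- Countable families of basic sets with the finite intersection property have nonempty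
intersection. -/
def IsSaturated (ψ : Γ → Γ) : Prop :=
  ∀ S : ℕ → Set Γ, (∀ n, IsBasicSet ψ (S n)) → (∀ F : Finset ℕ, ∃ y, ∀ n ∈ F, y ∈ S n) →
    ∃ y, ∀ n, y ∈ S n

theorem IsSaturated.exists_mem (hs : IsSaturated ψ) {ι : Type*} [Countable ι] (S : ι → Set Γ)
    (hS : ∀ i, IsBasicSet ψ (S i)) (hF : ∀ F : Finset ι, ∃ y, ∀ i ∈ F, y ∈ S i) :
    ∃ y, ∀ i, y ∈ S i := by
  classical
  cases isEmpty_or_nonempty ι with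
  | inl h => exact ⟨0, fun i => isEmptyElim i⟩
  | inr h =>
    obtain ⟨f, hf⟩ := exists_surjective_nat ι
    obtain ⟨y, hy⟩ := hs (S ∘ f) (fun n => hS _) fun F => by
      obtain ⟨y, hy⟩ := hF (F.image f)
      exact ⟨y, fun n hn => hy _ (Finset.mem_image_of_mem f hn)⟩
    refine ⟨y, fun i => ?_⟩
    obtain ⟨n, rfl⟩ := hf i
    exact hy n

/-- Subspaces closed under the operations of the language. -/
structure IsClosedSubspace (ψ : Γ → Γ) (A : Submodule ℚ Γ) : Prop where
  psi_mem : ∀ x ∈ A, x ≠ 0 → ψ x ∈ A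
  succ_mem : ∀ x ∈ A, succ ψ x ∈ A
  pred_mem : ∀ x ∈ PsiZero ψ, succ ψ x ∈ A → x ∈ A

theorem IsClosedSubspace.iterate_mem {A : Submodule ℚ Γ} (hA : IsClosedSubspace ψ A) {x : Γ}
    (hx : x ∈ A) (n : ℕ) : (succ ψ)^[n] x ∈ A := by
  induction n with
  | zero => exact hx
  | succ n ih => rw [Function.iterate_succ_apply']; exact hA.succ_mem _ ih

theorem IsClosedSubspace.of_iterate_mem {A : Submodule ℚ Γ} (hA : IsClosedSubspace ψ A)
    (hψ : IsLogCouple ψ) {x : Γ} (hx : x ∈ PsiZero ψ) (n : ℕ) (hn : (succ ψ)^[n] x ∈ A) :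
    x ∈ A := by
  induction n generalizing x with
  | zero => exact hn
  | succ n ih => exact hA.pred_mem x hx (ih (hψ.succ_mem' x) hn)

namespace PIso

variable {G : Submodule ℚ (Γ × Δ)} {P : Set (Γ × Δ)}

/-- Discreteness of `Ψ` gives finite satisfiability: just above the largest relevant point below `c`
sits its successor, which is at most `c` and so below all points of `P` above `c`. -/
theorem exists_newCut (hψ : IsLogCouple ψ) (hφ : IsLogCouple φ)
    (hs : IsSaturated φ) (H : PIso ψ φ G P) (hP : P.Countable) {c : Γ}
    (hc : c ∈ PsiZero ψ) (hcP : ∀ u ∈ P, u.1 ≠ c) : ∃ d, NewCut ψ φ P (c, d) := by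
  classical
  have := hP.to_subtype
  have h0c : 0 < c := (hψ.nonneg_of_mem hc).lt_of_ne (hcP 0 H.zero_mem)
  obtain ⟨d, hd⟩ := hs.exists_mem
    (fun u : P => if u.1.1 < c then {y | y ∈ PsiSet φ ∧ u.1.2 < y} else
      {y | y ∈ PsiSet φ ∧ y < u.1.2})
    (fun u => by split_ifs; exacts [.gt_mem _, .lt_mem _]) fun F => by
      -- Inserting `0`, which is below `c`, guarantees that a maximum exists.
      let F' : Finset P := (insert ⟨0, H.zero_mem⟩ F).filter fun u => u.1.1 < c
      obtain ⟨m, hm, hmax⟩ := F'.exists_max_image (fun u => u.1.1)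
        ⟨⟨0, H.zero_mem⟩, by simp [F', h0c]⟩
      have hmc : m.1.1 < c := (Finset.mem_filter.1 hm).2
      refine ⟨succ φ m.1.2, fun u hu => ?_⟩
      split_ifs with h
      · refine ⟨hφ.succ_mem _, ?_⟩
        have h1 : u.1.1 ≤ m.1.1 := hmax u (by simp [F', h, hu])
        have h2 : u.1.2 ≤ m.1.2 := by
          rw [← not_lt, ← H.lt_iff _ m.2 _ u.2, not_lt]
          exact h1
        exact h2.trans_lt (hφ.lt_succ (H.mem_snd _ m.2))
      · refine ⟨hφ.succ_mem _, ?_⟩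
        have h1 : c < u.1.1 := lt_of_le_of_ne (not_lt.1 h) (hcP _ u.2).symm
        have h2 := hψ.succ_le (H.mem_fst _ m.2) hc hmc
        exact (H.lt_iff _ (H.succ_mem _ m.2) _ u.2).1 (h2.trans_lt h1)
  have key : ∀ u ∈ P, (u.1 < c → d ∈ PsiSet φ ∧ u.2 < d) ∧ (¬ u.1 < c → d ∈ PsiSet φ ∧ d < u.2) := by
    intro u hu
    have := hd ⟨u, hu⟩
    dsimp only at this
    split_ifs at this with h
    · exact ⟨fun _ => this, fun h' => absurd h h'⟩
    · exact ⟨fun h' => absurd h' h, fun _ => this⟩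
  refine ⟨d, hc, Or.inr ((key 0 H.zero_mem).1 h0c).1, fun u hu => ?_⟩
  by_cases h : u.1 < c
  · have := ((key u hu).1 h).2
    exact ⟨iff_of_true h this, hcP u hu, this.ne⟩
  · have := ((key u hu).2 h).2
    exact ⟨iff_of_false h this.not_gt, hcP u hu, this.ne'⟩

/-- Over finitely many elements, the cut and the values of `c` are realized by some `y` in the
domain of `G`; the image of `y` satisfies the transported conditions, and saturation handles all of
the countable `G` at once. -/
theorem exists_adjoin (hψ : IsLogCouple ψ) (hφ : IsLogCouple φ)
    (hs : IsSaturated φ) (H : PIso ψ φ G P) (hPG : P ⊆ G)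
    (hG : (G : Set (Γ × Δ)).Countable) {c : Γ}
    (hval : ∀ g ∈ G, ∃ u ∈ P, val ψ (c - g.1) = ((succ ψ u.1 : Γ) : WithTop Γ))
    (hsucc : ∀ g ∈ G, ∀ q : ℚ, ∃ u ∈ P, succ ψ (g.1 + q • c) = succ ψ u.1) :
    ∃ d, PIso ψ φ (G ⊔ Submodule.span ℚ {(c, d)}) P := by
  classical
  have := hG.to_subtype
  choose! u huP hu using hval
  obtain ⟨d, hd⟩ := hs.exists_mem
    (fun g : G => if g.1.1 < c then
      {y | g.1.2 < y ∧ val φ (y - g.1.2) = ((succ φ (u g.1).2 : Δ) : WithTop Δ)} else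
      {y | y < g.1.2 ∧ val φ (y - g.1.2) = ((succ φ (u g.1).2 : Δ) : WithTop Δ)})
    (fun u => by split_ifs; exacts [.gt_val _ _, .lt_val _ _]) fun F => by
      obtain ⟨y, hy, hyF⟩ := hψ.exists_approx (G.map (LinearMap.fst ℚ Γ Δ)) (c := c) (by
        rintro _ ⟨g, hg, rfl⟩
        -- This element has value `succ ψ (u g).1` and lies in the domain because `P ⊆ G`.
        refine ⟨(u g).1 - succ ψ (u g).1, ?_, (hψ.sub_succ _).1, ?_⟩
        · exact ⟨_, G.sub_mem (hPG (huP g hg)) (hPG (H.succ_mem _ (huP g hg))), rfl⟩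
        · rw [hψ.val_sub_succ]
          exact hu g hg)
        (F.image fun g => g.1.1) (by
          intro a ha
          obtain ⟨g, -, rfl⟩ := Finset.mem_image.1 ha
          exact ⟨g.1, g.2, rfl⟩)
      obtain ⟨y, hyG, rfl⟩ := hy
      refine ⟨y.2, fun g hgF => ?_⟩
      obtain ⟨h1, h2⟩ := hyF g.1.1 (Finset.mem_image_of_mem _ hgF)
      simp only [LinearMap.fst_apply] at h1 h2
      rw [hu g.1 g.2] at h2
      have h3 : val φ (y.2 - g.1.2) = ((succ φ (u g.1).2 : Δ) : WithTop Δ) := by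
        obtain ⟨v, hv, -, h4, h5⟩ := H.val_mem _ (G.sub_mem hyG g.2) (ne_zero_of_val_eq h2)
        rw [Prod.fst_sub, h2, WithTop.coe_inj, hψ.succ_inj (H.mem_fst _ (huP _ g.2)) (H.mem_fst _ hv)]
          at h4
        rw [H.eq_of_fst_eq (huP _ g.2) hv h4]
        exact h5
      split_ifs with h
      · exact ⟨(H.lt_iff' g.2 hyG).1 (h1.2 h), h3⟩
      · refine ⟨?_, h3⟩
        have h4 : ¬ g.1.2 < y.2 := by rwa [← H.lt_iff' g.2 hyG, h1]
        exact lt_of_le_of_ne (not_lt.1 h4) (sub_ne_zero.1 (ne_zero_of_val_eq h3))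
  have hd' : ∀ g ∈ G, (g.1 < c ↔ g.2 < d) ∧
      val φ (d - g.2) = ((succ φ (u g).2 : Δ) : WithTop Δ) := by
    intro g hg
    have := hd ⟨g, hg⟩
    dsimp only at this
    split_ifs at this with h
    · exact ⟨iff_of_true h this.1, this.2⟩
    · exact ⟨iff_of_false h this.1.not_gt, this.2⟩
  exact ⟨d, H.adjoin_of_subset hψ hφ hPG (fun g hg => (hd' g hg).1)
    (fun g hg => ⟨u g, huP g hg, hu g hg, (hd' g hg).2⟩) hsucc⟩

/-- Zorn's lemma: each condition concerns finitely many elements, so unions of chains of partial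
isomorphisms are again partial isomorphisms. -/
theorem exists_maximal (H : PIso ψ φ G P) (A : Submodule ℚ Γ) (hG : ∀ g ∈ G, g.1 ∈ A)
    (hP : ∀ p ∈ P, p.1 ∈ A) :
    ∃ G' P', G ≤ G' ∧ P ⊆ P' ∧ PIso ψ φ G' P' ∧ (∀ g ∈ G', g.1 ∈ A) ∧ (∀ p ∈ P', p.1 ∈ A) ∧
      ∀ G'' P'', PIso ψ φ G'' P'' → (∀ g ∈ G'', g.1 ∈ A) → (∀ p ∈ P'', p.1 ∈ A) →
        G' ≤ G'' → P' ⊆ P'' → G'' ≤ G' ∧ P'' ⊆ P' := by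
  let S : Set (Submodule ℚ (Γ × Δ) × Set (Γ × Δ)) :=
    {X | PIso ψ φ X.1 X.2 ∧ (∀ g ∈ X.1, g.1 ∈ A) ∧ ∀ p ∈ X.2, p.1 ∈ A}
  obtain ⟨m, hm, hmax⟩ := zorn_le_nonempty₀ S (fun C hCS hC X₀ hX₀ => by
    let G₁ : Submodule ℚ (Γ × Δ) := sSup (Prod.fst '' C)
    let P₁ : Set (Γ × Δ) := ⋃ X ∈ C, X.2
    have hG₁ : ∀ {g}, g ∈ G₁ ↔ ∃ X ∈ C, g ∈ X.1 := by
      intro g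
      have hdir : DirectedOn (fun U V => U ≤ V) (Prod.fst '' C) := by
        rintro _ ⟨X, hX, rfl⟩ _ ⟨Y, hY, rfl⟩
        rcases hC.total hX hY with h | h
        · exact ⟨_, ⟨Y, hY, rfl⟩, h.1, le_rfl⟩
        · exact ⟨_, ⟨X, hX, rfl⟩, le_rfl, h.1⟩
      rw [Submodule.mem_sSup_of_directed (Set.Nonempty.image _ ⟨X₀, hX₀⟩) hdir]
      simp
    have hP₁ : ∀ {p}, p ∈ P₁ ↔ ∃ X ∈ C, p ∈ X.2 := by simp [P₁]
    refine ⟨(G₁, P₁), (show PIso ψ φ G₁ P₁ ∧ (∀ g ∈ G₁, g.1 ∈ A) ∧ ∀ p ∈ P₁, p.1 ∈ A from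
      ⟨⟨?_, ?_, ?_, ?_, ?_, ?_, ?_, ?_, ?_, ?_⟩, ?_, ?_⟩), ?_⟩
    · exact hP₁.2 ⟨X₀, hX₀, (hCS hX₀).1.zero_mem⟩
    · rintro p hp
      obtain ⟨X, hX, hpX⟩ := hP₁.1 hp
      exact (hCS hX).1.mem_fst p hpX
    · rintro p hp
      obtain ⟨X, hX, hpX⟩ := hP₁.1 hp
      exact (hCS hX).1.mem_snd p hpX
    · intro p hp q hq
      obtain ⟨X, hX, hpX⟩ := hP₁.1 hp
      obtain ⟨Y, hY, hqY⟩ := hP₁.1 hq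
      rcases hC.total hX hY with h | h
      · exact (hCS hY).1.lt_iff p (h.2 hpX) q hqY
      · exact (hCS hX).1.lt_iff p hpX q (h.2 hqY)
    · intro p hp
      obtain ⟨X, hX, hpX⟩ := hP₁.1 hp
      exact hP₁.2 ⟨X, hX, (hCS hX).1.succ_mem p hpX⟩
    · intro p hp
      obtain ⟨X, hX, hpX⟩ := hP₁.1 hp
      refine ((hCS hX).1.pred_mem p hpX).imp_right ?_
      rintro ⟨q, hq, h⟩
      exact ⟨q, hP₁.2 ⟨X, hX, hq⟩, h⟩
    · intro g hg
      obtain ⟨X, hX, hgX⟩ := hG₁.1 hg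
      exact (hCS hX).1.pos_iff g hgX
    · intro g hg h0
      obtain ⟨X, hX, hgX⟩ := hG₁.1 hg
      obtain ⟨u, hu, huG, h⟩ := (hCS hX).1.val_mem g hgX h0
      exact ⟨u, hP₁.2 ⟨X, hX, hu⟩, hG₁.2 ⟨X, hX, huG⟩, h⟩
    · intro g hg
      obtain ⟨X, hX, hgX⟩ := hG₁.1 hg
      obtain ⟨u, hu, huG, h⟩ := (hCS hX).1.succ_eq g hgX
      exact ⟨u, hP₁.2 ⟨X, hX, hu⟩, hG₁.2 ⟨X, hX, huG⟩, h⟩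
    · intro g hg
      obtain ⟨X, hX, hgX⟩ := hG₁.1 hg
      exact (hCS hX).1.lt_succ_iff g hgX
    · intro g hg
      obtain ⟨X, hX, hgX⟩ := hG₁.1 hg
      exact (hCS hX).2.1 g hgX
    · intro p hp
      obtain ⟨X, hX, hpX⟩ := hP₁.1 hp
      exact (hCS hX).2.2 p hpX
    · exact fun X hX => ⟨fun g hg => hG₁.2 ⟨X, hX, hg⟩, fun p hp => hP₁.2 ⟨X, hX, hp⟩⟩)
    (G, P) ⟨H, hG, hP⟩
  refine ⟨m.1, m.2, hm.1, hm.2, hmax.1.1, hmax.1.2.1, hmax.1.2.2, fun G'' P'' h1 h2 h3 h4 h5 => ?_⟩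
  exact hmax.2 (y := (G'', P'')) ⟨h1, h2, h3⟩ ⟨h4, h5⟩

/-- A partial isomorphism with domain contained in a countable closed subspace `A` extends to one
with domain `A` if the target is saturated. -/
theorem exists_extension (hψ : IsLogCouple ψ) (hφ : IsLogCouple φ)
    (hs : IsSaturated φ) (H : PIso ψ φ G P) (A : Submodule ℚ Γ)
    (hA : IsClosedSubspace ψ A) (hAc : (A : Set Γ).Countable) (hG : ∀ g ∈ G, g.1 ∈ A)
    (hP : ∀ p ∈ P, p.1 ∈ A) :
    ∃ G' P', G ≤ G' ∧ PIso ψ φ G' P' ∧ P' ⊆ G' ∧ (G' : Set (Γ × Δ)).Countable ∧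
      ∀ a ∈ A, ∃ g ∈ G', g.1 = a := by
  obtain ⟨G', P', hGG, -, H', hG', hP', hmax⟩ := H.exists_maximal A hG hP
  have hGc : (G' : Set (Γ × Δ)).Countable :=
    Set.MapsTo.countable_of_injOn (f := Prod.fst) (t := (A : Set Γ)) hG'
      (fun x hx y hy h => Prod.ext h ((H'.eq_iff' hx hy).1 h)) hAc
  have hPc : P'.Countable :=
    Set.MapsTo.countable_of_injOn (f := Prod.fst) (t := (A : Set Γ)) hP'
      (fun x hx y hy h => H'.eq_of_fst_eq hx hy h) hAc
  -- First use of maximality. The whole orbit of a missing `c` under successors and predecessors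
  -- stays in `A` because `A` is closed.
  have hdom : ∀ c ∈ A, c ∈ PsiZero ψ → ∃ u ∈ P', u.1 = c := by
    intro c hcA hc
    by_contra! hcP
    obtain ⟨d, hd⟩ := H'.exists_newCut hψ hφ hs hPc hc hcP
    have hsub : ∀ p ∈ P' ∪ chain ψ φ (c, d), p.1 ∈ A := by
      rintro p (hp | ⟨hp, -, m, n, h1, -⟩)
      · exact hP' p hp
      · refine hA.of_iterate_mem hψ hp m ?_
        rw [h1]
        exact hA.iterate_mem hcA n
    have := (hmax G' _ (H'.union_chain hψ hφ hd) hG' hsub le_rfl Set.subset_union_left).2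
      (Or.inr ⟨hd.1, hd.2.1, 0, 0, rfl, rfl⟩)
    exact hcP _ this rfl
  have hspan : ∀ c : Γ × Δ, c.1 ∈ A → ∀ g ∈ G' ⊔ Submodule.span ℚ {c}, g.1 ∈ A := by
    intro c hc g hg
    obtain ⟨x, hx, y, hy, rfl⟩ := Submodule.mem_sup.1 hg
    obtain ⟨q, rfl⟩ := Submodule.mem_span_singleton.1 hy
    exact A.add_mem (hG' x hx) (A.smul_mem q hc)
  have hmemspan : ∀ c : Γ × Δ, c ∈ G' ⊔ Submodule.span ℚ {c} := fun c =>
    Submodule.mem_sup_right (Submodule.mem_span_singleton_self c)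
  have hPG : P' ⊆ G' := by
    intro c hc
    by_contra hcG
    exact hcG ((hmax _ _ (H'.adjoin_of_mem hψ hφ hc hcG) (hspan c (hP' c hc)) hP' le_sup_left
      le_rfl).1 (hmemspan c))
  refine ⟨G', P', hGG, H', hPG, hGc, fun c hcA => ?_⟩
  by_contra! hcG
  -- The value lies in `A` since `A` is closed under `ψ`; so does its predecessor, which then
  -- belongs to the domain of `P'`.
  have hval : ∀ g ∈ G', ∃ u ∈ P', val ψ (c - g.1) = ((succ ψ u.1 : Γ) : WithTop Γ) := by
    intro g hg
    have h0 : c - g.1 ≠ 0 := sub_ne_zero.2 (hcG g hg).symm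
    obtain ⟨t, ht, htv⟩ := hψ.exists_val_eq h0
    have hA1 := hA.psi_mem _ (A.sub_mem hcA (hG' g hg)) h0
    rw [(val_eq_coe.1 htv).2] at hA1
    obtain ⟨u, hu, rfl⟩ := hdom t (hA.pred_mem t ht hA1) ht
    exact ⟨u, hu, htv⟩
  have hsucc : ∀ g ∈ G', ∀ q : ℚ, ∃ u ∈ P', succ ψ (g.1 + q • c) = succ ψ u.1 := by
    intro g hg q
    obtain ⟨t, ht, htv⟩ := hψ.exists_succ_eq (g.1 + q • c)
    have hA1 := hA.succ_mem _ (A.add_mem (hG' g hg) (A.smul_mem q hcA))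
    rw [htv] at hA1
    obtain ⟨u, hu, rfl⟩ := hdom t (hA.pred_mem t ht hA1) ht
    exact ⟨u, hu, htv⟩
  obtain ⟨d, hd⟩ := H'.exists_adjoin hψ hφ hs hPG hGc hval hsucc
  exact hcG _ ((hmax _ _ hd (hspan (c, d) hcA) hP' le_sup_left le_rfl).1 (hmemspan (c, d))) rfl

end PIso

end Extension


/-! ### Back-and-forth systems. -/

section BackAndForth

/-- A back-and-forth system of relations preserves all formulas. -/
theorem realize_iff_of_backAndForth {L : FirstOrder.Language} {M N : Type*} [L.Structure M]
    [L.Structure N] (S : Set (M → N → Prop))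
    (hfun : ∀ R ∈ S, ∀ (n : ℕ) (f : L.Functions n) (x : Fin n → M) (y : Fin n → N),
      (∀ i, R (x i) (y i)) → R (Structure.funMap f x) (Structure.funMap f y))
    (hrel : ∀ R ∈ S, ∀ (n : ℕ) (r : L.Relations n) (x : Fin n → M) (y : Fin n → N),
      (∀ i, R (x i) (y i)) → (Structure.RelMap r x ↔ Structure.RelMap r y))
    (heq : ∀ R ∈ S, ∀ x y x' y', R x y → R x' y' → (x = x' ↔ y = y'))
    (forth : ∀ R ∈ S, ∀ x, ∃ R' ∈ S, (∀ a b, R a b → R' a b) ∧ ∃ y, R' x y)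
    (back : ∀ R ∈ S, ∀ y, ∃ R' ∈ S, (∀ a b, R a b → R' a b) ∧ ∃ x, R' x y)
    {α : Type*} {n : ℕ} (φ : L.BoundedFormula α n) {R : M → N → Prop} (hR : R ∈ S)
    {v : α → M} {v' : α → N} {xs : Fin n → M} {ys : Fin n → N} (hv : ∀ a, R (v a) (v' a))
    (hxs : ∀ i, R (xs i) (ys i)) : φ.Realize v xs ↔ φ.Realize v' ys := by
  have hterm : ∀ R ∈ S, ∀ {β : Type _} (t : L.Term β) {w : β → M} {w' : β → N},
      (∀ b, R (w b) (w' b)) → R (t.realize w) (t.realize w') := by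
    intro R hR β t w w' hw
    induction t with
    | var b => exact hw b
    | func f ts ih => exact hfun R hR _ f _ _ ih
  have hel : ∀ {R : M → N → Prop} {n : ℕ} {v : α → M} {v' : α → N} {xs : Fin n → M}
      {ys : Fin n → N}, (∀ a, R (v a) (v' a)) → (∀ i, R (xs i) (ys i)) →
      ∀ b, R (Sum.elim v xs b) (Sum.elim v' ys b) := by
    rintro R n v v' xs ys h1 h2 (b | b)
    exacts [h1 b, h2 b]
  have hsnoc : ∀ {R : M → N → Prop} {n : ℕ} {xs : Fin n → M} {ys : Fin n → N} {x : M} {y : N},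
      (∀ i, R (xs i) (ys i)) → R x y →
      ∀ i, R ((Fin.snoc xs x : Fin (n + 1) → M) i) ((Fin.snoc ys y : Fin (n + 1) → N) i) := by
    intro R n xs ys x y h1 h2 i
    refine Fin.lastCases ?_ (fun i => ?_) i
    · simpa only [Fin.snoc_last] using h2
    · simpa only [Fin.snoc_castSucc] using h1 i
  induction φ generalizing R with
  | falsum => rfl
  | equal t₁ t₂ =>
    exact heq R hR _ _ _ _ (hterm R hR t₁ (hel hv hxs)) (hterm R hR t₂ (hel hv hxs))
  | rel r ts => exact hrel R hR _ r _ _ fun i => hterm R hR (ts i) (hel hv hxs)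
  | imp φ₁ φ₂ ih₁ ih₂ => exact imp_congr (ih₁ hR hv hxs) (ih₂ hR hv hxs)
  | all φ ih =>
    constructor
    · intro h y
      obtain ⟨R', hR', hle, x, hxy⟩ := back R hR y
      exact (ih hR' (fun a => hle _ _ (hv a)) (hsnoc (fun i => hle _ _ (hxs i)) hxy)).1 (h x)
    · intro h x
      obtain ⟨R', hR', hle, y, hxy⟩ := forth R hR x
      exact (ih hR' (fun a => hle _ _ (hv a)) (hsnoc (fun i => hle _ _ (hxs i)) hxy)).2 (h y)

end BackAndForth

/-! ### Countable saturation of ultrapowers. -/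

section Saturation

/-- The ultrapower of a structure over a nonprincipal ultrafilter on `ℕ`. -/
abbrev Ultrapower (M : Type*) : Type _ := (Filter.hyperfilter ℕ : Filter ℕ).Product fun _ => M

variable {L : FirstOrder.Language.{u, v}} {M : Type w} [L.Structure M] [Nonempty M]

theorem Ultrapower.realize_const {α : Type*} (φ : L.Formula α) (x : α → M) :
    (φ.Realize fun a => ((fun _ => x a : ℕ → M) : Ultrapower M)) ↔ φ.Realize x :=
  (Ultraproduct.realize_formula_cast φ fun a _ => x a).trans Filter.eventually_const

/-- Diagonal argument: at each index `i`, use the approximate solution for as many of the conditions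
as hold there. Two parameters per formula suffice for the conditions needed later. -/
theorem Ultrapower.exists_realize (χ : ℕ → L.BoundedFormula Empty 3)
    (b e : ℕ → Ultrapower M)
    (hF : ∀ n, ∃ y, ∀ k < n, (χ k).Realize default ![b k, e k, y]) :
    ∃ y, ∀ k, (χ k).Realize default ![b k, e k, y] := by
  classical
  have hrep : ∀ x : Ultrapower M, ∃ f : ℕ → M, (f : Ultrapower M) = x :=
    fun x => Quotient.exists_rep x
  choose b' hb using fun k => hrep (b k)
  choose e' he using fun k => hrep (e k)
  obtain rfl : b = fun k => (b' k : Ultrapower M) := funext fun k => (hb k).symm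
  obtain rfl : e = fun k => (e' k : Ultrapower M) := funext fun k => (he k).symm
  have key : ∀ (k : ℕ) (y : ℕ → M),
      (χ k).Realize default ![(b' k : Ultrapower M), (e' k : Ultrapower M), (y : Ultrapower M)] ↔
      ∀ᶠ i in (Filter.hyperfilter ℕ : Filter ℕ), (χ k).Realize default ![b' k i, e' k i, y i] := by
    intro k y
    have := Ultraproduct.boundedFormula_realize_cast (u := Filter.hyperfilter ℕ) (M := fun _ => M)
      (χ k) (fun a : Empty => a.elim) ![b' k, e' k, y]
    have e1 : ![(b' k : Ultrapower M), (e' k : Ultrapower M), (y : Ultrapower M)] =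
        fun i => ((![b' k, e' k, y] i : ℕ → M) : Ultrapower M) := by
      funext i
      fin_cases i <;> rfl
    have e2 : ∀ j, ![b' k j, e' k j, y j] = fun i => (![b' k, e' k, y] : Fin 3 → ℕ → M) i j := by
      intro j
      funext i
      fin_cases i <;> rfl
    simp only [e1, e2]
    convert this using 1
    · rw [Subsingleton.elim default fun a : Empty => ((a.elim : ℕ → M) : Ultrapower M)]
    · refine Filter.eventually_congr (Filter.Eventually.of_forall fun j => ?_)
      rw [Subsingleton.elim default fun a : Empty => (a.elim : ℕ → M) j]
  choose y hy using hF
  choose y' hy' using fun n => hrep (y n)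
  let good : ℕ → ℕ → Prop := fun i n => ∀ k < n, (χ k).Realize default ![b' k i, e' k i, y' n i]
  have hgood : ∀ n, ∀ᶠ i in (Filter.hyperfilter ℕ : Filter ℕ), good i n := by
    intro n
    refine (Filter.eventually_all_finite (Set.finite_lt_nat n)).2 fun k hk => ?_
    rw [← key, hy']
    exact hy n k hk
  -- The bound `i` makes a greatest value exist; it is harmless because the ultrafilter is
  -- nonprincipal, so that `k + 1 ≤ i` for almost all `i`.
  let N : ℕ → ℕ := fun i => Nat.findGreatest (good i) i
  have hN : ∀ i, good i (N i) := fun i =>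
    Nat.findGreatest_spec (P := good i) (Nat.zero_le i) fun k hk => absurd hk (Nat.not_lt_zero k)
  refine ⟨((fun i => y' (N i) i : ℕ → M) : Ultrapower M), fun k => (key k _).2 ?_⟩
  have hlarge : ∀ᶠ i in (Filter.hyperfilter ℕ : Filter ℕ), k + 1 ≤ i :=
    Nat.hyperfilter_le_atTop (Filter.eventually_ge_atTop (k + 1))
  filter_upwards [hlarge, hgood (k + 1)] with i hi hi'
  exact hN i k (Nat.le_findGreatest hi hi')

end Saturation

/-! ### A compactness criterion for quantifier elimination. -/

section QuantifierElimination

variable {L : FirstOrder.Language.{u, v}}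

/-- Quantifier elimination holds if formulas are preserved between tuples satisfying the same
quantifier-free formulas. -/
theorem hasQE_of_realize_iff (T : L.Theory)
    (hT : ∀ (M N : Theory.ModelType.{u, v, max u v} T) (n : ℕ) (x : Fin n → M) (y : Fin n → N),
      (∀ θ : L.Formula (Fin n), BoundedFormula.IsQF θ → (θ.Realize x ↔ θ.Realize y)) →
      ∀ φ : L.Formula (Fin n), φ.Realize x → φ.Realize y) : HasQE T := by
  intro n φ
  let D : L.Formula (Fin n) → Set (T.CompleteType (Fin n)) :=
    fun θ => T.typesWith (Formula.equivSentence θ)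
  have hclopen : ∀ θ, IsClopen (D θ) := fun θ => _root_.CompleteType.isClopen_typesWith _
  have hrep : ∀ p : T.CompleteType (Fin n), ∃ (M : Theory.ModelType.{u, v, max u v} T)
      (x : Fin n → M), ∀ θ : L.Formula (Fin n), p ∈ D θ ↔ θ.Realize x := by
    intro p
    obtain ⟨M, x, hx⟩ := T.exists_modelType_is_realized_in p
    refine ⟨M, x, fun θ => ?_⟩
    rw [← hx]
    exact Theory.CompleteType.formula_mem_typeOf
  have step1 : ∀ p ∈ D φ, ∃ θ : L.Formula (Fin n), BoundedFormula.IsQF θ ∧ p ∈ D θ ∧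
      D θ ⊆ D φ := by
    intro p hp
    let ι := {θ : L.Formula (Fin n) // BoundedFormula.IsQF θ ∧ p ∈ D θ}
    -- A type outside `D φ` containing all quantifier-free formulas of `p` would, by passing to
    -- negations, have the same quantifier-free part as `p`, contrary to the hypothesis. So finitely
    -- many quantifier-free members of `p` already imply `φ`.
    obtain ⟨t, ht⟩ := ((hclopen φ).compl.isClosed.isCompact).elim_finite_subcover
      (fun θ : ι => (D θ.1)ᶜ) (fun θ => (hclopen θ.1).compl.isOpen) (by
        intro q hq
        by_contra hq'
        simp only [Set.mem_iUnion, Set.mem_compl_iff, not_exists, not_not] at hq'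
        obtain ⟨M, x, hx⟩ := hrep p
        obtain ⟨N, y, hy⟩ := hrep q
        refine hq ((hy φ).2 (hT M N n x y (fun θ hθ => ?_) φ ((hx φ).1 hp)))
        rw [← hx, ← hy]
        refine ⟨fun h => hq' ⟨θ, hθ, h⟩, fun h => ?_⟩
        by_contra h'
        have := hq' ⟨∼θ, hθ.not, (hx _).2 fun h'' => h' ((hx θ).2 h'')⟩
        exact (hy _).1 this ((hy θ).1 h))
    have hQF : ∀ l : List ι, BoundedFormula.IsQF
        ((l.map Subtype.val).foldr (fun a b => a ⊓ b) ⊤ : L.Formula (Fin n)) := by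
      intro l
      induction l with
      | nil => exact BoundedFormula.IsQF.top
      | cons a l ih => exact a.2.1.inf ih
    refine ⟨_, hQF t.toList, ?_, ?_⟩
    · obtain ⟨M, x, hx⟩ := hrep p
      rw [hx]
      refine (BoundedFormula.realize_foldr_inf _ _ _).2 fun θ hθ => ?_
      obtain ⟨θ', -, rfl⟩ := List.mem_map.1 hθ
      exact (hx _).1 θ'.2.2
    · intro q hq
      by_contra hqφ
      obtain ⟨θ, hθt, hθ⟩ := Set.mem_iUnion₂.1 (ht hqφ)
      obtain ⟨N, y, hy⟩ := hrep q
      rw [hy] at hq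
      exact hθ ((hy _).2 ((BoundedFormula.realize_foldr_inf _ _ _).1 hq _
        (List.mem_map_of_mem (Finset.mem_toList.2 hθt))))
  let ι := {θ : L.Formula (Fin n) // BoundedFormula.IsQF θ ∧ D θ ⊆ D φ}
  -- Second use of compactness: finitely many of the resulting quantifier-free sets cover `D φ`, and
  -- their disjunction is equivalent to `φ`.
  obtain ⟨t, ht⟩ := ((hclopen φ).isClosed.isCompact).elim_finite_subcover
    (fun θ : ι => D θ.1) (fun θ => (hclopen θ.1).isOpen) (fun p hp => by
      obtain ⟨θ, h1, h2, h3⟩ := step1 p hp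
      exact Set.mem_iUnion.2 ⟨⟨θ, h1, h3⟩, h2⟩)
  have hQF : ∀ l : List ι, BoundedFormula.IsQF
      ((l.map Subtype.val).foldr (fun a b => a ⊔ b) ⊥ : L.Formula (Fin n)) := by
    intro l
    induction l with
    | nil => exact BoundedFormula.isQF_bot
    | cons a l ih => exact a.2.1.sup ih
  refine ⟨_, hQF t.toList, ?_⟩
  intro M v xs
  obtain rfl : xs = default := Subsingleton.elim _ _
  rw [BoundedFormula.realize_iff, BoundedFormula.realize_foldr_sup]
  have hp : ∀ θ : L.Formula (Fin n), T.typeOf v ∈ D θ ↔ BoundedFormula.Realize θ v default :=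
    fun θ => Theory.CompleteType.formula_mem_typeOf
  rw [← hp]
  constructor
  · intro h
    obtain ⟨θ, hθt, hθ⟩ := Set.mem_iUnion₂.1 (ht h)
    exact ⟨_, List.mem_map_of_mem (Finset.mem_toList.2 hθt), (hp _).1 hθ⟩
  · rintro ⟨θ, hθ, h⟩
    obtain ⟨θ', -, rfl⟩ := List.mem_map.1 hθ
    exact θ'.2.2 ((hp _).2 h)

end QuantifierElimination


/-! ### Divisible ordered abelian groups as rational vector spaces. -/

section RatModule

/-- Division with respect to the rational scalar multiplication below. -/
theorem exists_unique_rat_smul {Γ : Type*} [AddCommGroup Γ] [LinearOrder Γ] [IsOrderedAddMonoid Γ]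
    (hd : ∀ (n : ℕ+) (α : Γ), ∃ β : Γ, (n : ℕ) • β = α) :
    ∃ f : ℚ → Γ → Γ, ∀ (q : ℚ) (x y : Γ) (n d : ℤ), d ≠ 0 → q = n / d →
      (f q x = y ↔ d • y = n • x) := by
  choose g hg using hd
  have hinj : ∀ {d : ℤ}, d ≠ 0 → Function.Injective fun x : Γ => d • x :=
    fun hd => smul_right_injective Γ hd
  -- The reduced fraction defines the operation; torsion-freeness lets any other fraction describe
  -- it, so the module axioms can be checked by clearing denominators.
  refine ⟨fun q x => g ⟨q.den, q.den_pos⟩ (q.num • x), fun q x y n d hd hq => ?_⟩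
  have h1 : (q.den : ℤ) • g ⟨q.den, q.den_pos⟩ (q.num • x) = q.num • x := by
    rw [natCast_zsmul]; exact hg ⟨q.den, q.den_pos⟩ _
  have hden : (q.den : ℤ) ≠ 0 := by simp
  have h2 : q.num * d = n * q.den := by
    have : (q.num : ℚ) / q.den = n / d := by rw [Rat.num_div_den, hq]
    rw [div_eq_div_iff (by simp) (by exact_mod_cast hd)] at this
    exact_mod_cast this
  have h3 : d • g ⟨q.den, q.den_pos⟩ (q.num • x) = n • x := by
    apply hinj hden
    simp only
    rw [smul_comm, h1, smul_smul, smul_smul, mul_comm d, h2, mul_comm]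
  constructor
  · rintro rfl
    exact h3
  · intro h
    exact hinj hd (h3.trans h.symm)

/-- A divisible ordered abelian group is a rational vector space. -/
theorem nonempty_ratModule {Γ : Type*} [AddCommGroup Γ] [LinearOrder Γ] [IsOrderedAddMonoid Γ]
    (hd : ∀ (n : ℕ+) (α : Γ), ∃ β : Γ, (n : ℕ) • β = α) : Nonempty (Module ℚ Γ) := by
  obtain ⟨f, hf⟩ := exists_unique_rat_smul hd
  have hself : ∀ (q : ℚ) (x : Γ), (q.den : ℤ) • f q x = q.num • x := fun q x =>
    (hf q x _ q.num q.den (by simp) (by simp [Rat.num_div_den])).1 rfl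
  refine ⟨
    { smul := f
      one_smul := fun x => (hf 1 x x 1 1 one_ne_zero (by simp)).2 rfl
      mul_smul := fun q r x => (hf (q * r) x _ (q.num * r.num) (q.den * r.den) (by simp) (by
        push_cast
        rw [← div_mul_div_comm, Rat.num_div_den, Rat.num_div_den])).2 (by
          change _ • f q (f r x) = _
          rw [mul_comm (q.den : ℤ), mul_smul, hself, smul_comm, hself, smul_smul])
      smul_zero := fun q => (hf q 0 0 q.num q.den (by simp) (by simp [Rat.num_div_den])).2 (by simp)
      smul_add := fun q x y => (hf q _ _ q.num q.den (by simp) (by simp [Rat.num_div_den])).2 (by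
        change _ • (f q x + f q y) = _
        rw [smul_add, hself, hself, smul_add])
      add_smul := fun q r x => (hf (q + r) x _ (q.num * r.den + r.num * q.den) (q.den * r.den)
        (by simp) (by
          push_cast
          nth_rw 1 [← Rat.num_div_den q, ← Rat.num_div_den r]
          have h1 : (q.den : ℚ) ≠ 0 := by simp
          have h2 : (r.den : ℚ) ≠ 0 := by simp
          field_simp)).2 (by
          change _ • (f q x + f r x) = _
          rw [smul_add, mul_smul, smul_comm (q.den : ℤ), hself, mul_smul, hself, add_smul,
            smul_smul, smul_smul, mul_comm (r.den : ℤ), mul_comm (q.den : ℤ)])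
      zero_smul := fun x => (hf 0 x 0 0 1 one_ne_zero (by simp)).2 (by simp) }⟩

/-- An additive subgroup closed under division by positive integers, as a rational subspace. -/
def ratSubmodule {V : Type*} [AddCommGroup V] [Module ℚ V] (A : AddSubgroup V)
    (h : ∀ (n : ℕ+), ∀ x ∈ A, ((n : ℕ) : ℚ)⁻¹ • x ∈ A) : Submodule ℚ V :=
  { A with
    smul_mem' := fun q x hx => by
      have := h ⟨q.den, q.den_pos⟩ _ (A.zsmul_mem hx q.num)
      rw [← Int.cast_smul_eq_zsmul ℚ, smul_smul] at this
      rwa [PNat.mk_coe, inv_mul_eq_div, Rat.num_div_den] at this }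

end RatModule

/-! ### From structures back to couples: definability, saturation, closed subspaces. -/

section Ginf

set_option linter.unusedSectionVars false

variable {Γ : Type*} [AddCommGroup Γ] [LinearOrder Γ] [IsOrderedAddMonoid Γ] {ψ : Γ → Γ}

/-- The new operations on `Γ_∞`. -/
noncomputable def newMap (f : NewFunc 1) (x : Ginf ψ) : Ginf ψ :=
  Structure.funMap (L := Lnew) f ![x]

@[simp] theorem newMap_infty (f : NewFunc 1) : newMap f (mi (Ginf ψ)) = mi _ := by
  match f with
  | .succ => rfl
  | .pred => rfl
  | .delta k => rfl

@[simp] theorem newMap_succ (a : Γ) : newMap .succ (co ψ a) = co ψ (succ ψ a) := rfl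

theorem newMap_delta [Module ℚ Γ] (h : IsLogCouple ψ) (n : ℕ+) (a : Γ) :
    newMap (.delta n) (co ψ a) = co ψ (((n : ℕ) : ℚ)⁻¹ • a) := by
  have h1 : (n : ℕ) • (Classical.epsilon fun b : Γ => (n : ℕ) • b = a) = a :=
    Classical.epsilon_spec (h.divisible n a)
  have h2 : (n : ℕ) • (((n : ℕ) : ℚ)⁻¹ • a) = a := by
    rw [← Nat.cast_smul_eq_nsmul ℚ, smul_smul, mul_inv_cancel₀ (by simp), one_smul]
  exact congrArg (co ψ) (nsmul_right_injective n.pos.ne' (h1.trans h2.symm))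

theorem newMap_pred (h : IsLogCouple ψ) {a : Γ} (ha : a ∈ PsiSet ψ) :
    newMap .pred (co ψ (succ ψ a)) = co ψ a := by
  have h1 := h.succ_bijOn.mapsTo ha
  have h2 : newMap .pred (co ψ (succ ψ a)) =
      co ψ (Function.invFunOn (succ ψ) (PsiSet ψ) (succ ψ a)) := if_pos h1
  rw [h2, h.succ_bijOn.injOn.leftInvOn_invFunOn ha]

theorem newMap_pred_of_not {a : Γ} (ha : ¬ (a ∈ PsiSet ψ ∧ succ ψ 0 < a)) :
    newMap .pred (co ψ a) = mi _ := if_neg ha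

theorem ginf_cases (x : Ginf ψ) : x = mi _ ∨ ∃ a, x = co ψ a := by
  revert x
  rw [ginf_forall]
  exact ⟨Or.inl rfl, fun a => Or.inr ⟨a, rfl⟩⟩

/-- Puts the basic sets into the form required for saturation of ultrapowers. The formulas also
force `y ≠ ∞`, so that solutions lie in `Γ`; for the sets with one parameter, `e` is a dummy. -/
theorem IsBasicSet.exists_formula {S : Set Γ} (hS : IsBasicSet ψ S) :
    ∃ (χ : Fml 3) (b e : Γ), ∀ y : Ginf ψ, χ.Realize default ![co ψ b, co ψ e, y] ↔
      ∃ a ∈ S, y = co ψ a := by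
  have hval : ∀ a b e : Γ, mp (co ψ (a + -b)) = co ψ e ↔ val ψ (a - b) = (e : WithTop Γ) := by
    intro a b e
    rw [sub_eq_add_neg]
    by_cases h0 : a + -b = 0
    · rw [h0, g_mp0, val_zero]
      simp
    · rw [g_mp h0, val_of_ne h0]
      simp
  cases hS with
  | gt_val b e =>
    refine ⟨finF &2 ⊓ ltF &0 &2 ⊓ psiT (addT &2 (negT &0)) =' &1, b, e, ?_⟩
    rw [ginf_forall]
    simp [and_assoc, hval]
  | lt_val b e =>
    refine ⟨finF &2 ⊓ ltF &2 &0 ⊓ psiT (addT &2 (negT &0)) =' &1, b, e, ?_⟩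
    rw [ginf_forall]
    simp [and_assoc, hval]
  | gt_mem b =>
    refine ⟨inPsiF 2 ⊓ ltF &0 &2, b, 0, ?_⟩
    rw [ginf_forall]
    simp
  | lt_mem b =>
    refine ⟨inPsiF 2 ⊓ ltF &2 &0, b, 0, ?_⟩
    rw [ginf_forall]
    simp

theorem isSaturated_of_equiv {M : Type*} [Llog.Structure M] [Nonempty M]
    (e : Ultrapower M ≃[Llog] Ginf ψ) : IsSaturated ψ := by
  intro S hS hF
  choose χ b d hχ using fun n => (hS n).exists_formula
  let χ' : ℕ → Llog.BoundedFormula Empty 3 := fun n =>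
    (LHom.sumInl (L := L0) (L' := Lnew)).onBoundedFormula (χ n)
  have key : ∀ n (Y : Ultrapower M), (χ' n).Realize default
      ![e.symm (co ψ (b n)), e.symm (co ψ (d n)), Y] ↔ ∃ a ∈ S n, e Y = co ψ a := by
    intro n Y
    rw [← hχ, ← LHom.realize_onBoundedFormula (LHom.sumInl (L := L0) (L' := Lnew)) (χ n),
      ← StrongHomClass.realize_boundedFormula e]
    have e1 : (e ∘ ![e.symm (co ψ (b n)), e.symm (co ψ (d n)), Y] : Fin 3 → Ginf ψ) =
        ![co ψ (b n), co ψ (d n), e Y] := by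
      funext i
      fin_cases i
      · exact e.apply_symm_apply _
      · exact e.apply_symm_apply _
      · rfl
    rw [e1, Subsingleton.elim (e ∘ default) default]
  obtain ⟨Y, hY⟩ := Ultrapower.exists_realize χ' (fun n => e.symm (co ψ (b n)))
    (fun n => e.symm (co ψ (d n))) fun n => by
      obtain ⟨y, hy⟩ := hF (Finset.range n)
      exact ⟨e.symm (co ψ y), fun k hk =>
        (key k _).2 ⟨y, hy k (Finset.mem_range.2 hk), e.apply_symm_apply _⟩⟩
  have hY' := fun n => (key n Y).1 (hY n)
  obtain ⟨a, -, ha⟩ := hY' 0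
  refine ⟨a, fun n => ?_⟩
  obtain ⟨a', ha', h⟩ := hY' n
  rw [ha, co_inj] at h
  rwa [h]

/-- Every model of `Tlog` embeds elementarily into a saturated one. -/
theorem exists_saturated {M : Type u} [Llog.Structure M] [Nonempty M] (hM : M ⊨ Tlog) :
    ∃ (Γ : Type u) (_ : AddCommGroup Γ) (_ : LinearOrder Γ) (_ : IsOrderedAddMonoid Γ)
      (ψ : Γ → Γ) (j : M → Ginf ψ), IsLogCouple ψ ∧ IsSaturated ψ ∧
      ∀ {α : Type} (χ : Llog.Formula α) (x : α → M), χ.Realize (j ∘ x) ↔ χ.Realize x := by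
  have hU : Ultrapower M ⊨ Tlog := by
    rw [Theory.model_iff]
    intro χ hχ
    rw [Ultraproduct.sentence_realize]
    exact Filter.Eventually.of_forall fun _ => Theory.realize_sentence_of_mem Tlog hχ
  obtain ⟨Γ, i1, i2, i3, ψ, h, ⟨e⟩⟩ := (model_Tlog_iff (Ultrapower M)).1 hU
  refine ⟨Γ, i1, i2, i3, ψ, fun m => e ((fun _ => m : ℕ → M) : Ultrapower M), h,
    isSaturated_of_equiv e, fun χ x => ?_⟩
  rw [← Ultrapower.realize_const χ x]
  exact StrongHomClass.realize_formula e χ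

/-- Keeps substructures generated by countable sets, and sets of terms, countable. -/
theorem countable_llog_functions : Countable (Σ l, Llog.Functions l) := by
  have h0 : Countable (Σ l, L0.Functions l) := by
    refine Function.Injective.countable (β := ℕ) (f := fun f => match f with
      | ⟨_, L0Func.zero⟩ => 0
      | ⟨_, L0Func.infty⟩ => 1
      | ⟨_, L0Func.add⟩ => 2
      | ⟨_, L0Func.neg⟩ => 3
      | ⟨_, L0Func.psi⟩ => 4) ?_
    rintro ⟨_, f⟩ ⟨_, g⟩ hfg
    cases f <;> cases g <;> first | rfl | simp at hfg
  have h1 : Countable (Σ l, Lnew.Functions l) := by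
    refine Function.Injective.countable (β := ℕ) (f := fun f => match f with
      | ⟨_, NewFunc.succ⟩ => 0
      | ⟨_, NewFunc.pred⟩ => 1
      | ⟨_, NewFunc.delta n⟩ => (n : ℕ) + 2) ?_
    rintro ⟨_, f⟩ ⟨_, g⟩ hfg
    cases f <;> cases g <;> first | rfl | simp at hfg
    subst hfg
    rfl
  refine Function.Injective.countable
    (β := (Σ l, L0.Functions l) ⊕ (Σ l, Lnew.Functions l)) (f := fun f => match f with
      | ⟨l, Sum.inl f⟩ => Sum.inl ⟨l, f⟩
      | ⟨l, Sum.inr f⟩ => Sum.inr ⟨l, f⟩) ?_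
  rintro ⟨_, f | f⟩ ⟨_, g | g⟩ hfg <;> simp at hfg <;> obtain ⟨rfl, hfg⟩ := hfg <;>
    simp at hfg <;> subst hfg <;> rfl

/-- Every countable subset is contained in a countable closed subspace. -/
theorem exists_isClosedSubspace [Module ℚ Γ] (h : IsLogCouple ψ) {X : Set Γ} (hX : X.Countable) :
    ∃ A : Submodule ℚ Γ, IsClosedSubspace ψ A ∧ (A : Set Γ).Countable ∧ X ⊆ A := by
  have := countable_llog_functions
  let C := Substructure.closure Llog (co ψ '' X)
  have hC : (C : Set (Ginf ψ)).Countable :=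
    Set.countable_coe_iff.1 ((hX.image (co ψ)).substructure_closure Llog)
  have hzero : co ψ 0 ∈ C := C.fun_mem (Sum.inl L0Func.zero) ![] (fun i => i.elim0)
  have hadd : ∀ a b : Γ, co ψ a ∈ C → co ψ b ∈ C → co ψ (a + b) ∈ C := fun a b ha hb =>
    C.fun_mem (Sum.inl L0Func.add) ![co ψ a, co ψ b] (fun i => by fin_cases i; exacts [ha, hb])
  have hneg : ∀ a : Γ, co ψ a ∈ C → co ψ (-a) ∈ C := fun a ha =>
    C.fun_mem (Sum.inl L0Func.neg) ![co ψ a] (fun i => by fin_cases i; exact ha)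
  have hpsi : ∀ a : Γ, co ψ a ∈ C → mp (co ψ a) ∈ C := fun a ha =>
    C.fun_mem (Sum.inl L0Func.psi) ![co ψ a] (fun i => by fin_cases i; exact ha)
  have hnew : ∀ (f : NewFunc 1) (a : Γ), co ψ a ∈ C → newMap f (co ψ a) ∈ C := fun f a ha =>
    C.fun_mem (Sum.inr f) ![co ψ a] (fun i => by fin_cases i; exact ha)
  let A₀ : AddSubgroup Γ :=
    { carrier := {a | co ψ a ∈ C}
      zero_mem' := hzero
      add_mem' := fun ha hb => hadd _ _ ha hb
      neg_mem' := fun ha => hneg _ ha }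
  let A : Submodule ℚ Γ := ratSubmodule A₀ fun n x hx => by
    have := hnew (.delta n) x hx
    rwa [newMap_delta h] at this
  refine ⟨A, ⟨fun x hx h0 => ?_, fun x hx => hnew .succ x hx, fun x hx hx' => ?_⟩, ?_, ?_⟩
  · have := hpsi x hx
    rwa [g_mp h0] at this
  -- The predecessor `0` of `s 0` is not a value of `p`, but it lies in every substructure.
  · rcases hx with rfl | hx
    · exact hzero
    · have := hnew .pred _ hx'
      rwa [newMap_pred h hx] at this
  · exact Set.MapsTo.countable_of_injOn (f := co ψ) (fun a ha => ha)
      (fun a _ b _ hab => co_inj.1 hab) hC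
  · exact fun a ha => Substructure.subset_closure ⟨a, ha, rfl⟩

end Ginf


/-! ### Partial isomorphisms as relations between structures, and preservation of formulas. -/

section Graph

set_option linter.unusedSectionVars false

variable {Γ Δ : Type*} [AddCommGroup Γ] [LinearOrder Γ] [IsOrderedAddMonoid Γ] [Module ℚ Γ]
  [AddCommGroup Δ] [LinearOrder Δ] [IsOrderedAddMonoid Δ] [Module ℚ Δ]
  {ψ : Γ → Γ} {φ : Δ → Δ}

/-- The relation between `Γ_∞` and `Δ_∞` given by a subspace of `Γ × Δ`. -/
def graphRel (ψ : Γ → Γ) (φ : Δ → Δ) (G : Submodule ℚ (Γ × Δ)) (x : Ginf ψ) (y : Ginf φ) : Prop :=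
  (x = mi _ ∧ y = mi _) ∨ ∃ g ∈ G, x = co ψ g.1 ∧ y = co φ g.2

theorem graphRel_infty (G : Submodule ℚ (Γ × Δ)) : graphRel ψ φ G (mi _) (mi _) :=
  Or.inl ⟨rfl, rfl⟩

theorem graphRel_co {G : Submodule ℚ (Γ × Δ)} {g : Γ × Δ} (hg : g ∈ G) :
    graphRel ψ φ G (co ψ g.1) (co φ g.2) :=
  Or.inr ⟨g, hg, rfl, rfl⟩

theorem graphRel_mono {G G' : Submodule ℚ (Γ × Δ)} (h : G ≤ G') {x : Ginf ψ} {y : Ginf φ}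
    (hxy : graphRel ψ φ G x y) : graphRel ψ φ G' x y := by
  rcases hxy with hxy | ⟨g, hg, hxy⟩
  · exact Or.inl hxy
  · exact Or.inr ⟨g, h hg, hxy⟩

namespace PIso

variable {G : Submodule ℚ (Γ × Δ)} {P : Set (Γ × Δ)}

/-- Recovers membership in `P`: the successor of `g` is that of some `w` in both `P` and `G`, and
injectivity of `s` on `Ψ` gives `g = w`. -/
theorem exists_pred_of_mem (hψ : IsLogCouple ψ) (H : PIso ψ φ G P)
    {g : Γ × Δ} (hg : g ∈ G) (h1 : g.1 ∈ PsiSet ψ) (h2 : succ ψ 0 < g.1) :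
    ∃ q ∈ P, q.1 ∈ PsiSet ψ ∧ q.2 ∈ PsiSet φ ∧ g = (succ ψ q.1, succ φ q.2) := by
  obtain ⟨w, hw, hwG, h3, h4⟩ := H.succ_eq g hg
  rw [hψ.succ_inj (Or.inr h1) (H.mem_fst w hw)] at h3
  have h5 : g = w := Prod.ext h3 ((H.eq_iff' hg hwG).1 h3)
  subst h5
  rcases H.pred_mem g hw with rfl | ⟨q, hq, rfl⟩
  · exact absurd h2 hψ.succ_zero_pos.not_gt
  · have h6 : 0 < q.1 := (hψ.succ_lt_iff (Or.inl rfl) (H.mem_fst q hq)).1 h2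
    have h7 : 0 < q.2 := (H.lt_iff 0 H.zero_mem q hq).1 h6
    exact ⟨q, hq, mem_psiSet_of_pos (H.mem_fst q hq) h6, mem_psiSet_of_pos (H.mem_snd q hq) h7, rfl⟩

theorem mem_and_lt (hψ : IsLogCouple ψ) (hφ : IsLogCouple φ) (H : PIso ψ φ G P)
    {g : Γ × Δ} (hg : g ∈ G) (h : g.1 ∈ PsiSet ψ ∧ succ ψ 0 < g.1) :
    g.2 ∈ PsiSet φ ∧ succ φ 0 < g.2 := by
  obtain ⟨q, hq, -, h2, rfl⟩ := H.exists_pred_of_mem hψ hg h.1 h.2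
  exact hφ.succ_bijOn.mapsTo h2

theorem graphRel_newMap (hψ : IsLogCouple ψ) (hφ : IsLogCouple φ) (H : PIso ψ φ G P)
    (hPG : P ⊆ G) (f : NewFunc 1) {x : Ginf ψ} {y : Ginf φ} (hxy : graphRel ψ φ G x y) :
    graphRel ψ φ G (newMap f x) (newMap f y) := by
  rcases hxy with ⟨rfl, rfl⟩ | ⟨g, hg, rfl, rfl⟩
  · rw [newMap_infty, newMap_infty]
    exact graphRel_infty G
  match f with
  | .succ =>
    obtain ⟨u, hu, -, h1, h2⟩ := H.succ_eq g hg
    rw [newMap_succ, newMap_succ, h1, h2]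
    exact graphRel_co (hPG (H.succ_mem u hu))
  | .delta n =>
    rw [newMap_delta hψ, newMap_delta hφ]
    exact graphRel_co (G.smul_mem _ hg)
  | .pred =>
    by_cases h : g.1 ∈ PsiSet ψ ∧ succ ψ 0 < g.1
    · obtain ⟨q, hq, h1, h2, rfl⟩ := H.exists_pred_of_mem hψ hg h.1 h.2
      rw [newMap_pred hψ h1, newMap_pred hφ h2]
      exact graphRel_co (hPG hq)
    -- By symmetry, `p` takes its default value `∞` on both sides simultaneously.
    · have h' : ¬ (g.2 ∈ PsiSet φ ∧ succ φ 0 < g.2) := fun h' =>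
        h (H.symm.mem_and_lt hφ hψ (g := g.swap) hg h')
      rw [newMap_pred_of_not h, newMap_pred_of_not h']
      exact graphRel_infty G

theorem graphRel_funMap (hψ : IsLogCouple ψ) (hφ : IsLogCouple φ) (H : PIso ψ φ G P)
    (hPG : P ⊆ G) (n : ℕ) (f : Llog.Functions n) (x : Fin n → Ginf ψ) (y : Fin n → Ginf φ)
    (hxy : ∀ i, graphRel ψ φ G (x i) (y i)) :
    graphRel ψ φ G (Structure.funMap f x) (Structure.funMap f y) := by
  have hnew : ∀ f (x : Fin 1 → Ginf ψ) (y : Fin 1 → Ginf φ), (∀ i, graphRel ψ φ G (x i) (y i)) →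
      graphRel ψ φ G (Structure.funMap (L := Lnew) (f : NewFunc 1) x)
        (Structure.funMap (L := Lnew) f y) := by
    intro f x y hxy
    rw [show x = ![x 0] by ext i; fin_cases i; rfl, show y = ![y 0] by ext i; fin_cases i; rfl]
    exact H.graphRel_newMap hψ hφ hPG f (hxy 0)
  match n, f with
  | _, .inr .succ => exact hnew NewFunc.succ x y hxy
  | _, .inr .pred => exact hnew NewFunc.pred x y hxy
  | _, .inr (.delta k) => exact hnew (NewFunc.delta k) x y hxy
  | _, .inl .zero => exact graphRel_co G.zero_mem
  | _, .inl .infty => exact graphRel_infty G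
  | _, .inl .add =>
    change graphRel ψ φ G (ma (x 0) (x 1)) (ma (y 0) (y 1))
    rcases hxy 0 with ⟨h1, h2⟩ | ⟨g, hg, h1, h2⟩
    · rw [h1, h2, g_ma2, g_ma2]
      exact graphRel_infty G
    rcases hxy 1 with ⟨h3, h4⟩ | ⟨g', hg', h3, h4⟩
    · rw [h3, h4, g_ma1, g_ma1]
      exact graphRel_infty G
    rw [h1, h2, h3, h4, g_ma, g_ma]
    exact graphRel_co (G.add_mem hg hg')
  | _, .inl .neg =>
    change graphRel ψ φ G (mn (x 0)) (mn (y 0))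
    rcases hxy 0 with ⟨h1, h2⟩ | ⟨g, hg, h1, h2⟩
    · rw [h1, h2, g_mn1, g_mn1]
      exact graphRel_infty G
    rw [h1, h2, g_mn, g_mn]
    exact graphRel_co (G.neg_mem hg)
  | _, .inl .psi =>
    change graphRel ψ φ G (mp (x 0)) (mp (y 0))
    rcases hxy 0 with ⟨h1, h2⟩ | ⟨g, hg, h1, h2⟩
    · rw [h1, h2, g_mp1, g_mp1]
      exact graphRel_infty G
    rw [h1, h2]
    by_cases h0 : g.1 = 0
    · rw [h0, (H.eq_zero_iff hg).1 h0, g_mp0, g_mp0]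
      exact graphRel_infty G
    · obtain ⟨u, hu, -, h3, h4⟩ := H.val_mem g hg h0
      rw [g_mp h0, g_mp (ne_zero_of_val_eq h4), (val_eq_coe.1 h3).2, (val_eq_coe.1 h4).2]
      exact graphRel_co (hPG (H.succ_mem u hu))

theorem graphRel_relMap (H : PIso ψ φ G P) (n : ℕ) (r : Llog.Relations n) (x : Fin n → Ginf ψ)
    (y : Fin n → Ginf φ) (hxy : ∀ i, graphRel ψ φ G (x i) (y i)) :
    Structure.RelMap r x ↔ Structure.RelMap r y := by
  match n, r with
  | _, .inr r => exact r.elim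
  | _, .inl .lt =>
    change ml (x 0) (x 1) ↔ ml (y 0) (y 1)
    rcases hxy 0 with ⟨h1, h2⟩ | ⟨g, hg, h1, h2⟩
    · rw [h1, h2]
      exact iff_of_false (g_ml2 _) (g_ml2 _)
    rcases hxy 1 with ⟨h3, h4⟩ | ⟨g', hg', h3, h4⟩
    · rw [h1, h2, h3, h4]
      exact iff_of_true (g_ml1 _) (g_ml1 _)
    rw [h1, h2, h3, h4, g_ml, g_ml]
    exact H.lt_iff' hg hg'

theorem graphRel_eq_iff (H : PIso ψ φ G P) {x x' : Ginf ψ} {y y' : Ginf φ}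
    (h : graphRel ψ φ G x y) (h' : graphRel ψ φ G x' y') : x = x' ↔ y = y' := by
  rcases h with ⟨rfl, rfl⟩ | ⟨g, hg, rfl, rfl⟩ <;> rcases h' with ⟨rfl, rfl⟩ | ⟨g', hg', rfl, rfl⟩
  · simp
  · simp
  · simp
  · rw [co_inj, co_inj]
    exact H.eq_iff' hg hg'

theorem exists_extension_apply (hψ : IsLogCouple ψ) (hφ : IsLogCouple φ) (hs : IsSaturated φ)
    (H : PIso ψ φ G P) (hG : (G : Set (Γ × Δ)).Countable) (hP : P.Countable) (x : Ginf ψ) :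
    ∃ G' P', G ≤ G' ∧ PIso ψ φ G' P' ∧ P' ⊆ G' ∧ (G' : Set (Γ × Δ)).Countable ∧
      ∃ y, graphRel ψ φ G' x y := by
  have key : ∀ c : Γ, ∃ G' P', G ≤ G' ∧ PIso ψ φ G' P' ∧ P' ⊆ G' ∧
      (G' : Set (Γ × Δ)).Countable ∧ ∃ g ∈ G', g.1 = c := by
    intro c
    obtain ⟨A, hA, hAc, hX⟩ := exists_isClosedSubspace hψ
      (X := insert c (Prod.fst '' (G : Set (Γ × Δ)) ∪ Prod.fst '' P))
      (((hG.image _).union (hP.image _)).insert c)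
    obtain ⟨G', P', h1, h2, h3, h4, h5⟩ := H.exists_extension hψ hφ hs A hA hAc
      (fun g hg => hX (Or.inr (Or.inl ⟨g, hg, rfl⟩)))
      (fun p hp => hX (Or.inr (Or.inr ⟨p, hp, rfl⟩)))
    exact ⟨G', P', h1, h2, h3, h4, h5 c (hX (Or.inl rfl))⟩
  rcases ginf_cases x with rfl | ⟨c, rfl⟩
  · obtain ⟨G', P', h1, h2, h3, h4, -⟩ := key 0
    exact ⟨G', P', h1, h2, h3, h4, _, graphRel_infty G'⟩
  · obtain ⟨G', P', h1, h2, h3, h4, g, hg, rfl⟩ := key c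
    exact ⟨G', P', h1, h2, h3, h4, _, graphRel_co hg⟩

/-- Countable partial isomorphisms between saturated couples preserve all formulas. -/
theorem realize_iff (hψ : IsLogCouple ψ) (hφ : IsLogCouple φ) (hsψ : IsSaturated ψ)
    (hsφ : IsSaturated φ) (H : PIso ψ φ G P) (hG : (G : Set (Γ × Δ)).Countable)
    (hP : P.Countable) {α : Type*} (χ : Llog.Formula α) {x : α → Ginf ψ} {y : α → Ginf φ}
    (hxy : ∀ a, graphRel ψ φ G (x a) (y a)) : χ.Realize x ↔ χ.Realize y := by
  -- A first extension only serves to achieve `P ⊆ G`, without which the relation need not respect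
  -- `ψ`, `s` and `p`.
  obtain ⟨G₀, P₀, hle, H₀, hPG₀, hG₀, -⟩ := H.exists_extension_apply hψ hφ hsφ hG hP (mi _)
  let S : Set (Ginf ψ → Ginf φ → Prop) := {R | ∃ G P, PIso ψ φ G P ∧ P ⊆ G ∧
    (G : Set (Γ × Δ)).Countable ∧ R = graphRel ψ φ G}
  refine realize_iff_of_backAndForth S ?_ ?_ ?_ ?_ ?_ χ (R := graphRel ψ φ G₀)
    ⟨G₀, P₀, H₀, hPG₀, hG₀, rfl⟩ (fun a => graphRel_mono hle (hxy a)) (fun i => i.elim0)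
  · rintro _ ⟨G, P, H, hPG, -, rfl⟩
    exact H.graphRel_funMap hψ hφ hPG
  · rintro _ ⟨G, P, H, hPG, -, rfl⟩
    exact H.graphRel_relMap
  · rintro _ ⟨G, P, H, hPG, -, rfl⟩ x y x' y' h h'
    exact H.graphRel_eq_iff h h'
  · rintro _ ⟨G, P, H, hPG, hG, rfl⟩ x
    obtain ⟨G', P', h1, h2, h3, h4, h5⟩ :=
      H.exists_extension_apply hψ hφ hsφ hG (hG.mono hPG) x
    exact ⟨_, ⟨G', P', h2, h3, h4, rfl⟩, fun a b => graphRel_mono h1, h5⟩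
  · rintro _ ⟨G, P, H, hPG, hG, rfl⟩ y
    obtain ⟨G', P', h1, h2, h3, h4, x, h5⟩ :=
      H.symm.exists_extension_apply hφ hψ hsψ (hG.preimage Prod.swap_injective)
        ((hG.mono hPG).preimage Prod.swap_injective) y
    refine ⟨_, ⟨_, _, h2.symm, fun p hp => h3 hp, h4.preimage Prod.swap_injective, rfl⟩, ?_, x, ?_⟩
    · exact fun a b => graphRel_mono fun g hg => h1 (x := g.swap) hg
    · rcases h5 with ⟨rfl, rfl⟩ | ⟨g, hg, rfl, rfl⟩
      · exact graphRel_infty _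
      · exact Or.inr ⟨g.swap, hg, rfl, rfl⟩

/-- If `G` preserves order and is closed under the operations, then `P` can be read off from `G`;
predecessors of `ψ`-values and of successors supply the required points `u`. -/
theorem of_closed (hψ : IsLogCouple ψ) (hφ : IsLogCouple φ)
    (hpos : ∀ g ∈ G, (0 < g.1 ↔ 0 < g.2))
    (hpsi : ∀ g ∈ G, g.1 ≠ 0 → (ψ g.1, φ g.2) ∈ G)
    (hsucc : ∀ g ∈ G, (succ ψ g.1, succ φ g.2) ∈ G)
    (hpred : ∀ g ∈ G, g.1 ∈ PsiSet ψ → ∃ u ∈ G, u.1 ∈ PsiZero ψ ∧ u.2 ∈ PsiZero φ ∧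
      g = (succ ψ u.1, succ φ u.2)) :
    PIso ψ φ G {p | p ∈ G ∧ p.1 ∈ PsiZero ψ ∧ p.2 ∈ PsiZero φ} := by
  have hlt : ∀ p ∈ G, ∀ q ∈ G, (p.1 < q.1 ↔ p.2 < q.2) := by
    intro p hp q hq
    rw [← sub_pos, ← sub_pos (a := q.2)]
    exact hpos _ (G.sub_mem hq hp)
  refine ⟨⟨G.zero_mem, Or.inl rfl, Or.inl rfl⟩, fun p hp => hp.2.1, fun p hp => hp.2.2,
    fun p hp q hq => hlt p hp.1 q hq.1,
    fun p hp => ⟨hsucc p hp.1, hψ.succ_mem' _, hφ.succ_mem' _⟩, ?_, hpos, ?_, ?_, ?_⟩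
  · rintro p ⟨hp, h1, h2⟩
    rcases h1 with h1 | h1
    · refine Or.inl (Prod.ext h1 ?_)
      have h3 := (hlt p hp 0 G.zero_mem).not.1 (by rw [h1]; exact lt_irrefl _)
      have h4 := (hlt 0 G.zero_mem p hp).not.1 (by rw [h1]; exact lt_irrefl _)
      exact le_antisymm (not_lt.1 h4) (not_lt.1 h3)
    · obtain ⟨u, hu, h3, h4, rfl⟩ := hpred p hp h1
      exact Or.inr ⟨u, ⟨hu, h3, h4⟩, rfl⟩
  · intro g hg h0
    have h0' : g.2 ≠ 0 := by
      intro h0'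
      have h3 := (hlt g hg 0 G.zero_mem).not.2 (by rw [h0']; exact lt_irrefl _)
      have h4 := (hlt 0 G.zero_mem g hg).not.2 (by rw [h0']; exact lt_irrefl _)
      exact h0 (le_antisymm (not_lt.1 h4) (not_lt.1 h3))
    obtain ⟨u, hu, h3, h4, h5⟩ := hpred _ (hpsi g hg h0) ⟨g.1, h0, rfl⟩
    refine ⟨u, ⟨hu, h3, h4⟩, hu, ?_, ?_⟩
    · rw [val_of_ne h0]
      exact congrArg _ (congrArg Prod.fst h5)
    · rw [val_of_ne h0']
      exact congrArg _ (congrArg Prod.snd h5)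
  · intro g hg
    obtain ⟨u, hu, h3, h4, h5⟩ := hpred _ (hsucc g hg) (hψ.succ_mem _)
    exact ⟨u, ⟨hu, h3, h4⟩, hu, (Prod.ext_iff.1 h5).1, (Prod.ext_iff.1 h5).2⟩
  · exact fun g hg => hlt g hg _ (hsucc g hg)

/-- The least partial isomorphism. -/
theorem bot (hψ : IsLogCouple ψ) (hφ : IsLogCouple φ) :
    PIso ψ φ ⊥ (Set.range fun n : ℕ => ((succ ψ)^[n] 0, (succ φ)^[n] 0)) where
  zero_mem := ⟨0, rfl⟩
  mem_fst := by
    rintro _ ⟨n, rfl⟩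
    exact hψ.iterate_mem (Or.inl rfl) n
  mem_snd := by
    rintro _ ⟨n, rfl⟩
    exact hφ.iterate_mem (Or.inl rfl) n
  lt_iff := by
    rintro _ ⟨n, rfl⟩ _ ⟨m, rfl⟩
    exact (hψ.iterate_strictMono (Or.inl rfl)).lt_iff_lt.trans
      (hφ.iterate_strictMono (Or.inl rfl)).lt_iff_lt.symm
  succ_mem := by
    rintro _ ⟨n, rfl⟩
    exact ⟨n + 1, by simp only [Function.iterate_succ_apply']⟩
  pred_mem := by
    rintro _ ⟨_ | n, rfl⟩
    · exact Or.inl rfl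
    · exact Or.inr ⟨_, ⟨n, rfl⟩, by simp only [Function.iterate_succ_apply']⟩
  pos_iff := by simp
  val_mem := by simp
  succ_eq := by
    rintro g hg
    rw [(Submodule.mem_bot ℚ).1 hg]
    exact ⟨0, ⟨0, rfl⟩, Submodule.zero_mem _, rfl, rfl⟩
  lt_succ_iff := by
    rintro g hg
    rw [(Submodule.mem_bot ℚ).1 hg]
    exact iff_of_true hψ.succ_zero_pos hφ.succ_zero_pos

end PIso

/-! ### Tuples with the same quantifier-free type -/

/-- The finite pairs `(t(x), t(y))`, for terms `t`, form the graph of a partial isomorphism: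
equality and order of term values are quantifier-free. The symbols `δ_n` make it a rational subspace
and `p` closes it under predecessors. -/
theorem realize_iff_of_isQF (hψ : IsLogCouple ψ) (hφ : IsLogCouple φ) (hsψ : IsSaturated ψ)
    (hsφ : IsSaturated φ) {n : ℕ} {x : Fin n → Ginf ψ} {y : Fin n → Ginf φ}
    (hxy : ∀ θ : Llog.Formula (Fin n), BoundedFormula.IsQF θ → (θ.Realize x ↔ θ.Realize y))
    (χ : Llog.Formula (Fin n)) : χ.Realize x ↔ χ.Realize y := by
  have heq : ∀ t₁ t₂ : Llog.Term (Fin n),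
      t₁.realize x = t₂.realize x ↔ t₁.realize y = t₂.realize y := by
    intro t₁ t₂
    have := hxy (Term.equal t₁ t₂) (BoundedFormula.IsAtomic.equal _ _).isQF
    rwa [Formula.realize_equal, Formula.realize_equal] at this
  have hlt : ∀ t₁ t₂ : Llog.Term (Fin n),
      ml (t₁.realize x) (t₂.realize x) ↔ ml (t₁.realize y) (t₂.realize y) := by
    intro t₁ t₂
    have := hxy (Relations.formula₂ (L := Llog) (Sum.inl L0Rel.lt) t₁ t₂)
      (BoundedFormula.IsAtomic.rel _ _).isQF
    exact (Formula.realize_rel₂ (L := Llog)).symm.trans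
      (this.trans (Formula.realize_rel₂ (L := Llog)))
  let zeroT : Llog.Term (Fin n) := Constants.term (L := Llog) (Sum.inl L0Func.zero)
  let inftyT : Llog.Term (Fin n) := Constants.term (L := Llog) (Sum.inl L0Func.infty)
  let addT : Llog.Term (Fin n) → Llog.Term (Fin n) → Llog.Term (Fin n) :=
    Functions.apply₂ (L := Llog) (Sum.inl L0Func.add)
  let negT : Llog.Term (Fin n) → Llog.Term (Fin n) :=
    Functions.apply₁ (L := Llog) (Sum.inl L0Func.neg)
  let psiT : Llog.Term (Fin n) → Llog.Term (Fin n) :=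
    Functions.apply₁ (L := Llog) (Sum.inl L0Func.psi)
  let newT : NewFunc 1 → Llog.Term (Fin n) → Llog.Term (Fin n) := fun f =>
    Functions.apply₁ (L := Llog) (Sum.inr f)
  have zx : zeroT.realize x = co ψ 0 := Term.realize_constants
  have zy : zeroT.realize y = co φ 0 := Term.realize_constants
  have ix : inftyT.realize x = mi _ := Term.realize_constants
  have iy : inftyT.realize y = mi _ := Term.realize_constants
  have ax : ∀ t s, (addT t s).realize x = ma (t.realize x) (s.realize x) := fun t s =>
    Term.realize_functions_apply₂
  have ay : ∀ t s, (addT t s).realize y = ma (t.realize y) (s.realize y) := fun t s =>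
    Term.realize_functions_apply₂
  have nx : ∀ t, (negT t).realize x = mn (t.realize x) := fun t => Term.realize_functions_apply₁
  have ny : ∀ t, (negT t).realize y = mn (t.realize y) := fun t => Term.realize_functions_apply₁
  have px : ∀ t, (psiT t).realize x = mp (t.realize x) := fun t => Term.realize_functions_apply₁
  have py : ∀ t, (psiT t).realize y = mp (t.realize y) := fun t => Term.realize_functions_apply₁
  have fx : ∀ f t, (newT f t).realize x = newMap f (t.realize x) := fun f t =>
    Term.realize_functions_apply₁
  have fy : ∀ f t, (newT f t).realize y = newMap f (t.realize y) := fun f t =>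
    Term.realize_functions_apply₁
  let A₀ : AddSubgroup (Γ × Δ) :=
    { carrier := {g | ∃ t : Llog.Term (Fin n), t.realize x = co ψ g.1 ∧ t.realize y = co φ g.2}
      zero_mem' := ⟨zeroT, zx, zy⟩
      add_mem' := by
        rintro a b ⟨t, h1, h2⟩ ⟨s, h3, h4⟩
        exact ⟨addT t s, by rw [ax, h1, h3, g_ma]; rfl, by rw [ay, h2, h4, g_ma]; rfl⟩
      neg_mem' := by
        rintro a ⟨t, h1, h2⟩
        exact ⟨negT t, by rw [nx, h1, g_mn]; rfl, by rw [ny, h2, g_mn]; rfl⟩ }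
  let G : Submodule ℚ (Γ × Δ) := ratSubmodule A₀ fun k g hg => by
    obtain ⟨t, h1, h2⟩ := hg
    exact ⟨newT (.delta k) t, by rw [fx, h1, newMap_delta hψ]; rfl,
      by rw [fy, h2, newMap_delta hφ]; rfl⟩
  have hfin : ∀ t : Llog.Term (Fin n), t.realize x = mi _ ↔ t.realize y = mi _ := by
    intro t
    rw [← ix, heq, iy]
  have hzero : ∀ (t : Llog.Term (Fin n)) (g : Γ × Δ), t.realize x = co ψ g.1 →
      t.realize y = co φ g.2 → (g.1 = 0 ↔ g.2 = 0) := by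
    intro t g h1 h2
    have := heq t zeroT
    rwa [zx, zy, h1, h2, co_inj, co_inj] at this
  have H : PIso ψ φ G _ := PIso.of_closed hψ hφ ?_ ?_ ?_ ?_
  rotate_left
  · rintro g ⟨t, h1, h2⟩
    have := hlt zeroT t
    rwa [zx, zy, h1, h2, g_ml, g_ml] at this
  · rintro g ⟨t, h1, h2⟩ h0
    exact ⟨psiT t, by rw [px, h1, g_mp h0],
      by rw [py, h2, g_mp ((hzero t g h1 h2).not.1 h0)]⟩
  · rintro g ⟨t, h1, h2⟩
    exact ⟨newT .succ t, by rw [fx, h1, newMap_succ], by rw [fy, h2, newMap_succ]⟩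
  · rintro ⟨a, b⟩ ⟨t, h1, h2⟩ (ha : a ∈ PsiSet ψ)
    change t.realize x = co ψ a at h1
    change t.realize y = co φ b at h2
    -- At `s 0` the predecessor is `0`, where `p` would give `∞`; there the equation `t = s 0` is
    -- transferred instead.
    rcases (hψ.least.2 ha).eq_or_lt with h0 | h0
    · refine ⟨0, G.zero_mem, Or.inl rfl, Or.inl rfl, Prod.ext h0.symm ?_⟩
      have := heq t (newT .succ zeroT)
      rw [fx, fy, zx, zy, newMap_succ, newMap_succ, h1, h2, co_inj, co_inj] at this
      exact this.1 h0.symm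
    · obtain ⟨u, hu, rfl⟩ := hψ.succ_bijOn.surjOn ⟨ha, h0⟩
      have h3 : (newT .pred t).realize x = co ψ u := by rw [fx, h1, newMap_pred hψ hu]
      -- Membership in `Ψ` above `s 0` is quantifier-free: it says that `p` does not take the value
      -- `∞`.
      have h4 : b ∈ PsiSet φ ∧ succ φ 0 < b := by
        by_contra h4
        have h5 : (newT .pred t).realize y = mi _ := by rw [fy, h2, newMap_pred_of_not h4]
        rw [← hfin, h3] at h5
        exact co_ne _ h5
      obtain ⟨v, hv, rfl⟩ := hφ.succ_bijOn.surjOn h4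
      exact ⟨(u, v), ⟨newT .pred t, h3, by rw [fy, h2, newMap_pred hφ hv]⟩, Or.inr hu, Or.inr hv,
        rfl⟩
  have hcount : (G : Set (Γ × Δ)).Countable := by
    have hc := countable_llog_functions
    let vx : Ginf ψ → Γ := fun z => WithTop.untopD (α := Γ) 0 z
    let vy : Ginf φ → Δ := fun z => WithTop.untopD (α := Δ) 0 z
    refine (Set.countable_range fun t : Llog.Term (Fin n) =>
      (vx (t.realize x), vy (t.realize y))).mono ?_
    rintro g ⟨t, h1, h2⟩
    refine ⟨t, ?_⟩
    simp only [h1, h2]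
    rfl
  refine H.realize_iff hψ hφ hsψ hsφ hcount (hcount.mono fun p hp => hp.1) χ fun i => ?_
  have hv := hfin (Term.var i)
  rw [Term.realize_var, Term.realize_var] at hv
  rcases ginf_cases (x i) with h1 | ⟨a, h1⟩
  · rw [h1, hv.1 h1]
    exact graphRel_infty G
  · rcases ginf_cases (y i) with h2 | ⟨b, h2⟩
    · rw [hv.2 h2] at h1
      exact absurd h1 (co_ne2 _)
    · exact Or.inr ⟨(a, b), ⟨Term.var i, h1, h2⟩, h1, h2⟩

end Graph


/-! ### A model: lexicographically ordered finitely supported sequences of rationals -/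

section Model

/-- Finitely supported sequences of rationals, ordered lexicographically. -/
abbrev LexSeq : Type := Lex (ℕ →₀ ℚ)

namespace LexSeq

/-- The `k`-th coordinate. -/
def coord (k : ℕ) : LexSeq →+ ℚ where
  toFun a := ofLex a k
  map_zero' := rfl
  map_add' _ _ := rfl

theorem ext_coord {a b : LexSeq} (h : ∀ k, coord k a = coord k b) : a = b :=
  Finsupp.ext (f := ofLex a) (g := ofLex b) h

theorem lt_iff {a b : LexSeq} :
    a < b ↔ ∃ n, (∀ k < n, coord k a = coord k b) ∧ coord n a < coord n b :=
  Iff.rfl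

/-- The least index of a nonzero coordinate. -/
noncomputable def lead (a : LexSeq) : ℕ := sInf {k | coord k a ≠ 0}

theorem coord_lead {a : LexSeq} (ha : a ≠ 0) : coord (lead a) a ≠ 0 := by
  refine Nat.sInf_mem (s := {k | coord k a ≠ 0}) ?_
  by_contra h
  rw [Set.not_nonempty_iff_eq_empty, Set.eq_empty_iff_forall_notMem] at h
  exact ha (ext_coord fun k => (not_not.1 (h k)).trans (map_zero _).symm)

theorem coord_eq_zero {a : LexSeq} {k : ℕ} (hk : k < lead a) : coord k a = 0 :=
  not_not.1 (Nat.notMem_of_lt_sInf hk)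

theorem lead_le {a : LexSeq} {k : ℕ} (hk : coord k a ≠ 0) : lead a ≤ k := Nat.sInf_le hk

theorem lead_eq {a : LexSeq} {n : ℕ} (h : ∀ k < n, coord k a = 0) (hn : coord n a ≠ 0) :
    lead a = n := by
  refine le_antisymm (lead_le hn) (not_lt.1 fun hlt => ?_)
  refine coord_lead (a := a) ?_ (h _ hlt)
  rintro rfl
  exact hn (map_zero _)

theorem pos_iff {a : LexSeq} : 0 < a ↔ 0 < coord (lead a) a := by
  rw [lt_iff]
  constructor
  · rintro ⟨n, h1, h2⟩
    simp only [map_zero] at h1 h2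
    rwa [lead_eq (fun k hk => (h1 k hk).symm) h2.ne']
  · intro h
    exact ⟨lead a, fun k hk => by rw [coord_eq_zero hk, map_zero], by rwa [map_zero]⟩

/-- The sequence with `n + 1` leading ones and all other coordinates `0`. -/
noncomputable def ones (n : ℕ) : LexSeq :=
  toLex (Finsupp.onFinset (Finset.range (n + 1)) (fun k => if k ≤ n then 1 else 0) fun _ hk =>
    Finset.mem_range_succ_iff.2 (not_not.1 fun h => hk (if_neg h)))

theorem coord_ones (n k : ℕ) : coord k (ones n) = if k ≤ n then 1 else 0 :=
  rfl

theorem ones_strictMono : StrictMono ones := by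
  refine strictMono_nat_of_lt_succ fun n => lt_iff.2 ⟨n + 1, fun k hk => ?_, ?_⟩
  · rw [coord_ones, coord_ones, if_pos (Nat.lt_succ_iff.1 hk), if_pos hk.le]
  · simp [coord_ones]

/-- `ψ a` has as many leading ones as needed to reach the first nonzero coordinate of `a`. -/
noncomputable def psi (a : LexSeq) : LexSeq := ones (lead a)

theorem exists_coord_ne_one (a : LexSeq) : ∃ n, coord n a ≠ 1 := by
  obtain ⟨n, hn⟩ := Infinite.exists_notMem_finset (ofLex a).support
  refine ⟨n, ?_⟩
  rw [show coord n a = 0 from Finsupp.notMem_support_iff.1 hn]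
  exact zero_ne_one

theorem lead_sub_ones {a : LexSeq} {n : ℕ} (h : ∀ k < n, coord k a = 1) (hn : coord n a ≠ 1) :
    lead (a - ones n) = n := by
  refine lead_eq (fun k hk => ?_) ?_
  · rw [map_sub, coord_ones, if_pos hk.le, h k hk, sub_self]
  · rw [map_sub, coord_ones, if_pos le_rfl]
    exact sub_ne_zero.2 hn

theorem ne_zero_of_coord {a : LexSeq} {n : ℕ} (h : coord n a ≠ 0) : a ≠ 0 := by
  rintro rfl
  exact h (map_zero _)

/-- Subtracting `ones n`, where `n` is the first index with coordinate different from `1`, leaves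
leading index exactly `n`. Finite support guarantees such an index, hence asymptotic integration. -/
theorem integral_spec' {a : LexSeq} {n : ℕ} (h : ∀ k < n, coord k a = 1) (hn : coord n a ≠ 1) :
    a - ones n ≠ 0 ∧ a - ones n + psi (a - ones n) = a := by
  refine ⟨ne_zero_of_coord (n := n) ?_, ?_⟩
  · rw [map_sub, coord_ones, if_pos le_rfl]
    exact sub_ne_zero.2 hn
  · rw [psi, lead_sub_ones h hn, sub_add_cancel]

theorem isCouple_psi : IsCouple psi where
  ac1 a b ha hb hab := by
    rw [psi, psi, psi, ← ones_strictMono.monotone.map_min]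
    refine ones_strictMono.monotone (not_lt.1 fun hlt => coord_lead hab ?_)
    rw [map_add, coord_eq_zero (hlt.trans_le (min_le_left _ _)),
      coord_eq_zero (hlt.trans_le (min_le_right _ _)), add_zero]
  ac2 r a hr ha := by
    rw [psi, psi, lead_eq (n := lead a)]
    · intro k hk
      rw [map_zsmul, coord_eq_zero hk, smul_zero]
    · rw [map_zsmul]
      exact smul_ne_zero hr (coord_lead ha)
  ac3 a b ha hb := by
    have h1 := pos_iff.1 ha
    rcases le_or_gt (lead b) (lead a) with h | h
    · exact (ones_strictMono.monotone h).trans_lt (lt_add_of_pos_left _ ha)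
    -- Both sides have ones before `lead a`; at that index `psi b` has `1` while `a + psi a` has `1`
    -- plus a positive number.
    · refine lt_iff.2 ⟨lead a, fun k hk => ?_, ?_⟩
      · rw [map_add, psi, psi, coord_ones, coord_ones, coord_eq_zero hk, if_pos hk.le,
          if_pos (hk.trans h).le, zero_add]
      · rw [map_add, psi, psi, coord_ones, coord_ones, if_pos le_rfl, if_pos h.le]
        exact lt_add_of_pos_left _ h1

theorem succ_psi {a : LexSeq} {n : ℕ} (h : ∀ k < n, coord k a = 1) (hn : coord n a ≠ 1) :
    succ psi a = ones n := by
  have h1 := integral_spec' h hn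
  have h2 : integral psi a ≠ 0 ∧ integral psi a + psi (integral psi a) = a :=
    Classical.epsilon_spec (p := fun b => b ≠ 0 ∧ b + psi b = a) ⟨_, h1⟩
  rw [succ, isCouple_psi.integral_unique h2.1 h1.1 (h2.2.trans h1.2.symm), psi,
    lead_sub_ones h hn]

theorem succ_psi_zero : succ psi 0 = ones 0 :=
  succ_psi (fun k hk => absurd hk k.not_lt_zero) (by rw [map_zero]; exact zero_ne_one)

theorem succ_psi_ones (n : ℕ) : succ psi (ones n) = ones (n + 1) :=
  succ_psi (fun k hk => by rw [coord_ones, if_pos (Nat.lt_succ_iff.1 hk)])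
    (by rw [coord_ones, if_neg (by lia)]; exact zero_ne_one)

theorem psiSet_psi : PsiSet psi = Set.range ones := by
  ext a
  constructor
  · rintro ⟨b, -, rfl⟩
    exact ⟨_, rfl⟩
  · rintro ⟨n, rfl⟩
    -- The `n`-th unit vector; the case distinction avoids truncated subtraction at `n = 0`.
    refine ⟨ones n - if n = 0 then 0 else ones (n - 1), ?_, ?_⟩
    · refine ne_zero_of_coord (n := n) ?_
      rcases n with _ | n <;> simp [coord_ones]
    · rw [psi, lead_eq (n := n)]
      · intro k hk
        rcases n with _ | n
        · exact absurd hk k.not_lt_zero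
        · simp [coord_ones, hk.le, Nat.lt_succ_iff.1 hk]
      · rcases n with _ | n <;> simp [coord_ones]

theorem isLogCouple_psi : IsLogCouple psi where
  toIsCouple := isCouple_psi
  hType a b ha hab := by
    refine ones_strictMono.monotone (not_lt.1 fun hlt => not_lt.2 hab ?_)
    refine lt_iff.2 ⟨lead a, fun k hk => ?_, ?_⟩
    · rw [coord_eq_zero hk, coord_eq_zero (hk.trans hlt)]
    · rw [coord_eq_zero hlt]
      exact pos_iff.1 ha
  divisible n a := by
    refine ⟨toLex ((n : ℚ)⁻¹ • ofLex a), ext_coord fun k => ?_⟩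
    have : ((n : ℕ) : ℚ) ≠ 0 := by exact_mod_cast n.ne_zero
    rw [map_nsmul, nsmul_eq_mul]
    exact mul_inv_cancel_left₀ this _
  integration a := by
    classical
    have h := exists_coord_ne_one a
    exact ⟨_, integral_spec' (fun k hk => not_not.1 (Nat.find_min h hk)) (Nat.find_spec h)⟩
  least := by
    rw [psiSet_psi, succ_psi_zero]
    refine ⟨⟨0, rfl⟩, ?_⟩
    rintro _ ⟨n, rfl⟩
    exact ones_strictMono.monotone n.zero_le
  succ_zero_pos := by
    rw [succ_psi_zero]
    exact lt_iff.2 ⟨0, fun k hk => absurd hk k.not_lt_zero, by simp [coord_ones]⟩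
  succ_isLeast := by
    rw [psiSet_psi]
    rintro _ ⟨n, rfl⟩
    rw [succ_psi_ones]
    refine ⟨⟨⟨_, rfl⟩, ones_strictMono n.lt_succ_self⟩, ?_⟩
    rintro _ ⟨⟨m, rfl⟩, hm⟩
    exact ones_strictMono.monotone (ones_strictMono.lt_iff_lt.1 hm)
  succ_bijOn := by
    rw [psiSet_psi, succ_psi_zero]
    refine ⟨?_, ?_, ?_⟩
    · rintro _ ⟨n, rfl⟩
      rw [succ_psi_ones]
      exact ⟨⟨_, rfl⟩, ones_strictMono n.succ_pos⟩
    · rintro _ ⟨n, rfl⟩ _ ⟨m, rfl⟩ h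
      rw [succ_psi_ones, succ_psi_ones, ones_strictMono.injective.eq_iff] at h
      rw [Nat.succ_injective h]
    · rintro _ ⟨⟨_ | n, rfl⟩, hm⟩
      · exact absurd hm (lt_irrefl _)
      · exact ⟨ones n, ⟨n, rfl⟩, succ_psi_ones n⟩

end LexSeq

theorem ginf_Tlog {Γ : Type u} [AddCommGroup Γ] [LinearOrder Γ] [IsOrderedAddMonoid Γ] {ψ : Γ → Γ}
    (h : IsLogCouple ψ) : Ginf ψ ⊨ Tlog :=
  (model_Tlog_iff _).2 ⟨Γ, _, _, inferInstance, ψ, h, ⟨Language.Equiv.refl _ _⟩⟩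

instance {Γ : Type u} [AddCommGroup Γ] [LinearOrder Γ] (ψ : Γ → Γ) : Nonempty (Ginf ψ) := ⟨mi _⟩

theorem isSatisfiable_Tlog : Tlog.IsSatisfiable := by
  have := ginf_Tlog LexSeq.isLogCouple_psi
  exact Theory.Model.isSatisfiable (Ginf LexSeq.psi)

end Model


/-! ### Completeness and quantifier elimination for `Tlog` -/

section Tlog

/-- Both models pass to saturated elementary extensions, which changes neither hypothesis nor
conclusion. -/
theorem realize_iff_of_models {M : Type u} {N : Type v} [Llog.Structure M] [Llog.Structure N]
    [Nonempty M] [Nonempty N] (hM : M ⊨ Tlog) (hN : N ⊨ Tlog) {n : ℕ} {x : Fin n → M}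
    {y : Fin n → N}
    (hxy : ∀ θ : Llog.Formula (Fin n), BoundedFormula.IsQF θ → (θ.Realize x ↔ θ.Realize y))
    (χ : Llog.Formula (Fin n)) : χ.Realize x ↔ χ.Realize y := by
  obtain ⟨Γ, _, _, _, ψ, i, hψ, hsψ, hi⟩ := exists_saturated hM
  obtain ⟨Δ, _, _, _, φ, j, hφ, hsφ, hj⟩ := exists_saturated hN
  obtain ⟨_⟩ := nonempty_ratModule hψ.divisible
  obtain ⟨_⟩ := nonempty_ratModule hφ.divisible
  rw [← hi, ← hj]
  refine realize_iff_of_isQF hψ hφ hsψ hsφ (fun θ hθ => ?_) χ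
  rw [hi, hj, hxy θ hθ]

theorem hasQE_Tlog : HasQE Tlog :=
  hasQE_of_realize_iff _ fun M N _ _ _ h χ =>
    (realize_iff_of_models M.is_model N.is_model h χ).1

/-- The least partial isomorphism exists between any two couples, so no parameters need to be
matched. -/
theorem elementarilyEquivalent_of_models {M : Type u} {N : Type v} [Llog.Structure M]
    [Llog.Structure N] [Nonempty M] [Nonempty N] (hM : M ⊨ Tlog) (hN : N ⊨ Tlog) :
    Llog.ElementarilyEquivalent M N := by
  obtain ⟨Γ, _, _, _, ψ, i, hψ, hsψ, hi⟩ := exists_saturated hM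
  obtain ⟨Δ, _, _, _, φ, j, hφ, hsφ, hj⟩ := exists_saturated hN
  obtain ⟨_⟩ := nonempty_ratModule hψ.divisible
  obtain ⟨_⟩ := nonempty_ratModule hφ.divisible
  rw [elementarilyEquivalent_iff]
  intro χ
  rw [Sentence.Realize, Sentence.Realize, ← hi, ← hj]
  refine (PIso.bot hψ hφ).realize_iff hψ hφ hsψ hsφ ?_ (Set.countable_range _) χ fun a => a.elim
  simp

theorem isComplete_Tlog : Tlog.IsComplete :=
  Theory.IsComplete.isComplete_iff_models_elementarily_equivalent.2 ⟨isSatisfiable_Tlog, fun M N =>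
    elementarilyEquivalent_of_models M.is_model N.is_model⟩

end Tlog

/-! ### Completeness and model completeness for `T0` -/

section T0

theorem isSatisfiable_T0 : T0.IsSatisfiable :=
  have := ginf_T0_iff.2 LexSeq.isLogCouple_psi
  Theory.Model.isSatisfiable (Ginf LexSeq.psi)

theorem isComplete_T0 : T0.IsComplete := by
  refine Theory.IsComplete.isComplete_iff_models_elementarily_equivalent.2
    ⟨isSatisfiable_T0, fun M N => ?_⟩
  obtain ⟨Γ, _, _, _, ψ, hψ, ⟨e⟩⟩ := (model_T0_iff M).1 M.is_model
  obtain ⟨Δ, _, _, _, φ, hφ, ⟨e'⟩⟩ := (model_T0_iff N).1 N.is_model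
  have h := elementarilyEquivalent_iff.1
    (elementarilyEquivalent_of_models (ginf_Tlog hψ) (ginf_Tlog hφ))
  rw [elementarilyEquivalent_iff]
  intro χ
  have h1 := h ((LHom.sumInl (L := L0) (L' := Lnew)).onSentence χ)
  rw [LHom.realize_onSentence, LHom.realize_onSentence] at h1
  rw [StrongHomClass.realize_sentence e, StrongHomClass.realize_sentence e', h1]

/-! ### Embeddings of `L0`-structures. -/

section Embedding

variable {M : Type u} {N : Type v} [L0.Structure M] [L0.Structure N] (f : M ↪[L0] N)

theorem map_mz : f (mz M) = mz N :=
  (f.map_fun L0Func.zero _).trans (congrArg _ (Subsingleton.elim _ _))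

theorem map_mi : f (mi M) = mi N :=
  (f.map_fun L0Func.infty _).trans (congrArg _ (Subsingleton.elim _ _))

theorem map_ma (x y : M) : f (ma x y) = ma (f x) (f y) :=
  (f.map_fun L0Func.add _).trans (congrArg _ (by ext i; fin_cases i <;> rfl))

theorem map_mp (x : M) : f (mp x) = mp (f x) :=
  (f.map_fun L0Func.psi _).trans (congrArg _ (by ext i; fin_cases i; rfl))

theorem map_ml (x y : M) : ml (f x) (f y) ↔ ml x y := by
  refine Iff.trans (iff_of_eq (congrArg (Structure.RelMap (L := L0) L0Rel.lt) ?_))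
    (f.map_rel L0Rel.lt ![x, y])
  ext i; fin_cases i <;> rfl

theorem map_msmul (k : ℕ) (x : M) : f (msmul k x) = msmul k (f x) := by
  induction k with
  | zero => exact map_mz f
  | succ k ih => exact (map_ma f _ _).trans (by rw [ih]; rfl)

theorem map_mnz {x : M} (h : mnz x) : mnz (f x) :=
  ⟨fun h' => h.1 (f.injective (h'.trans (map_mz f).symm)),
    fun h' => h.2 (f.injective (h'.trans (map_mi f).symm))⟩

theorem map_mPsi {x : M} (h : mPsi x) : mPsi (f x) := by
  obtain ⟨z, hz, rfl⟩ := h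
  exact ⟨f z, map_mnz f hz, (map_mp f z).symm⟩

theorem map_mS {x y : M} (h : mS x y) : mS (f x) (f y) := by
  obtain ⟨h0, z, hz, rfl, rfl⟩ := h
  exact ⟨fun h' => h0 (f.injective (h'.trans (map_mi f).symm)), f z, map_mnz f hz,
    by rw [map_ma, map_mp], (map_mp f z).symm⟩

end Embedding

section GinfEmbedding

variable {Γ Δ : Type*} [AddCommGroup Γ] [LinearOrder Γ] [IsOrderedAddMonoid Γ]
  [AddCommGroup Δ] [LinearOrder Δ] [IsOrderedAddMonoid Δ] {ψ : Γ → Γ} {φ : Δ → Δ}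

theorem newMap_delta_eq_iff (h : IsLogCouple ψ) {k : ℕ+} {x y : Ginf ψ} :
    newMap (.delta k) x = y ↔ msmul k y = x := by
  refine (ginf_graphF h (.delta k) default x y).symm.trans ?_
  simp [graphF]

/-- `s` has an existential graph and `δ_k` inverts an `L0`-term. For `p` one needs that an embedding
also reflects `Ψ` above `s 0`, which uses injectivity of `s` on `Ψ`. -/
theorem map_newMap (hψ : IsLogCouple ψ) (hφ : IsLogCouple φ) (f : Ginf ψ ↪[L0] Ginf φ)
    (F : NewFunc 1) (x : Ginf ψ) : f (newMap F x) = newMap F (f x) := by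
  have hex : ∀ a, ∃ b, f (co ψ a) = co φ b := fun a => (ginf_cases _).resolve_left fun h =>
    co_ne a (f.injective (h.trans (map_mi f).symm))
  choose g hg using hex
  have hg0 : g 0 = 0 := by
    have := map_mz f
    rwa [g_mz, g_mz, hg, co_inj] at this
  have hinj : Function.Injective g := fun a b h => by
    rw [← co_inj (ψ := φ), ← hg, ← hg, f.injective.eq_iff, co_inj] at h
    exact h
  have hlt : ∀ a b, g a < g b ↔ a < b := fun a b => by
    rw [← g_ml (ψ := φ), ← hg, ← hg, map_ml, g_ml]
  have hsucc : ∀ a, g (succ ψ a) = succ φ (g a) := fun a => by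
    have := map_mS f ((g_mS hψ.toIsCouple hψ.integration a _).2 rfl)
    rw [hg, hg, g_mS hφ.toIsCouple hφ.integration] at this
    exact this.symm
  have hmem : ∀ a ∈ PsiSet ψ, g a ∈ PsiSet φ := fun a ha => by
    rw [← g_mPsi, ← hg]
    exact map_mPsi f ((g_mPsi a).2 ha)
  match F with
  | .succ =>
    rcases ginf_cases x with rfl | ⟨a, rfl⟩
    · rw [newMap_infty, map_mi, newMap_infty]
    · rw [newMap_succ, hg, hg, newMap_succ, hsucc]
  | .pred =>
    rcases ginf_cases x with rfl | ⟨a, rfl⟩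
    · rw [newMap_infty, map_mi, newMap_infty]
    rw [hg]
    by_cases ha : a ∈ PsiSet ψ ∧ succ ψ 0 < a
    · obtain ⟨b, hb, rfl⟩ := hψ.succ_bijOn.surjOn ha
      rw [hsucc, newMap_pred hψ hb, newMap_pred hφ (hmem b hb), hg]
    · rw [newMap_pred_of_not ha, newMap_pred_of_not, map_mi]
      rintro ⟨h1, h2⟩
      rw [← hg0, ← hsucc] at h2
      have h3 : succ ψ 0 < succ ψ a := by
        rw [← hlt]
        refine h2.trans ?_
        rw [hsucc]
        exact (hφ.succ_isLeast _ h1).1.2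
      -- If `g a` lies in `Ψ`, choose `b` in `Ψ` with the same successor as `a`; then `g b` and `g
      -- a` are points of `Ψ` with equal successors, so `a = b` is in `Ψ`.
      obtain ⟨b, hb, h4⟩ := hψ.succ_bijOn.surjOn ⟨hψ.succ_mem a, h3⟩
      have h5 := congrArg g h4
      rw [hsucc, hsucc] at h5
      have h6 := hinj (hφ.succ_bijOn.injOn (hmem b hb) h1 h5)
      exact ha ⟨h6 ▸ hb, (hlt _ _).1 h2⟩
  | .delta k =>
    symm
    rw [newMap_delta_eq_iff hφ, ← map_msmul, (newMap_delta_eq_iff hψ).1 rfl]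

/-- An `L0`-embedding between couples as in `IsLogCouple` is an `Llog`-embedding. -/
noncomputable def embeddingOfL0 (hψ : IsLogCouple ψ) (hφ : IsLogCouple φ)
    (f : Ginf ψ ↪[L0] Ginf φ) : Ginf ψ ↪[Llog] Ginf φ where
  toFun := f
  inj' := f.injective
  map_fun' {n} F x := by
    have hnew : ∀ (F : NewFunc 1) (x : Fin 1 → Ginf ψ),
        f (Structure.funMap (L := Lnew) F x) = Structure.funMap (L := Lnew) F (f ∘ x) := by
      intro F x
      rw [show x = ![x 0] by ext i; fin_cases i; rfl,
        show f ∘ ![x 0] = ![f (x 0)] by ext i; fin_cases i; rfl]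
      exact map_newMap hψ hφ f F (x 0)
    match n, F with
    | _, .inl F => exact f.map_fun F x
    | _, .inr .succ => exact hnew NewFunc.succ x
    | _, .inr .pred => exact hnew NewFunc.pred x
    | _, .inr (.delta k) => exact hnew (NewFunc.delta k) x
  map_rel' {n} r x := by
    match n, r with
    | _, .inl r => exact f.map_rel r x
    | _, .inr r => exact r.elim

end GinfEmbedding

/-- The inclusion becomes an `Llog`-embedding of couples; it preserves quantifier-free formulas both
ways, and tuples in models of `Tlog` with the same quantifier-free type satisfy the same formulas.
-/
theorem isModelComplete_T0 : IsModelComplete.{0, 0, w} T0 := by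
  intro N _ _ S _ hN hS n χ x
  obtain ⟨Γ, _, _, _, ψ, hψ, ⟨e⟩⟩ := (model_T0_iff S).1 hS
  obtain ⟨Δ, _, _, _, φ, hφ, ⟨e'⟩⟩ := (model_T0_iff N).1 hN
  let f : Ginf ψ ↪[L0] Ginf φ := e'.toEmbedding.comp (S.subtype.comp e.symm.toEmbedding)
  let f' := embeddingOfL0 hψ hφ f
  have h := realize_iff_of_models (ginf_Tlog hψ) (ginf_Tlog hφ) (x := e ∘ x) (y := f' ∘ e ∘ x)
    (fun θ hθ => by
      have := hθ.realize_embedding f' (v := e ∘ x) (xs := default)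
      rw [Formula.Realize, Formula.Realize, ← this]
      exact iff_of_eq (congrArg _ (Subsingleton.elim _ _)))
    ((LHom.sumInl (L := L0) (L' := Lnew)).onFormula χ)
  rw [LHom.realize_onFormula, LHom.realize_onFormula] at h
  have h2 : f' ∘ e ∘ x = e' ∘ ((↑) ∘ x : Fin n → N) := by
    ext i
    exact congrArg (fun z : S => e' z) (e.symm_apply_apply (x i))
  rw [h2, StrongHomClass.realize_formula, StrongHomClass.realize_formula] at h
  exact h.symm

end T0

end AsymCouple

theorem mainTheorem2 :
    (AsymCouple.Tlog.IsComplete ∧ AsymCouple.HasQE AsymCouple.Tlog) ∧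
    (AsymCouple.T0.IsComplete ∧ AsymCouple.IsModelComplete.{0, 0, w} AsymCouple.T0) :=
  ⟨⟨AsymCouple.isComplete_Tlog, AsymCouple.hasQE_Tlog⟩,
    AsymCouple.isComplete_T0, AsymCouple.isModelComplete_T0⟩
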